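/- Let $V:\mathbb R\to\mathbb R$ be convex, with $|V(x)|\le C(1+|x|)^K$ for all $x$ and some $C>0$, $K\ge 1$, and non-affine in the sense that $\lim_{x\to+\infty}V(x)/x>\lim_{x\to-\infty}V(x)/x$ (limits in $[-\infty,\infty]$). For $N\ge 2$ let $\Omega_N=\{x\in\mathbb R^{N+1}: x_0=x_N=0\}$, let $\pi_N$ be the probability measure on $\Omega_N$ with density proportional to $e^{-H(x)}$, $H(x)=\sum_{k=1}^N V(x_k-x_{k-1})$, with respect to $dx_1\cdots dx_{N-1}$, and let $P_t^x$ be the law at time $t$ of the Gibbs sampler started from $x$: the continuous time Markov chain on $\Omega_N$ in which each coordinate $x_k$, $1\le k\le N-1$, is independently resampled at rate $1$ from its conditional equilibrium law, of density $\rho_{b,c}(u)\propto e^{-V(u-b)-V(c-u)}$ with $b=x_{k-1}$, $c=x_{k+1}$; that is, the chain with generator $\mathcal L=\sum_{k=1}^{N-1}(\mathcal Q_k-1)$, where $\mathcal Q_k$ is this resampling of $x_k$. Let $d_N(t)=\sup_{x\in\Omega_N,\ |x|_\infty\le N}\|P_t^x-\pi_N\|_{TV}$, $T_N(\varepsilon)=\inf\{t\ge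 0: d_N(t)<\varepsilon\}$ and $\lambda_N=1-\cos(\pi/N)$. (i) For every $\delta>0$ and $\varepsilon\in(0,1)$ there is $N_0$ such that for all $N\ge N_0$, $$T_N(\varepsilon)\le\frac{2+\delta}{\lambda_N}\log N .$$ (ii) This bound is of the correct order: there is $c>0$ such that for every $\varepsilon\in(0,1)$ there is $N_0$ with $T_N(\varepsilon)\ge \frac{c}{\lambda_N}\log N$ for all $N\ge N_0$. (iii) Pre-cutoff holds: there is $C<\infty$ such that for all $\varepsilon\in(0,1/2)$, $$\limsup_{N\to\infty}\frac{T_N(\varepsilon)}{T_N(1-\varepsilon)}\le C .$$ -/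

import Mathlib

open MeasureTheory ProbabilityTheory Filter Topology Set
open scoped ENNReal NNReal

noncomputable section

namespace GradPhi

/-- The class of admissible potentials. The slopes at infinity may be infinite, so the limits
of `V x / x` are taken in the extended reals (they always exist for convex `V`). -/
structure IsAdmissible (V : ℝ → ℝ) : Prop where
  /-- `V` is convex. -/
  convex : ConvexOn ℝ univ V
  /-- `V` grows at most polynomially. -/
  growth : ∃ C K : ℝ, 0 < C ∧ 1 ≤ K ∧ ∀ x : ℝ, |V x| ≤ C * (1 + |x|) ^ K
  /-- `V` is non-affine: its slope at `+∞` exceeds its slope at `-∞`. -/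
  nonaffine : ∃ sp sm : EReal,
    Tendsto (fun x : ℝ => ((V x / x : ℝ) : EReal)) atTop (𝓝 sp) ∧
    Tendsto (fun x : ℝ => ((V x / x : ℝ) : EReal)) atBot (𝓝 sm) ∧ sm < sp

/-- The state space `{(x_0, …, x_N) : x_0 = x_N = 0}`, identified with the space of the free
coordinates `(x_k)`, `0 < k < N`. -/
abbrev Omega (N : ℕ) : Type := ↥(Finset.Ioo 0 N) → ℝ

/-- The height `x_i`, with the boundary values `x_0 = x_N = 0`. -/
def height {N : ℕ} (x : Omega N) (i : ℕ) : ℝ :=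
  if h : i ∈ Finset.Ioo 0 N then x ⟨i, h⟩ else 0

/-- The Hamiltonian `H(x) = ∑_{k=1}^N V(x_k - x_{k-1})`. -/
def hamiltonian (V : ℝ → ℝ) {N : ℕ} (x : Omega N) : ℝ :=
  ∑ k ∈ Finset.Icc 1 N, V (height x k - height x (k - 1))

/-- The Gibbs measure `π_N`, with density `e^{-H} / Z_N` with respect to `dx_1 ⋯ dx_{N-1}`. -/
def gibbs (V : ℝ → ℝ) (N : ℕ) : Measure (Omega N) :=
  volume.withDensity fun x =>
    ENNReal.ofReal (Real.exp (-hamiltonian V x) / ∫ y : Omega N, Real.exp (-hamiltonian V y))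

/-- The density `ρ_{b,c}` of the law of a height given the values `b`, `c` of its neighbours. -/
def rho (V : ℝ → ℝ) (b c u : ℝ) : ℝ :=
  Real.exp (-V (u - b) - V (c - u)) / ∫ s : ℝ, Real.exp (-V (s - b) - V (c - s))

/-- The kernel `x ↦ ρ_{x_{k-1}, x_{k+1}}(u) du` on the line. -/
def conditionalKernel (V : ℝ → ℝ) {N : ℕ} (k : ↥(Finset.Ioo 0 N)) : Kernel (Omega N) ℝ :=
  (Kernel.const (Omega N) (volume : Measure ℝ)).withDensity fun x u =>
    ENNReal.ofReal (rho V (height x (k - 1)) (height x (k + 1)) u)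

/-- The heat-bath update `𝒬_k`: the law of `x^{(k,u)}` with `u` drawn from `ρ_{x_{k-1},x_{k+1}}`. -/
def updateKernel (V : ℝ → ℝ) {N : ℕ} (k : ↥(Finset.Ioo 0 N)) : Kernel (Omega N) (Omega N) :=
  (Kernel.id ×ₖ conditionalKernel V k).map fun p => Function.update p.1 k p.2

/-- Unfolding of the update kernel for a measurable potential (a convex one is continuous). -/
lemma updateKernel_apply {V : ℝ → ℝ} (hV : Measurable V) {N : ℕ} (k : ↥(Finset.Ioo 0 N))
    (x : Omega N) :
    updateKernel V k x =
      ((volume : Measure ℝ).withDensity fun u =>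
        ENNReal.ofReal (rho V (height x (k - 1)) (height x (k + 1)) u)).map
          fun u => Function.update x k u := by
  have hh : ∀ i : ℕ, Measurable fun x : Omega N => height x i := by
    intro i
    unfold height
    split_ifs <;> fun_prop
  have hZ : StronglyMeasurable fun q : ℝ × ℝ =>
      ∫ s : ℝ, Real.exp (-V (s - q.1) - V (q.2 - s)) := by
    apply StronglyMeasurable.integral_prod_right
      (f := fun q : ℝ × ℝ => fun s => Real.exp (-V (s - q.1) - V (q.2 - s)))
    apply Measurable.stronglyMeasurable
    fun_prop
  have hr : Measurable fun p : (ℝ × ℝ) × ℝ => rho V p.1.1 p.1.2 p.2 := by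
    unfold rho
    apply Measurable.div
    · fun_prop
    · exact hZ.measurable.comp measurable_fst
  have hm : Measurable (Function.uncurry fun (x : Omega N) (u : ℝ) =>
      ENNReal.ofReal (rho V (height x (k - 1)) (height x (k + 1)) u)) := by
    apply ENNReal.measurable_ofReal.comp
    exact hr.comp ((((hh _).comp measurable_fst).prodMk ((hh _).comp measurable_fst)).prodMk
      measurable_snd)
  have h2 : Measurable fun p : Omega N × ℝ => Function.update p.1 k p.2 := by
    fun_prop
  have hs : IsSFiniteKernel (conditionalKernel V k) :=
    Kernel.IsSFiniteKernel.withDensity _ fun _ _ => ENNReal.ofReal_ne_top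
  unfold updateKernel
  rw [Kernel.map_apply _ h2, Kernel.prod_apply, Kernel.id_apply, Measure.dirac_prod,
    Measure.map_map h2 (by fun_prop)]
  unfold conditionalKernel
  rw [Kernel.withDensity_apply _ hm, Kernel.const_apply]
  rfl

/-- The sum `∑_k 𝒬_k` of the heat-bath updates, so that the generator of the Gibbs sampler is
`ℒ = ∑_k (𝒬_k - 1) = totalKernel - (N - 1)`. -/
def totalKernel (V : ℝ → ℝ) (N : ℕ) : Kernel (Omega N) (Omega N) :=
  ∑ k : ↥(Finset.Ioo 0 N), updateKernel V k

/-- The law `P_t^x` at time `t` of the continuous time Markov chain with the (bounded) generator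
`ℒ` and initial condition `x`, that is `δ_x e^{tℒ} = e^{-(N-1)t} ∑_n (t^n / n!) (∑_k 𝒬_k)^n (x, ·)`.
Powers are powers for the composition of kernels. Equivalently, the number of updates up to
time `t` is Poisson with mean `(N-1)t`, and each update is at a uniformly chosen site. -/
def law (V : ℝ → ℝ) (N : ℕ) (t : ℝ≥0) (x : Omega N) : Measure (Omega N) :=
  Measure.sum fun n : ℕ =>
    ENNReal.ofReal (Real.exp (-(((N - 1 : ℕ) : ℝ) * t)) * ((t : ℝ) ^ n / (n.factorial : ℝ))) •
      (totalKernel V N ^ n) x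

/-- Total variation distance `sup_B (μ(B) - ν(B))` over measurable sets. The subtraction is
truncated at `0`, which does not change the supremum, since `B = ∅` contributes `0`. -/
def tvDist {α : Type*} [MeasurableSpace α] (μ ν : Measure α) : ℝ≥0∞ :=
  ⨆ (B : Set α) (_ : MeasurableSet B), μ B - ν B

/-- The distance to equilibrium at time `t` from the worst initial condition with `|x|_∞ ≤ N`. -/
def worstDist (V : ℝ → ℝ) (N : ℕ) (t : ℝ≥0) : ℝ≥0∞ :=
  ⨆ (x : Omega N) (_ : ∀ k, |x k| ≤ (N : ℝ)), tvDist (law V N t x) (gibbs V N)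

/-- The mixing time `T_N(ε) = inf {t ≥ 0 : d_N(t) < ε}`, equal to `∞` if there is no such `t`. -/
def mixingTime (V : ℝ → ℝ) (N : ℕ) (ε : ℝ) : ℝ≥0∞ :=
  ⨅ (t : ℝ≥0) (_ : worstDist V N t < ENNReal.ofReal ε), (t : ℝ≥0∞)

/-- `λ_N = 1 - cos(π / N)`. -/
def lam (N : ℕ) : ℝ := 1 - Real.cos (Real.pi / N)

end GradPhi

end

/-! ### Integrability against exponential weights, coercive potentials and heat-bath densities. -/

noncomputable section
namespace GradPhi

/-! Two structural facts drive everything. By the reflection `u ↦ b + c - u`, the conditional mean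
of a height is the average of its neighbours for every potential (`Coercive.integral_Qt`), so mean
heights follow the discrete heat equation, with spectral gap `λ_N`. By convexity, the conditional
laws are stochastically monotone in the neighbours (`wt_mlr`), so resampling by quantile functions
with a common uniform variable couples all initial conditions monotonically. A linear term in `V` is
invisible on pinned paths (`mixingTime_tilt`), which allows `V` to be assumed to grow at least
linearly on both sides.

Upper bound. Under the monotone coupling the mean distance of two copies at each site is a
subsolution of the heat equation; comparison with a cosine of frequency slightly below `π / N`
yields decay at almost the rate `λ_N` without a polynomial prefactor
(`Coercive.meanGap_evolve_le_exp`). Starting from heights of order `N`, time `(2 + δ) λ_N⁻¹ log N`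
makes each mean gap of order `N ^ (-1 - δ/2)`, so that the sum over sites is small. About `N ^ (1 +
γ)` further updates turn small distance into equality: resampling a site whose neighbours differ
slightly can be coupled to give equal values, at a total variation cost linear in the differences
(`Coercive.lintegral_Qt_le`, `Coercive.iterate_stepOp_add_le`). The linear constant depends on a
moment of the local increments, measured in the stationary copy, where large values are rare
(`exists_lintegral_badFrac_le`).

Moments. The required uniform bounds on increments under the pinned Gibbs measure are obtained
dynamically, without a local limit theorem. Free paths with independent, exponentially tilted
increments are invariant under the updates, and domination between increments is preserved by the
coupling. A random tent-shaped configuration is built whose increments lie between those of two free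
paths with tilts of opposite drift (`exists_isTentLaw`). Its increments keep bounded moments at all
times, and the contraction transfers these bounds to equilibrium (`exists_gibbs_moments`).

Lower bound. The sine mode of the heights is an eigenfunction of the mean dynamics. From the tent it
starts at order `N ^ 2`, while its fluctuations stay of order at most `N ^ (3/2)`, along the
evolution and hence at equilibrium (`exists_sineSum_variance`, `gibbs_sineSum_tail`). Until it has
lost a power of `N`, which takes a time of order `λ_N⁻¹ log N`, it distinguishes the chain from
equilibrium. Neither bound has a leading constant depending on `ε`, and pre-cutoff follows. -/

lemma integrable_exp_neg_mul_abs_sub {κ : ℝ} (hκ : 0 < κ) (b : ℝ) :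
    Integrable fun u : ℝ => Real.exp (-κ * |u - b|) := by
  have h0 : Integrable fun u : ℝ => Real.exp (-κ * |u|) := by
    have h1 : IntegrableOn (fun u : ℝ => Real.exp (-κ * u)) (Ioi 0) :=
      integrableOn_exp_mul_Ioi (by linarith) 0
    have h2 : IntegrableOn (fun u : ℝ => Real.exp (κ * u)) (Iic 0) :=
      integrableOn_exp_mul_Iic hκ 0
    rw [← integrableOn_univ, ← Iic_union_Ioi (a := (0 : ℝ)), integrableOn_union]
    constructor
    · refine h2.congr_fun (fun u hu => ?_) measurableSet_Iic
      simp only [mem_Iic] at hu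
      simp [abs_of_nonpos hu]
    · refine h1.congr_fun (fun u hu => ?_) measurableSet_Ioi
      simp only [mem_Ioi] at hu
      simp [abs_of_pos hu]
  exact h0.comp_sub_right b

lemma exists_pow_mul_exp_le (n : ℕ) {κ : ℝ} (hκ : 0 < κ) :
    ∃ c : ℝ, 0 < c ∧ ∀ t : ℝ, 0 ≤ t →
      t ^ n * Real.exp (-κ * t) ≤ c * Real.exp (-(κ / 2) * t) := by
  refine ⟨(n.factorial : ℝ) / (κ / 2) ^ n, by positivity, fun t ht => ?_⟩
  have h := Real.pow_div_factorial_le_exp (κ / 2 * t) (by positivity) n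
  have hf : (0 : ℝ) < n.factorial := by positivity
  have h2 : t ^ n ≤ (n.factorial : ℝ) / (κ / 2) ^ n * Real.exp (κ / 2 * t) := by
    rw [div_le_iff₀ hf, mul_pow] at h
    rw [div_mul_eq_mul_div, le_div_iff₀ (by positivity)]
    nlinarith
  calc t ^ n * Real.exp (-κ * t)
      ≤ (n.factorial : ℝ) / (κ / 2) ^ n * Real.exp (κ / 2 * t) * Real.exp (-κ * t) := by gcongr
    _ = _ := by rw [mul_assoc, ← Real.exp_add]; ring_nf

lemma integrable_mul_of_exp_bound {w g : ℝ → ℝ} {A B κ b : ℝ} {n : ℕ} (hκ : 0 < κ)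
    (hw : Measurable w) (hg : Measurable g) (hwb : ∀ u, |w u| ≤ A * Real.exp (-κ * |u - b|))
    (hgb : ∀ u, |g u| ≤ B * (1 + |u - b|) ^ n) : Integrable fun u => g u * w u := by
  obtain ⟨c, hc, h⟩ := exists_pow_mul_exp_le n hκ
  have hA : 0 ≤ A := by
    have := (abs_nonneg _).trans (hwb b)
    simpa using this
  have hB : 0 ≤ B := by
    have := (abs_nonneg _).trans (hgb b)
    simpa using this
  refine Integrable.mono' ((integrable_exp_neg_mul_abs_sub (half_pos hκ) b).const_mul
    (A * B * c * Real.exp κ)) (hg.mul hw).aestronglyMeasurable (ae_of_all _ fun u => ?_)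
  rw [Real.norm_eq_abs, abs_mul]
  have h1 := h (1 + |u - b|) (by positivity)
  have e1 : Real.exp (-κ * |u - b|) = Real.exp κ * Real.exp (-κ * (1 + |u - b|)) := by
    rw [← Real.exp_add]; ring_nf
  calc |g u| * |w u| ≤ (B * (1 + |u - b|) ^ n) * (A * Real.exp (-κ * |u - b|)) :=
        mul_le_mul (hgb u) (hwb u) (abs_nonneg _) (by positivity)
    _ = A * B * Real.exp κ * ((1 + |u - b|) ^ n * Real.exp (-κ * (1 + |u - b|))) := by
        rw [e1]; ring
    _ ≤ A * B * Real.exp κ * (c * Real.exp (-(κ / 2) * (1 + |u - b|))) := by gcongr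
    _ ≤ A * B * Real.exp κ * (c * Real.exp (-(κ / 2) * |u - b|)) := by
        gcongr A * B * Real.exp κ * (c * Real.exp ?_)
        nlinarith
    _ = _ := by ring

/-- Convex potentials with at most polynomial growth and at least linear growth. -/
structure Coercive (V : ℝ → ℝ) (κ C : ℝ) (K : ℕ) : Prop where
  convex : ConvexOn ℝ univ V
  kpos : 0 < κ
  cpos : 0 < C
  lower : ∀ x, κ * |x| - C ≤ V x
  growth : ∀ x, |V x| ≤ C * (1 + |x|) ^ K

lemma measurable_of_convexOn {V : ℝ → ℝ} (hV : ConvexOn ℝ univ V) : Measurable V := by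
  have := hV.continuousOn isOpen_univ
  exact (continuousOn_univ.1 this).measurable

/-- The unnormalised conditional density. -/
def wt (V : ℝ → ℝ) (b c u : ℝ) : ℝ := Real.exp (-V (u - b) - V (c - u))

lemma wt_pos (V : ℝ → ℝ) (b c u : ℝ) : 0 < wt V b c u := Real.exp_pos _

lemma wt_shift (V : ℝ → ℝ) (b c s u : ℝ) : wt V (b + s) (c + s) u = wt V b c (u - s) := by
  unfold wt; ring_nf

lemma wt_symm (V : ℝ → ℝ) (b c u : ℝ) : wt V b c (b + c - u) = wt V b c u := by
  unfold wt; ring_nf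

section
variable {V : ℝ → ℝ} {κ C : ℝ} {K : ℕ}

lemma Coercive.meas (h : Coercive V κ C K) : Measurable V := measurable_of_convexOn h.convex

lemma Coercive.measurable_wt (h : Coercive V κ C K) :
    Measurable fun p : (ℝ × ℝ) × ℝ => wt V p.1.1 p.1.2 p.2 := by
  have := h.meas
  unfold wt; fun_prop

lemma Coercive.measurable_wt' (h : Coercive V κ C K) (b c : ℝ) : Measurable (wt V b c) := by
  have := h.meas
  unfold wt; fun_prop

lemma Coercive.wt_le (h : Coercive V κ C K) (b c u : ℝ) :
    wt V b c u ≤ Real.exp (2 * C) * Real.exp (-κ * (|u - b| + |c - u|)) := by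
  rw [wt, ← Real.exp_add]
  apply Real.exp_le_exp.2
  have h1 := h.lower (u - b)
  have h2 := h.lower (c - u)
  nlinarith

lemma Coercive.abs_wt_le (h : Coercive V κ C K) (b c u : ℝ) :
    |wt V b c u| ≤ Real.exp (2 * C) * Real.exp (-κ * |u - b|) := by
  rw [abs_of_pos (wt_pos _ _ _ _)]
  refine (h.wt_le b c u).trans ?_
  gcongr Real.exp (2 * C) * Real.exp ?_
  nlinarith [h.kpos, abs_nonneg (c - u)]

lemma Coercive.integrable_mul_wt (h : Coercive V κ C K) (b c : ℝ) {g : ℝ → ℝ} (hg : Measurable g)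
    {B : ℝ} {n : ℕ} (hgb : ∀ u, |g u| ≤ B * (1 + |u - b|) ^ n) :
    Integrable fun u => g u * wt V b c u :=
  integrable_mul_of_exp_bound h.kpos (h.measurable_wt' b c) hg (h.abs_wt_le b c) hgb

lemma Coercive.integrable_wt (h : Coercive V κ C K) (b c : ℝ) : Integrable (wt V b c) := by
  simpa using h.integrable_mul_wt b c (g := fun _ => 1) measurable_const (B := 1) (n := 0)
    (by simp)

lemma integral_pos_of_pos {w : ℝ → ℝ} (hw : Integrable w) (h : ∀ u, 0 < w u) : 0 < ∫ u, w u := by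
  rw [integral_pos_iff_support_of_nonneg (fun u => (h u).le) hw]
  have : Function.support w = univ := by
    ext u; simp [(h u).ne']
  simp [this]

lemma Coercive.integral_wt_pos (h : Coercive V κ C K) (b c : ℝ) : 0 < ∫ u, wt V b c u :=
  integral_pos_of_pos (h.integrable_wt b c) (wt_pos V b c)

end

/-- Sums of convex functions at majorized pairs. -/
lemma ConvexOn.add_le_add_of_majorize {V : ℝ → ℝ} (hV : ConvexOn ℝ univ V) {a p q d : ℝ}
    (hap : a ≤ p) (haq : a ≤ q) (hs : a + d = p + q) : V p + V q ≤ V a + V d := by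
  rcases eq_or_lt_of_le (show a ≤ d by linarith) with had | had
  · have h1 : p = a := by linarith
    have h2 : q = d := by linarith
    rw [h1, h2]
  · have hd : 0 < d - a := by linarith
    have key : ∀ t, a ≤ t → t ≤ d → V t ≤ (d - t) / (d - a) * V a + (t - a) / (d - a) * V d := by
      intro t h1 h2
      have := hV.2 (mem_univ a) (mem_univ d)
        (show 0 ≤ (d - t) / (d - a) from div_nonneg (by linarith) hd.le)
        (show 0 ≤ (t - a) / (d - a) from div_nonneg (by linarith) hd.le)
        (by rw [← add_div]; rw [div_eq_one_iff_eq hd.ne']; ring)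
      simp only [smul_eq_mul] at this
      have e : (d - t) / (d - a) * a + (t - a) / (d - a) * d = t := by
        have := hd.ne'
        field_simp; ring
      rwa [e] at this
    have h1 := key p hap (by linarith)
    have h2 := key q haq (by linarith)
    have e : (d - p) / (d - a) * V a + (p - a) / (d - a) * V d +
        ((d - q) / (d - a) * V a + (q - a) / (d - a) * V d) = V a + V d := by
      have : q = a + d - p := by linarith
      have := hd.ne'
      subst q
      field_simp; ring
    linarith

/-- After taking logarithms this is convexity at two majorized pairs, one for each bond at the site.
The monotone likelihood ratio is the source of all the monotone couplings. -/
lemma wt_mlr {V : ℝ → ℝ} (hV : ConvexOn ℝ univ V) {b c b' c' : ℝ} (hb : b ≤ b') (hc : c ≤ c')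
    {u v : ℝ} (huv : u ≤ v) : wt V b c v * wt V b' c' u ≤ wt V b c u * wt V b' c' v := by
  unfold wt
  rw [← Real.exp_add, ← Real.exp_add]
  apply Real.exp_le_exp.2
  have h1 := ConvexOn.add_le_add_of_majorize hV (a := u - b') (d := v - b) (p := u - b)
    (q := v - b') (by linarith) (by linarith) (by ring)
  have h2 := ConvexOn.add_le_add_of_majorize hV (a := c - v) (d := c' - u) (p := c - u)
    (q := c' - v) (by linarith) (by linarith) (by ring)
  linarith

/-- The probability measure on the line with density proportional to `w`. -/
def dens (w : ℝ → ℝ) : Measure ℝ := volume.withDensity fun u => ENNReal.ofReal (w u / ∫ s, w s)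

lemma dens_wt (V : ℝ → ℝ) (b c : ℝ) :
    dens (wt V b c) = volume.withDensity fun u => ENNReal.ofReal (rho V b c u) := rfl

section
variable {w w' : ℝ → ℝ}

lemma isProbabilityMeasure_dens (hw : Integrable w) (h : ∀ u, 0 < w u) :
    IsProbabilityMeasure (dens w) := by
  constructor
  have h0 := integral_pos_of_pos hw h
  rw [dens, withDensity_apply _ MeasurableSet.univ, Measure.restrict_univ,
    ← ofReal_integral_eq_lintegral_ofReal (hw.div_const _)
      (ae_of_all _ fun u => div_nonneg (h u).le h0.le), integral_div, div_self h0.ne',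
    ENNReal.ofReal_one]

lemma lintegral_dens (hm : Measurable w) {f : ℝ → ℝ≥0∞} (hf : Measurable f) :
    ∫⁻ u, f u ∂dens w = ∫⁻ u, ENNReal.ofReal (w u / ∫ s, w s) * f u := by
  rw [dens, lintegral_withDensity_eq_lintegral_mul _ (by fun_prop) hf]
  rfl

lemma dens_toReal (h : ∀ u, 0 < w u) (u : ℝ) :
    (ENNReal.ofReal (w u / ∫ s, w s)).toReal = w u / ∫ s, w s :=
  ENNReal.toReal_ofReal (div_nonneg (h u).le (integral_nonneg fun u => (h u).le))

lemma integral_dens (hm : Measurable w) (h : ∀ u, 0 < w u) (g : ℝ → ℝ) :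
    ∫ u, g u ∂dens w = (∫ u, g u * w u) / ∫ s, w s := by
  rw [dens, integral_withDensity_eq_integral_toReal_smul₀ (by fun_prop)
    (ae_of_all _ fun u => ENNReal.ofReal_lt_top), ← integral_div]
  congr 1
  ext u
  rw [dens_toReal h, smul_eq_mul]; ring

lemma integrable_dens (hm : Measurable w) (h : ∀ u, 0 < w u) {g : ℝ → ℝ}
    (hg : Integrable fun u => g u * w u) : Integrable g (dens w) := by
  rw [dens, integrable_withDensity_iff_integrable_smul₀' (by fun_prop)
    (ae_of_all _ fun u => ENNReal.ofReal_lt_top)]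
  refine (hg.div_const (∫ s, w s)).congr (ae_of_all _ fun u => ?_)
  simp only [dens_toReal h, smul_eq_mul]; ring

lemma dens_real_Iic (hm : Measurable w) (h : ∀ u, 0 < w u) (s : ℝ) :
    (dens w).real (Iic s) = (∫ u in Iic s, w u) / ∫ u, w u := by
  rw [← integral_indicator_one measurableSet_Iic, integral_dens hm h,
    ← integral_indicator measurableSet_Iic]
  congr 2
  ext u
  by_cases hu : u ∈ Iic s <;> simp [hu]

/-- The monotone likelihood ratio property implies stochastic domination. -/
lemma dens_Iic_le_of_mlr (hm : Measurable w) (hm' : Measurable w') (hw : Integrable w)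
    (hw' : Integrable w') (h : ∀ u, 0 < w u) (h' : ∀ u, 0 < w' u)
    (hmlr : ∀ u v, u ≤ v → w v * w' u ≤ w u * w' v) (s : ℝ) :
    (dens w').real (Iic s) ≤ (dens w).real (Iic s) := by
  rw [dens_real_Iic hm h, dens_real_Iic hm' h']
  have p := integral_pos_of_pos hw h
  have p' := integral_pos_of_pos hw' h'
  have e : ∀ {v : ℝ → ℝ}, Integrable v → (∫ u in Iic s, v u) + ∫ u in Ioi s, v u = ∫ u, v u := by
    intro v hv
    have := integral_add_compl (s := Iic s) measurableSet_Iic hv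
    rwa [compl_Iic] at this
  -- Integrating over `v > s` and then over `u ≤ s` compares products of a lower and an upper mass.
  -- Adding the product of the two lower masses to both sides gives the comparison of the normalised
  -- lower masses.
  have k1 : ∀ u ∈ Iic s, w' u * ∫ v in Ioi s, w v ≤ w u * ∫ v in Ioi s, w' v := by
    intro u hu
    rw [← integral_const_mul, ← integral_const_mul]
    refine setIntegral_mono_on (hw.integrableOn.const_mul _) (hw'.integrableOn.const_mul _)
      measurableSet_Ioi fun v hv => ?_
    rw [mul_comm]
    exact hmlr u v ((mem_Iic.1 hu).trans (le_of_lt (mem_Ioi.1 hv)))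
  have k2 : (∫ u in Iic s, w' u) * ∫ v in Ioi s, w v ≤
      (∫ u in Iic s, w u) * ∫ v in Ioi s, w' v := by
    rw [← integral_mul_const, ← integral_mul_const]
    exact setIntegral_mono_on (hw'.integrableOn.mul_const _) (hw.integrableOn.mul_const _)
      measurableSet_Iic k1
  rw [div_le_div_iff₀ p' p, ← e hw, ← e hw']
  nlinarith

end

end GradPhi
end

/-! ### The quantile coupling of the heat-bath updates. -/

noncomputable section
namespace GradPhi

/-- The uniform distribution on the unit interval. -/
def unif : Measure ℝ := volume.restrict (Ioo 0 1)

instance : IsProbabilityMeasure unif := ⟨by simp [unif]⟩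

lemma ae_unif : ∀ᵐ u ∂unif, u ∈ Ioo (0 : ℝ) 1 := ae_restrict_mem measurableSet_Ioo

/-- The quantile function of a law on the line. -/
def quantile (μ : Measure ℝ) (U : ℝ) : ℝ := sInf {s | U ≤ μ.real (Iic s)}

section
variable {μ ν : Measure ℝ} [IsProbabilityMeasure μ] [IsProbabilityMeasure ν] {U : ℝ}

lemma quantile_set_nonempty (hU : U < 1) : {s | U ≤ μ.real (Iic s)}.Nonempty := by
  have := (tendsto_cdf_atTop μ).eventually (lt_mem_nhds hU)
  obtain ⟨s, hs⟩ := this.exists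
  exact ⟨s, by rw [mem_ofPred_eq, ← cdf_eq_real]; exact hs.le⟩

lemma quantile_set_bddBelow (hU : 0 < U) : BddBelow {s | U ≤ μ.real (Iic s)} := by
  have := (tendsto_cdf_atBot μ).eventually (gt_mem_nhds hU)
  obtain ⟨s, hs⟩ := this.exists
  refine ⟨s, fun t ht => ?_⟩
  by_contra hts
  rw [not_le] at hts
  have := monotone_cdf μ hts.le
  rw [mem_ofPred_eq, ← cdf_eq_real] at ht
  linarith

/-- Right continuity of the distribution function makes the infimum attained. This Galois connection
carries the measurability, the law and the translation covariance of the quantile function. -/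
lemma quantile_le_iff (hU : U ∈ Ioo (0 : ℝ) 1) (s : ℝ) :
    quantile μ U ≤ s ↔ U ≤ μ.real (Iic s) := by
  constructor
  · intro h
    rw [← cdf_eq_real]
    have hc : ContinuousWithinAt (cdf μ) (Ioi s) s :=
      ((cdf μ).right_continuous s).mono Ioi_subset_Ici_self
    refine ge_of_tendsto hc ?_
    filter_upwards [self_mem_nhdsWithin] with t ht
    obtain ⟨r, hr, hrt⟩ := exists_lt_of_csInf_lt (quantile_set_nonempty (μ := μ) hU.2)
      (lt_of_le_of_lt h ht)
    rw [mem_ofPred_eq, ← cdf_eq_real] at hr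
    exact hr.trans (monotone_cdf μ hrt.le)
  · intro h
    exact csInf_le (quantile_set_bddBelow hU.1) h

lemma quantile_mono (h : ∀ s, ν.real (Iic s) ≤ μ.real (Iic s)) (hU : U ∈ Ioo (0 : ℝ) 1) :
    quantile μ U ≤ quantile ν U :=
  csInf_le_csInf (quantile_set_bddBelow hU.1) (quantile_set_nonempty hU.2)
    fun s hs => le_trans (show U ≤ ν.real (Iic s) from hs) (h s)

lemma unif_real_le {a : ℝ} (h0 : 0 ≤ a) (h1 : a ≤ 1) : unif {U | U ≤ a} = ENNReal.ofReal a := by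
  have h : {U : ℝ | U ≤ a} = Iic a := rfl
  rw [h, unif, Measure.restrict_apply measurableSet_Iic]
  rcases eq_or_lt_of_le h1 with rfl | h1
  · have : Iic (1 : ℝ) ∩ Ioo 0 1 = Ioo 0 1 := by
      ext; simp; intro _ h; exact h.le
    simp [this]
  · have : Iic a ∩ Ioo 0 1 = Ioc 0 a := by
      ext x; simp; constructor
      · rintro ⟨h1, h2, h3⟩; exact ⟨h2, h1⟩
      · rintro ⟨h2, h3⟩; exact ⟨h3, h2, h3.trans_lt h1⟩
    simp [this]

end

/-- A real function which is the quantile function on the unit interval has the given law. -/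
lemma map_unif_eq {μ : Measure ℝ} [IsProbabilityMeasure μ] {q : ℝ → ℝ} (hq : Measurable q)
    (h : ∀ U ∈ Ioo (0 : ℝ) 1, q U = quantile μ U) : unif.map q = μ := by
  have : IsProbabilityMeasure (unif.map q) := Measure.isProbabilityMeasure_map hq.aemeasurable
  refine Measure.ext_of_Iic _ _ fun s => ?_
  rw [Measure.map_apply hq measurableSet_Iic]
  have : unif (q ⁻¹' Iic s) = unif {U | U ≤ μ.real (Iic s)} := by
    refine measure_congr ?_
    filter_upwards [ae_unif] with U hU
    refine propext ?_
    change q U ≤ s ↔ U ≤ μ.real (Iic s)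
    rw [h U hU, quantile_le_iff hU]
  rw [this, unif_real_le measureReal_nonneg measureReal_le_one, ofReal_measureReal]

/-- The heat-bath value with uniform variable `U`. Outside of the unit interval a value compatible
with monotonicity and translations is chosen. -/
def Qt (V : ℝ → ℝ) (b c U : ℝ) : ℝ :=
  if U ∈ Ioo (0 : ℝ) 1 then quantile (dens (wt V b c)) U else (b + c) / 2

section
variable {V : ℝ → ℝ} {κ C : ℝ} {K : ℕ}

lemma Coercive.prob (h : Coercive V κ C K) (b c : ℝ) :
    IsProbabilityMeasure (dens (wt V b c)) :=
  isProbabilityMeasure_dens (h.integrable_wt b c) (wt_pos V b c)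

lemma Coercive.measurable_cdf (h : Coercive V κ C K) (s : ℝ) :
    Measurable fun p : ℝ × ℝ => (dens (wt V p.1 p.2)).real (Iic s) := by
  have e : ∀ p : ℝ × ℝ, (dens (wt V p.1 p.2)).real (Iic s) =
      (∫ u in Iic s, wt V p.1 p.2 u) / ∫ u, wt V p.1 p.2 u := fun p =>
    dens_real_Iic (h.measurable_wt' _ _) (wt_pos _ _ _) s
  simp_rw [e]
  apply Measurable.div
  · exact (StronglyMeasurable.integral_prod_right (f := fun p : ℝ × ℝ => fun u => wt V p.1 p.2 u)
      h.measurable_wt.stronglyMeasurable).measurable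
  · exact (StronglyMeasurable.integral_prod_right (f := fun p : ℝ × ℝ => fun u => wt V p.1 p.2 u)
      h.measurable_wt.stronglyMeasurable).measurable

/-- The Galois connection turns sublevel sets of `Qt` into comparisons of `U` with a distribution
function that depends measurably on the neighbours. -/
lemma Coercive.measurable_Qt (h : Coercive V κ C K) :
    Measurable fun p : (ℝ × ℝ) × ℝ => Qt V p.1.1 p.1.2 p.2 := by
  refine measurable_of_Iic fun s => ?_
  have hI : MeasurableSet {p : (ℝ × ℝ) × ℝ | p.2 ∈ Ioo (0 : ℝ) 1} :=
    measurable_snd measurableSet_Ioo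
  have : (fun p : (ℝ × ℝ) × ℝ => Qt V p.1.1 p.1.2 p.2) ⁻¹' Iic s =
      ({p | p.2 ∈ Ioo (0 : ℝ) 1} ∩ {p | p.2 ≤ (dens (wt V p.1.1 p.1.2)).real (Iic s)}) ∪
      ({p | p.2 ∈ Ioo (0 : ℝ) 1}ᶜ ∩ {p | (p.1.1 + p.1.2) / 2 ≤ s}) := by
    ext p
    have := h.prob p.1.1 p.1.2
    by_cases hp : p.2 ∈ Ioo (0 : ℝ) 1
    · have hp' := hp
      simp only [mem_Ioo] at hp'
      simp [Qt, hp', quantile_le_iff hp]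
    · have hp' := hp
      simp only [mem_Ioo] at hp'
      simp only [Qt, mem_preimage, mem_Iic, mem_union, mem_inter_iff, mem_ofPred_eq, hp, if_false,
        false_and, mem_compl_iff, not_false_eq_true, true_and, false_or]
  rw [this]
  refine (hI.inter (measurableSet_le measurable_snd ((h.measurable_cdf s).comp measurable_fst))).union
    (hI.compl.inter (measurableSet_le (by fun_prop) measurable_const))

lemma Coercive.measurable_Qt' (h : Coercive V κ C K) (b c : ℝ) : Measurable (Qt V b c) := by
  have := h.measurable_Qt.comp (f := fun U : ℝ => ((b, c), U)) (by fun_prop)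
  simpa only [Function.comp_def] using this

lemma Coercive.map_Qt (h : Coercive V κ C K) (b c : ℝ) :
    unif.map (Qt V b c) = dens (wt V b c) :=
  have := h.prob b c
  map_unif_eq (h.measurable_Qt' b c) fun U hU => by rw [Qt, if_pos hU]

lemma Coercive.Qt_mono (h : Coercive V κ C K) {b c b' c' : ℝ} (hb : b ≤ b') (hc : c ≤ c')
    (U : ℝ) : Qt V b c U ≤ Qt V b' c' U := by
  unfold Qt
  split_ifs with hU
  · have := h.prob b c
    have := h.prob b' c'
    exact quantile_mono (fun s => dens_Iic_le_of_mlr (h.measurable_wt' _ _) (h.measurable_wt' _ _)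
      (h.integrable_wt _ _) (h.integrable_wt _ _) (wt_pos _ _ _) (wt_pos _ _ _)
      (fun u v huv => wt_mlr h.convex hb hc huv) s) hU
  · linarith

lemma Coercive.Qt_shift (h : Coercive V κ C K) (b c s U : ℝ) :
    Qt V (b + s) (c + s) U = Qt V b c U + s := by
  unfold Qt
  split_ifs with hU
  · have := h.prob b c
    have := h.prob (b + s) (c + s)
    have e : ∀ t, (dens (wt V (b + s) (c + s))).real (Iic t) =
        (dens (wt V b c)).real (Iic (t - s)) := by
      intro t
      rw [dens_real_Iic (h.measurable_wt' _ _) (wt_pos _ _ _),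
        dens_real_Iic (h.measurable_wt' _ _) (wt_pos _ _ _)]
      simp_rw [wt_shift]
      have e0 : ∫ u, wt V b c (u - s) = ∫ u, wt V b c u :=
        integral_sub_right_eq_self (fun u => wt V b c u) s
      rw [e0]
      congr 1
      rw [← integral_indicator measurableSet_Iic, ← integral_indicator measurableSet_Iic,
        ← integral_sub_right_eq_self (fun u => (Iic (t - s)).indicator (wt V b c) u) s]
      congr 1
      ext u
      by_cases hu : u ≤ t <;> simp [indicator, hu]
    refine eq_of_forall_ge_iff fun t => ?_
    rw [quantile_le_iff hU, e, ← le_sub_iff_add_le, quantile_le_iff hU]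
  · ring

lemma Coercive.integrable_id_wt (h : Coercive V κ C K) (b c : ℝ) :
    Integrable fun u => u * wt V b c u := by
  refine h.integrable_mul_wt b c (g := fun u => u) measurable_id (B := 1 + |b|) (n := 1) fun u => ?_
  simp only [pow_one]
  have := abs_add_le (u - b) b
  rw [sub_add_cancel] at this
  nlinarith [abs_nonneg (u - b), abs_nonneg b]

/-- The reflection `u ↦ b + c - u` exchanges the two bonds and preserves the weight, whatever the
potential. Linearity of this mean in the neighbours is what brings in the discrete Laplacian. -/
lemma Coercive.integral_id_wt (h : Coercive V κ C K) (b c : ℝ) :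
    ∫ u, u * wt V b c u = (b + c) / 2 * ∫ u, wt V b c u := by
  have e : ∫ u, u * wt V b c u = ∫ u, (b + c - u) * wt V b c u := by
    rw [← integral_sub_left_eq_self (fun u => u * wt V b c u) volume (b + c)]
    simp_rw [wt_symm]
  have e2 : ∫ u, (b + c - u) * wt V b c u =
      (b + c) * (∫ u, wt V b c u) - ∫ u, u * wt V b c u := by
    simp_rw [sub_mul]
    rw [integral_sub ((h.integrable_wt b c).const_mul _) (h.integrable_id_wt b c),
      integral_const_mul]
  linarith

lemma Coercive.integrable_comp_Qt (h : Coercive V κ C K) (b c : ℝ) {g : ℝ → ℝ} (hg : Measurable g)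
    {B : ℝ} {n : ℕ} (hgb : ∀ u, |g u| ≤ B * (1 + |u - b|) ^ n) :
    Integrable (fun U => g (Qt V b c U)) unif := by
  have : Integrable g (unif.map (Qt V b c)) := by
    rw [h.map_Qt]
    exact integrable_dens (h.measurable_wt' b c) (wt_pos _ _ _) (h.integrable_mul_wt b c hg hgb)
  exact this.comp_measurable (h.measurable_Qt' b c)

lemma Coercive.integrable_Qt (h : Coercive V κ C K) (b c : ℝ) : Integrable (Qt V b c) unif := by
  refine h.integrable_comp_Qt b c (g := fun u => u) measurable_id (B := 1 + |b|) (n := 1) fun u => ?_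
  simp only [pow_one]
  have := abs_add_le (u - b) b
  rw [sub_add_cancel] at this
  nlinarith [abs_nonneg (u - b), abs_nonneg b]

lemma Coercive.integral_Qt (h : Coercive V κ C K) (b c : ℝ) :
    ∫ U, Qt V b c U ∂unif = (b + c) / 2 := by
  have : ∫ U, Qt V b c U ∂unif = ∫ u, u ∂(unif.map (Qt V b c)) :=
    (integral_map (h.measurable_Qt' b c).aemeasurable
      (f := fun u : ℝ => u) measurable_id.aestronglyMeasurable).symm
  rw [this, h.map_Qt, integral_dens (h.measurable_wt' b c) (wt_pos _ _ _), h.integral_id_wt,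
    mul_div_assoc, div_self (h.integral_wt_pos b c).ne', mul_one]

/-- Both values lie below the one obtained from the larger of the neighbours on each side, so their
distance is at most the sum of the two gaps to it. These gaps are nonnegative and have explicit
means, and nothing is lost: the bound is exactly that of the averaging operator. -/
lemma Coercive.lintegral_abs_Qt_sub_le (h : Coercive V κ C K) (b c b' c' : ℝ) :
    ∫⁻ U, ENNReal.ofReal |Qt V b c U - Qt V b' c' U| ∂unif ≤
      ENNReal.ofReal ((|b - b'| + |c - c'|) / 2) := by
  have hint : Integrable (fun U => |Qt V b c U - Qt V b' c' U|) unif :=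
    ((h.integrable_Qt b c).sub (h.integrable_Qt b' c')).abs
  rw [← ofReal_integral_eq_lintegral_ofReal hint (ae_of_all _ fun _ => abs_nonneg _)]
  apply ENNReal.ofReal_le_ofReal
  have hi := h.integrable_Qt (max b b') (max c c')
  calc ∫ U, |Qt V b c U - Qt V b' c' U| ∂unif
      ≤ ∫ U, ((Qt V (max b b') (max c c') U - Qt V b c U) +
          (Qt V (max b b') (max c c') U - Qt V b' c' U)) ∂unif := by
        refine integral_mono hint
          ((hi.sub (h.integrable_Qt b c)).add (hi.sub (h.integrable_Qt b' c'))) fun U => ?_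
        have h1 := h.Qt_mono (le_max_left b b') (le_max_left c c') U
        have h2 := h.Qt_mono (le_max_right b b') (le_max_right c c') U
        dsimp only
        rw [abs_le]
        constructor <;> linarith
    _ = (|b - b'| + |c - c'|) / 2 := by
        have i1 : Integrable (fun U => Qt V (max b b') (max c c') U - Qt V b c U) unif :=
          hi.sub (h.integrable_Qt b c)
        have i2 : Integrable (fun U => Qt V (max b b') (max c c') U - Qt V b' c' U) unif :=
          hi.sub (h.integrable_Qt b' c')
        rw [integral_add i1 i2, integral_sub hi (h.integrable_Qt b c),
          integral_sub hi (h.integrable_Qt b' c')]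
        simp only [h.integral_Qt]
        rcases le_total b b' with h1 | h1 <;> rcases le_total c c' with h2 | h2 <;>
          simp only [h1, h2, max_eq_left, max_eq_right, abs_of_nonneg, abs_of_nonpos, sub_nonneg,
            sub_nonpos] <;> ring

/-- Resampling preserves domination of the increments. -/
lemma Coercive.Qt_sub_le (h : Coercive V κ C K) {b c b' c' : ℝ} (hs : c - b ≤ c' - b') (U : ℝ) :
    Qt V b c U - b ≤ Qt V b' c' U - b' ∧ c - Qt V b c U ≤ c' - Qt V b' c' U := by
  -- Translate the first pair so that the left neighbours agree, then so that the right ones agree;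
  -- in both cases the other neighbours are ordered by `hs`.
  have h1 := h.Qt_mono (b := b + (b' - b)) (c := c + (b' - b)) (b' := b') (c' := c') (by linarith)
    (by linarith) U
  have h2 := h.Qt_mono (b := b') (c := c') (b' := b + (c' - c)) (c' := c + (c' - c)) (by linarith)
    (by linarith) U
  rw [h.Qt_shift] at h1 h2
  constructor <;> linarith

end
end GradPhi
end

/-! ### Chains driven by random sites and uniform variables. -/

noncomputable section
namespace GradPhi

section Pair
variable {ι α β : Type*} [MeasurableSpace α] [MeasurableSpace β]

/-- The two chains driven by the same sites and uniform variables. -/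
def pairMap (Φ : ι → α → ℝ → α) (Ψ : ι → β → ℝ → β) (i : ι) (p : α × β) (u : ℝ) : α × β :=
  (Φ i p.1 u, Ψ i p.2 u)

lemma measurable_pairMap {Φ : ι → α → ℝ → α} {Ψ : ι → β → ℝ → β}
    (hΦ : ∀ i, Measurable fun p : α × ℝ => Φ i p.1 p.2)
    (hΨ : ∀ i, Measurable fun p : β × ℝ => Ψ i p.1 p.2) (i : ι) :
    Measurable fun p : (α × β) × ℝ => pairMap Φ Ψ i p.1 p.2 :=
  ((hΦ i).comp (f := fun p : (α × β) × ℝ => (p.1.1, p.2)) (by fun_prop)).prodMk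
    ((hΨ i).comp (f := fun p : (α × β) × ℝ => (p.1.2, p.2)) (by fun_prop))

end Pair

section Abstract
variable {ι α β : Type*} [Fintype ι] [MeasurableSpace α] [MeasurableSpace β]

/-- The law after an update driven by a uniform variable. -/
def siteStep (φ : α → ℝ → α) (μ : Measure α) : Measure α :=
  (μ.prod unif).map fun p => φ p.1 p.2

/-- The law after an update at a uniformly chosen site. -/
def step (Φ : ι → α → ℝ → α) (μ : Measure α) : Measure α :=
  (Fintype.card ι : ℝ≥0∞)⁻¹ • ∑ i, siteStep (Φ i) μ

/-- The Markov operator of the chain with random site updates. -/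
def stepOp (Φ : ι → α → ℝ → α) (f : α → ℝ≥0∞) (x : α) : ℝ≥0∞ :=
  (Fintype.card ι : ℝ≥0∞)⁻¹ * ∑ i, ∫⁻ u, f (Φ i x u) ∂unif

/-- The law after `n` updates at uniformly chosen sites. -/
def evolve (Φ : ι → α → ℝ → α) (n : ℕ) (μ : Measure α) : Measure α := (step Φ)^[n] μ

lemma evolve_zero (Φ : ι → α → ℝ → α) (μ : Measure α) : evolve Φ 0 μ = μ := rfl

lemma evolve_succ (Φ : ι → α → ℝ → α) (n : ℕ) (μ : Measure α) :
    evolve Φ (n + 1) μ = step Φ (evolve Φ n μ) := Function.iterate_succ_apply' _ _ _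

lemma evolve_add (Φ : ι → α → ℝ → α) (n m : ℕ) (μ : Measure α) :
    evolve Φ (n + m) μ = evolve Φ n (evolve Φ m μ) := Function.iterate_add_apply _ _ _ _

lemma lintegral_siteStep {φ : α → ℝ → α} (hφ : Measurable fun p : α × ℝ => φ p.1 p.2)
    (μ : Measure α) [SFinite μ] {f : α → ℝ≥0∞} (hf : Measurable f) :
    ∫⁻ x, f x ∂siteStep φ μ = ∫⁻ x, ∫⁻ u, f (φ x u) ∂unif ∂μ := by
  rw [siteStep, lintegral_map hf hφ, lintegral_prod (fun p : α × ℝ => f (φ p.1 p.2))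
    (hf.comp hφ).aemeasurable]

lemma measurable_lintegral_unif {φ : α → ℝ → α} (hφ : Measurable fun p : α × ℝ => φ p.1 p.2)
    {f : α → ℝ≥0∞} (hf : Measurable f) : Measurable fun x => ∫⁻ u, f (φ x u) ∂unif :=
  (hf.comp hφ).lintegral_prod_right'

lemma measurable_stepOp {Φ : ι → α → ℝ → α} (hΦ : ∀ i, Measurable fun p : α × ℝ => Φ i p.1 p.2)
    {f : α → ℝ≥0∞} (hf : Measurable f) : Measurable (stepOp Φ f) := by
  unfold stepOp
  exact (Finset.measurable_sum _ fun i _ => measurable_lintegral_unif (hΦ i) hf).const_mul _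

lemma measurable_iterate_stepOp {Φ : ι → α → ℝ → α}
    (hΦ : ∀ i, Measurable fun p : α × ℝ => Φ i p.1 p.2)
    {f : α → ℝ≥0∞} (hf : Measurable f) (n : ℕ) : Measurable ((stepOp Φ)^[n] f) := by
  induction n with
  | zero => exact hf
  | succ n ih => rw [Function.iterate_succ_apply']; exact measurable_stepOp hΦ ih

lemma lintegral_step_eq_sum (Φ : ι → α → ℝ → α) (μ : Measure α) {f : α → ℝ≥0∞} :
    ∫⁻ x, f x ∂step Φ μ =
      (Fintype.card ι : ℝ≥0∞)⁻¹ * ∑ i, ∫⁻ x, f x ∂siteStep (Φ i) μ := by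
  rw [step, lintegral_smul_measure, lintegral_finsetSum_measure, smul_eq_mul]

lemma lintegral_step {Φ : ι → α → ℝ → α} (hΦ : ∀ i, Measurable fun p : α × ℝ => Φ i p.1 p.2)
    (μ : Measure α) [SFinite μ] {f : α → ℝ≥0∞} (hf : Measurable f) :
    ∫⁻ x, f x ∂step Φ μ = ∫⁻ x, stepOp Φ f x ∂μ := by
  unfold stepOp
  rw [lintegral_step_eq_sum Φ, lintegral_const_mul _ (Finset.measurable_sum _ fun i _ =>
    measurable_lintegral_unif (hΦ i) hf), lintegral_finsetSum _ fun i _ =>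
    measurable_lintegral_unif (hΦ i) hf]
  simp_rw [fun i => lintegral_siteStep (hΦ i) μ hf]

lemma isProbabilityMeasure_siteStep {φ : α → ℝ → α} (hφ : Measurable fun p : α × ℝ => φ p.1 p.2)
    (μ : Measure α) [IsProbabilityMeasure μ] : IsProbabilityMeasure (siteStep φ μ) :=
  Measure.isProbabilityMeasure_map hφ.aemeasurable

lemma isProbabilityMeasure_step [Nonempty ι] {Φ : ι → α → ℝ → α}
    (hΦ : ∀ i, Measurable fun p : α × ℝ => Φ i p.1 p.2)
    (μ : Measure α) [IsProbabilityMeasure μ] : IsProbabilityMeasure (step Φ μ) := by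
  constructor
  have := fun i => isProbabilityMeasure_siteStep (hΦ i) μ
  rw [← lintegral_one, lintegral_step_eq_sum Φ]
  simp only [lintegral_one, measure_univ, Finset.sum_const, Finset.card_univ, nsmul_eq_mul, mul_one]
  exact ENNReal.inv_mul_cancel (by simp) (by simp)

lemma isProbabilityMeasure_evolve [Nonempty ι] {Φ : ι → α → ℝ → α}
    (hΦ : ∀ i, Measurable fun p : α × ℝ => Φ i p.1 p.2) (n : ℕ)
    (μ : Measure α) [IsProbabilityMeasure μ] : IsProbabilityMeasure (evolve Φ n μ) := by
  induction n with
  | zero => rwa [evolve_zero]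
  | succ n ih => rw [evolve_succ]; exact isProbabilityMeasure_step hΦ _

lemma lintegral_evolve [Nonempty ι] {Φ : ι → α → ℝ → α}
    (hΦ : ∀ i, Measurable fun p : α × ℝ => Φ i p.1 p.2)
    (μ : Measure α) [IsProbabilityMeasure μ] (n : ℕ) {f : α → ℝ≥0∞} (hf : Measurable f) :
    ∫⁻ x, f x ∂evolve Φ n μ = ∫⁻ x, (stepOp Φ)^[n] f x ∂μ := by
  induction n generalizing f with
  | zero => rfl
  | succ n ih =>
    have := isProbabilityMeasure_evolve hΦ n μ
    rw [evolve_succ, lintegral_step hΦ _ hf, ih (measurable_stepOp hΦ hf),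
      Function.iterate_succ_apply]

/-- A measure invariant under each update is invariant under the chain. -/
lemma evolve_eq_self [Nonempty ι] {Φ : ι → α → ℝ → α} {μ : Measure α}
    (h : ∀ i, siteStep (Φ i) μ = μ) (n : ℕ) : evolve Φ n μ = μ := by
  induction n with
  | zero => rfl
  | succ n ih =>
    rw [evolve_succ, ih, step]
    simp only [h, Finset.sum_const, Finset.card_univ]
    rw [← Nat.cast_smul_eq_nsmul ℝ≥0∞, smul_smul, ENNReal.inv_mul_cancel (by simp) (by simp),
      one_smul]

/-- Laws of a function of the state which is itself Markov. -/
lemma map_siteStep {φ : α → ℝ → α} {ψ : β → ℝ → β} {g : α → β} (hg : Measurable g)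
    (hφ : Measurable fun p : α × ℝ => φ p.1 p.2) (hψ : Measurable fun p : β × ℝ => ψ p.1 p.2)
    (h : ∀ x u, g (φ x u) = ψ (g x) u) (μ : Measure α) [SFinite μ] :
    (siteStep φ μ).map g = siteStep ψ (μ.map g) := by
  rw [siteStep, siteStep, Measure.map_map hg hφ]
  have : (μ.map g).prod unif = (μ.prod unif).map (Prod.map g id) := by
    rw [← Measure.map_prod_map _ _ hg measurable_id, Measure.map_id]
  rw [this, Measure.map_map hψ (hg.prodMap measurable_id)]
  congr 1
  ext p
  exact h _ _

lemma map_evolve [Nonempty ι] {Φ : ι → α → ℝ → α} {Ψ : ι → β → ℝ → β} {g : α → β}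
    (hg : Measurable g)
    (hΦ : ∀ i, Measurable fun p : α × ℝ => Φ i p.1 p.2)
    (hΨ : ∀ i, Measurable fun p : β × ℝ => Ψ i p.1 p.2)
    (h : ∀ i x u, g (Φ i x u) = Ψ i (g x) u) (n : ℕ) (μ : Measure α) [IsProbabilityMeasure μ] :
    (evolve Φ n μ).map g = evolve Ψ n (μ.map g) := by
  induction n with
  | zero => rfl
  | succ n ih =>
    have := isProbabilityMeasure_evolve hΦ n μ
    rw [evolve_succ, evolve_succ, ← ih, step, step, Measure.map_smul, Measure.map_finset_sum hg.aemeasurable]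
    simp_rw [fun i => map_siteStep hg (hΦ i) (hΨ i) (h i) (evolve Φ n μ)]

lemma ae_siteStep {φ : α → ℝ → α} (hφ : Measurable fun p : α × ℝ => φ p.1 p.2) {S : Set α}
    (hS : MeasurableSet S) (h : ∀ x ∈ S, ∀ u, φ x u ∈ S) (μ : Measure α) [SFinite μ]
    (hμ : ∀ᵐ x ∂μ, x ∈ S) : ∀ᵐ x ∂siteStep φ μ, x ∈ S := by
  rw [siteStep, ae_map_iff hφ.aemeasurable (p := fun x => x ∈ S) hS]
  have : ∀ᵐ p ∂(μ.prod unif), p.1 ∈ S := Measure.quasiMeasurePreserving_fst.ae hμ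
  filter_upwards [this] with p hp using h _ hp _

lemma ae_evolve [Nonempty ι] {Φ : ι → α → ℝ → α}
    (hΦ : ∀ i, Measurable fun p : α × ℝ => Φ i p.1 p.2) {S : Set α}
    (hS : MeasurableSet S) (h : ∀ i, ∀ x ∈ S, ∀ u, Φ i x u ∈ S) (μ : Measure α)
    [IsProbabilityMeasure μ] (hμ : ∀ᵐ x ∂μ, x ∈ S) (n : ℕ) : ∀ᵐ x ∂evolve Φ n μ, x ∈ S := by
  induction n with
  | zero => exact hμ
  | succ n ih =>
    have := isProbabilityMeasure_evolve hΦ n μ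
    rw [evolve_succ]
    refine Measure.ae_smul_measure ?_ _
    rw [ae_finsetSum_measure_iff]
    exact fun i _ => ae_siteStep (hΦ i) hS (h i) _ ih

end Abstract

end GradPhi
end

/-! ### Invariance under tilting, and the sampler as a Poisson number of quantile updates. -/

noncomputable section
namespace GradPhi

section Tilt

/-- The two increments at a site add up to `c - b`, so the tilt multiplies the weight by a constant,
which the normalisation removes. -/
lemma rho_tilt (V : ℝ → ℝ) (a : ℝ) : rho (fun x => V x - a * x) = rho V := by
  ext b c u
  have e : ∀ s, Real.exp (-(V (s - b) - a * (s - b)) - (V (c - s) - a * (c - s))) =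
      Real.exp (-V (s - b) - V (c - s)) * Real.exp (a * (c - b)) := by
    intro s
    rw [← Real.exp_add]; ring_nf
  unfold rho
  simp_rw [e]
  rw [integral_mul_const, mul_div_mul_right _ _ (Real.exp_ne_zero _)]

lemma height_zero {N : ℕ} (x : Omega N) : height x 0 = 0 := by simp [height]

lemma height_of_le {N : ℕ} (x : Omega N) {i : ℕ} (h : N ≤ i) : height x i = 0 := by
  simp [height, h]

lemma hamiltonian_tilt (V : ℝ → ℝ) (a : ℝ) {N : ℕ} (x : Omega N) :
    hamiltonian (fun x => V x - a * x) x = hamiltonian V x := by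
  unfold hamiltonian
  rw [Finset.sum_sub_distrib, ← Finset.mul_sum]
  have : ∑ k ∈ Finset.Icc 1 N, (height x k - height x (k - 1)) = 0 := by
    have h := Finset.sum_range_sub (height x) N
    rw [height_zero, height_of_le x le_rfl, sub_zero] at h
    have e : Finset.Icc 1 N = Finset.Ico (0 + 1) (N + 1) := by ext; simp
    rw [← h, Finset.range_eq_Ico, e, ← Finset.sum_Ico_add']
    rfl
  rw [this, mul_zero, sub_zero]

/-- Reduces the theorem to potentials with at least linear growth on both sides: a suitable slope
can be subtracted from any admissible potential. -/
lemma mixingTime_tilt (V : ℝ → ℝ) (a : ℝ) :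
    mixingTime (fun x => V x - a * x) = mixingTime V := by
  have h1 : gibbs (fun x => V x - a * x) = gibbs V := by
    ext1 N
    unfold gibbs
    simp_rw [hamiltonian_tilt]
  have h2 : law (fun x => V x - a * x) = law V := by
    ext1 N
    unfold law totalKernel updateKernel conditionalKernel
    simp_rw [rho_tilt]
  ext N ε
  unfold mixingTime worstDist
  rw [h1, h2]

end Tilt

/-- The updates of paths. -/
def pathMap (V : ℝ → ℝ) (k : ℕ) (z : ℕ → ℝ) (u : ℝ) : ℕ → ℝ :=
  Function.update z k (Qt V (z (k - 1)) (z (k + 1)) u)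

/-- The updates of the Gibbs sampler. -/
def siteMap (V : ℝ → ℝ) {N : ℕ} (k : ↥(Finset.Ioo 0 N)) (x : Omega N) (u : ℝ) : Omega N :=
  Function.update x k (Qt V (height x (k - 1)) (height x (k + 1)) u)

lemma height_coe {N : ℕ} (x : Omega N) (k : ↥(Finset.Ioo 0 N)) : height x k = x k := by
  simp only [height, k.2, dite_true]

lemma height_update {N : ℕ} (x : Omega N) (k : ↥(Finset.Ioo 0 N)) (v : ℝ) :
    height (Function.update x k v) = Function.update (height x) (k : ℕ) v := by
  ext i
  by_cases hi : i ∈ Finset.Ioo 0 N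
  · lift i to ↥(Finset.Ioo 0 N) using hi
    rw [height_coe]
    by_cases hik : i = k
    · subst hik; simp
    · rw [Function.update_of_ne hik, Function.update_of_ne (fun hh => hik (Subtype.ext hh)),
        height_coe]
  · have : i ≠ k := fun h => hi (h ▸ k.2)
    rw [Function.update_of_ne this]
    simp only [height, hi, dite_false]

lemma measurable_height {N : ℕ} (i : ℕ) : Measurable fun x : Omega N => height x i := by
  unfold height
  split_ifs <;> fun_prop

lemma height_siteMap (V : ℝ → ℝ) {N : ℕ} (k : ↥(Finset.Ioo 0 N)) (x : Omega N) (u : ℝ) :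
    height (siteMap V k x u) = pathMap V k (height x) u := height_update _ _ _

lemma height_add {N : ℕ} (x y : Omega N) (i : ℕ) :
    height (x + y) i = height x i + height y i := by
  unfold height; split_ifs <;> simp

section
variable {V : ℝ → ℝ} {κ C : ℝ} {K : ℕ}

lemma Coercive.measurable_pathMap (h : Coercive V κ C K) (k : ℕ) :
    Measurable fun p : (ℕ → ℝ) × ℝ => pathMap V k p.1 p.2 := by
  have h1 : Measurable fun p : (ℕ → ℝ) × ℝ => Qt V (p.1 (k - 1)) (p.1 (k + 1)) p.2 :=
    h.measurable_Qt.comp (f := fun p : (ℕ → ℝ) × ℝ => ((p.1 (k - 1), p.1 (k + 1)), p.2))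
      (by fun_prop)
  unfold pathMap
  fun_prop

lemma Coercive.measurable_siteMap (h : Coercive V κ C K) {N : ℕ} (k : ↥(Finset.Ioo 0 N)) :
    Measurable fun p : Omega N × ℝ => siteMap V k p.1 p.2 := by
  have h1 : Measurable fun p : Omega N × ℝ =>
      Qt V (height p.1 (k - 1)) (height p.1 (k + 1)) p.2 :=
    h.measurable_Qt.comp (f := fun p : Omega N × ℝ =>
      ((height p.1 (k - 1), height p.1 (k + 1)), p.2))
      ((((measurable_height _).comp measurable_fst).prodMk
        ((measurable_height _).comp measurable_fst)).prodMk measurable_snd)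
  unfold siteMap
  fun_prop

lemma Coercive.lintegral_Qt (h : Coercive V κ C K) (b c : ℝ) {f : ℝ → ℝ≥0∞} (hf : Measurable f) :
    ∫⁻ U, f (Qt V b c U) ∂unif = ∫⁻ u, f u ∂dens (wt V b c) := by
  rw [← h.map_Qt, lintegral_map hf (h.measurable_Qt' b c)]

lemma Coercive.updateKernel_eq (h : Coercive V κ C K) {N : ℕ} (k : ↥(Finset.Ioo 0 N))
    (x : Omega N) : updateKernel V k x = unif.map (siteMap V k x) := by
  rw [updateKernel_apply h.meas, ← dens_wt, ← h.map_Qt,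
    Measure.map_map (by fun_prop) (h.measurable_Qt' _ _)]
  rfl

lemma card_sites (N : ℕ) : Fintype.card ↥(Finset.Ioo 0 N) = N - 1 := by simp

lemma nonempty_sites {N : ℕ} (hN : 2 ≤ N) : Nonempty ↥(Finset.Ioo 0 N) :=
  ⟨⟨1, by simp; omega⟩⟩

lemma Coercive.totalKernel_apply (h : Coercive V κ C K) {N : ℕ} (hN : 2 ≤ N) (x : Omega N)
    {s : Set (Omega N)} (hs : MeasurableSet s) :
    totalKernel V N x s = (N - 1 : ℕ) * stepOp (siteMap V) (s.indicator 1) x := by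
  have h0 : ((N - 1 : ℕ) : ℝ≥0∞) ≠ 0 := Nat.cast_ne_zero.2 (by omega)
  rw [stepOp, card_sites, ← mul_assoc, ENNReal.mul_inv_cancel h0 (by simp), one_mul, totalKernel,
    Kernel.finsetSum_apply' ]
  refine Finset.sum_congr rfl fun k _ => ?_
  have hm : Measurable (siteMap V k x) :=
    (h.measurable_siteMap k).comp (measurable_const.prodMk measurable_id)
  rw [h.updateKernel_eq, Measure.map_apply hm hs, ← lintegral_indicator_one (hm hs)]
  rfl

/-- The sum of the updates has mass `N - 1`. Extracting this factor at each step leaves a Markov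
chain with a uniformly chosen site, and turns the weights in `law` into Poisson weights. -/
lemma Coercive.totalKernel_pow_apply (h : Coercive V κ C K) {N : ℕ} (hN : 2 ≤ N) (n : ℕ)
    (x : Omega N) :
    (totalKernel V N ^ n) x = ((N - 1 : ℕ) : ℝ≥0∞) ^ n • evolve (siteMap V) n (Measure.dirac x) := by
  have := nonempty_sites hN
  have hm := fun k => h.measurable_siteMap (N := N) k
  induction n with
  | zero => rw [pow_zero, pow_zero, one_smul]; rfl
  | succ n ih =>
    have := isProbabilityMeasure_evolve hm n (Measure.dirac x)
    ext s hs
    rw [Kernel.pow_succ_apply_eq_lintegral _ _ _ hs, ih, lintegral_smul_measure, evolve_succ,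
      Measure.smul_apply, ← lintegral_indicator_one hs, lintegral_step hm _ (measurable_one.indicator hs)]
    simp_rw [h.totalKernel_apply hN _ hs]
    rw [lintegral_const_mul _ (measurable_stepOp hm (measurable_one.indicator hs)), pow_succ]
    simp only [smul_eq_mul, mul_assoc]

/-- The weights of the Poisson law with mean `m`. -/
def poisW (m : ℝ) (n : ℕ) : ℝ := Real.exp (-m) * (m ^ n / n.factorial)

lemma Coercive.law_apply (h : Coercive V κ C K) {N : ℕ} (hN : 2 ≤ N) (t : ℝ≥0) (x : Omega N)
    {s : Set (Omega N)} (hs : MeasurableSet s) :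
    law V N t x s = ∑' n, ENNReal.ofReal (poisW (((N - 1 : ℕ) : ℝ) * t) n) *
      evolve (siteMap V) n (Measure.dirac x) s := by
  rw [law, Measure.sum_apply _ hs]
  congr 1
  ext n
  rw [Measure.smul_apply, h.totalKernel_pow_apply hN, Measure.smul_apply, smul_eq_mul, smul_eq_mul,
    ← mul_assoc, poisW]
  congr 1
  rw [← ENNReal.ofReal_natCast, ← ENNReal.ofReal_pow (by positivity),
    ← ENNReal.ofReal_mul (by positivity)]
  congr 1
  rw [mul_pow]; ring

end
end GradPhi
end

/-! ### The Gibbs measure: integrability and invariance. -/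

noncomputable section
namespace GradPhi

section
variable {V : ℝ → ℝ} {κ C : ℝ} {K : ℕ} {N : ℕ}

lemma Coercive.measurable_hamiltonian (h : Coercive V κ C K) :
    Measurable fun x : Omega N => hamiltonian V x := by
  unfold hamiltonian
  exact Finset.measurable_sum _ fun k _ =>
    h.meas.comp ((measurable_height _).sub (measurable_height _))

lemma abs_height_le_sum (x : Omega N) {k : ℕ} (hk : k ≤ N) :
    |height x k| ≤ ∑ j ∈ Finset.range N, |height x (j + 1) - height x j| := by
  have h := Finset.sum_range_sub (height x) k
  rw [height_zero, sub_zero] at h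
  rw [← h]
  refine (Finset.abs_sum_le_sum_abs _ _).trans ?_
  exact Finset.sum_le_sum_of_subset_of_nonneg (Finset.range_subset_range.2 hk)
    fun _ _ _ => abs_nonneg _

lemma hamiltonian_eq_range (V : ℝ → ℝ) (x : Omega N) :
    hamiltonian V x = ∑ j ∈ Finset.range N, V (height x (j + 1) - height x j) := by
  have e : Finset.Icc 1 N = Finset.Ico (0 + 1) (N + 1) := by ext; simp
  rw [hamiltonian, Finset.range_eq_Ico, e, ← Finset.sum_Ico_add']
  rfl

/-- The energy controls the total variation of the path, which controls each height because the path
starts at zero. The dependence on `N` is crude, and only serves integrability for fixed `N`. -/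
lemma Coercive.hamiltonian_ge (h : Coercive V κ C K) (x : Omega N) :
    κ / N * (∑ k, |x k|) - C * N ≤ hamiltonian V x := by
  rcases Nat.eq_zero_or_pos N with rfl | hN
  · simp [hamiltonian]
  have hN' : (0 : ℝ) < N := by exact_mod_cast hN
  rw [hamiltonian_eq_range]
  set T := ∑ j ∈ Finset.range N, |height x (j + 1) - height x j| with hT
  have h1 : κ * T - C * N ≤ ∑ j ∈ Finset.range N, V (height x (j + 1) - height x j) := by
    calc κ * T - C * N = ∑ j ∈ Finset.range N, (κ * |height x (j + 1) - height x j| - C) := by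
          rw [Finset.sum_sub_distrib, ← Finset.mul_sum]; simp [hT, mul_comm]
      _ ≤ _ := Finset.sum_le_sum fun j _ => h.lower _
  have hT0 : 0 ≤ T := Finset.sum_nonneg fun _ _ => abs_nonneg _
  have h2 : ∑ k, |x k| ≤ N * T := by
    calc ∑ k, |x k| ≤ ∑ _k : ↥(Finset.Ioo 0 N), T := by
          refine Finset.sum_le_sum fun k _ => ?_
          rw [← height_coe x k]
          exact abs_height_le_sum x (Finset.mem_Ioo.1 k.2).2.le
      _ = (N - 1 : ℕ) * T := by
          rw [Finset.sum_const, Finset.card_univ, card_sites, nsmul_eq_mul]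
      _ ≤ N * T := by gcongr; omega
  have h3 : κ / N * ∑ k, |x k| ≤ κ / N * (N * T) :=
    mul_le_mul_of_nonneg_left h2 (div_nonneg h.kpos.le hN'.le)
  have h4 : κ / N * (N * T) = κ * T := by field_simp
  linarith

lemma Coercive.integrable_gibbs_aux (h : Coercive V κ C K) (hN : 2 ≤ N) {g : Omega N → ℝ}
    (hg : Measurable g) (hgb : ∀ x, |g x| ≤ ∏ k, (1 + |x k|)) :
    Integrable fun x : Omega N => g x * Real.exp (-hamiltonian V x) := by
  have hN' : (0 : ℝ) < N := by exact_mod_cast (by omega : 0 < N)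
  have hκ : 0 < κ / N := div_pos h.kpos hN'
  have h1 : Integrable fun t : ℝ => (1 + |t|) * Real.exp (-(κ / N) * |t|) := by
    refine integrable_mul_of_exp_bound (A := 1) (B := 1) (b := 0) (n := 1) hκ (by fun_prop)
      (by fun_prop) (fun u => ?_) (fun u => ?_)
    · rw [abs_of_pos (Real.exp_pos _)]; simp
    · rw [abs_of_nonneg (by positivity)]; simp
  have h2 : Integrable fun x : Omega N => ∏ k, ((1 + |x k|) * Real.exp (-(κ / N) * |x k|)) :=
    Integrable.fintype_prod (f := fun (_ : ↥(Finset.Ioo 0 N)) (t : ℝ) =>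
      (1 + |t|) * Real.exp (-(κ / N) * |t|)) fun _ => h1
  refine Integrable.mono' (h2.const_mul (Real.exp (C * N)))
    (hg.mul h.measurable_hamiltonian.neg.exp).aestronglyMeasurable (ae_of_all _ fun x => ?_)
  rw [Real.norm_eq_abs, abs_mul, abs_of_pos (Real.exp_pos _), Finset.prod_mul_distrib,
    ← Real.exp_sum, mul_left_comm]
  refine mul_le_mul (hgb x) ?_ (Real.exp_pos _).le (Finset.prod_nonneg fun _ _ => by positivity)
  rw [← Real.exp_add]
  apply Real.exp_le_exp.2
  have := h.hamiltonian_ge x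
  rw [← Finset.mul_sum]
  linarith

lemma Coercive.integrable_exp_neg_hamiltonian (h : Coercive V κ C K) (hN : 2 ≤ N) :
    Integrable fun x : Omega N => Real.exp (-hamiltonian V x) := by
  simpa using h.integrable_gibbs_aux hN (g := fun _ => 1) measurable_const fun x => by
    rw [abs_one]
    have := Finset.prod_le_prod (s := Finset.univ) (f := fun _ : ↥(Finset.Ioo 0 N) => (1 : ℝ))
      (g := fun k => 1 + |x k|) (fun _ _ => zero_le_one) (fun k _ => by simp)
    simpa using this

lemma Coercive.integral_exp_neg_hamiltonian_pos (h : Coercive V κ C K) (hN : 2 ≤ N) :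
    0 < ∫ x : Omega N, Real.exp (-hamiltonian V x) := by
  rw [integral_pos_iff_support_of_nonneg (fun x => (Real.exp_pos _).le)
    (h.integrable_exp_neg_hamiltonian hN)]
  have : Function.support (fun x : Omega N => Real.exp (-hamiltonian V x)) = univ := by
    ext x; simp [(Real.exp_pos _).ne']
  rw [this]
  exact isOpen_univ.measure_pos volume univ_nonempty

lemma Coercive.isProbabilityMeasure_gibbs (h : Coercive V κ C K) (hN : 2 ≤ N) :
    IsProbabilityMeasure (gibbs V N) := by
  constructor
  have h0 := h.integral_exp_neg_hamiltonian_pos hN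
  rw [gibbs, withDensity_apply _ MeasurableSet.univ, Measure.restrict_univ,
    ← ofReal_integral_eq_lintegral_ofReal ((h.integrable_exp_neg_hamiltonian hN).div_const _)
      (ae_of_all _ fun u => div_nonneg (Real.exp_pos _).le h0.le), integral_div, div_self h0.ne',
    ENNReal.ofReal_one]

lemma Coercive.integrable_gibbs (h : Coercive V κ C K) (hN : 2 ≤ N) (k : ↥(Finset.Ioo 0 N)) :
    Integrable (fun x : Omega N => x k) (gibbs V N) := by
  have h0 := h.integral_exp_neg_hamiltonian_pos hN
  have hm := h.measurable_hamiltonian (N := N)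
  rw [gibbs, integrable_withDensity_iff_integrable_smul₀' (by fun_prop)
    (ae_of_all _ fun u => ENNReal.ofReal_lt_top)]
  have := h.integrable_gibbs_aux hN (g := fun x => x k) (measurable_pi_apply k) fun x => by
    rw [← Finset.mul_prod_erase _ _ (Finset.mem_univ k)]
    have := Finset.prod_le_prod (s := Finset.univ.erase k)
      (f := fun _ : ↥(Finset.Ioo 0 N) => (1 : ℝ))
      (g := fun k => 1 + |x k|) (fun _ _ => zero_le_one) (fun k _ => by simp)
    rw [Finset.prod_const_one] at this
    nlinarith [abs_nonneg (x k)]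
  refine (this.div_const (∫ y : Omega N, Real.exp (-hamiltonian V y))).congr
    (ae_of_all _ fun x => ?_)
  simp only [smul_eq_mul]
  rw [ENNReal.toReal_ofReal (div_nonneg (Real.exp_pos _).le h0.le)]
  ring

lemma exists_hamiltonian_update (V : ℝ → ℝ) (k : ↥(Finset.Ioo 0 N)) (x : Omega N) :
    ∃ R : ℝ, ∀ v, hamiltonian V (Function.update x k v) =
      R + (V (v - height x (k - 1)) + V (height x (k + 1) - v)) := by
  have hk := Finset.mem_Ioo.1 k.2
  have hk1 : (k : ℕ) ∈ Finset.Icc 1 N := Finset.mem_Icc.2 ⟨hk.1, hk.2.le⟩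
  have hk2 : (k : ℕ) + 1 ∈ (Finset.Icc 1 N).erase k :=
    Finset.mem_erase.2 ⟨by omega, Finset.mem_Icc.2 ⟨by omega, hk.2⟩⟩
  refine ⟨∑ j ∈ ((Finset.Icc 1 N).erase k).erase (k + 1), V (height x j - height x (j - 1)),
    fun v => ?_⟩
  rw [hamiltonian, ← Finset.add_sum_erase _ _ hk1, ← Finset.add_sum_erase _ _ hk2, height_update,
    Function.update_self, Function.update_of_ne (by omega), Function.update_of_ne (by omega),
    Nat.add_sub_cancel, Function.update_self]
  have : ∑ j ∈ ((Finset.Icc 1 N).erase k).erase (k + 1),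
      V (Function.update (height x) (k : ℕ) v j - Function.update (height x) (k : ℕ) v (j - 1)) =
      ∑ j ∈ ((Finset.Icc 1 N).erase k).erase (k + 1), V (height x j - height x (j - 1)) := by
    refine Finset.sum_congr rfl fun j hj => ?_
    simp only [Finset.mem_erase, Finset.mem_Icc] at hj
    rw [Function.update_of_ne (by omega), Function.update_of_ne (by omega)]
  rw [this]; ring

/-- Along a line in direction `k` the Gibbs density is a multiple of `wt`, so resampling from the
normalised weight preserves every integral along that line. Marginalising over the single coordinate
`k` reduces the claim to this. -/
lemma Coercive.siteStep_gibbs (h : Coercive V κ C K) (hN : 2 ≤ N) (k : ↥(Finset.Ioo 0 N)) :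
    siteStep (siteMap V k) (gibbs V N) = gibbs V N := by
  have := h.isProbabilityMeasure_gibbs hN
  have hm := h.measurable_hamiltonian (N := N)
  have hk := Finset.mem_Ioo.1 k.2
  refine Measure.ext_of_lintegral _ fun f hf => ?_
  have hg := measurable_lintegral_unif (h.measurable_siteMap k) hf
  rw [lintegral_siteStep (h.measurable_siteMap k) _ hf, gibbs,
    lintegral_withDensity_eq_lintegral_mul _ (by fun_prop) hg,
    lintegral_withDensity_eq_lintegral_mul _ (by fun_prop) hf]
  have hZ0 := h.integral_exp_neg_hamiltonian_pos hN
  set Z := ∫ y : Omega N, Real.exp (-hamiltonian V y) with hZ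
  clear_value Z
  rw [volume_pi]
  refine lintegral_eq_of_lmarginal_eq {k} ?_ ?_ ?_
  · exact Measurable.mul (by fun_prop) hg
  · exact Measurable.mul (by fun_prop) hf
  ext x
  rw [lmarginal_singleton, lmarginal_singleton]
  obtain ⟨R, hR⟩ := exists_hamiltonian_update V k x
  set b := height x (k - 1) with hb
  set c := height x (k + 1) with hc
  have e1 : ∀ v, Real.exp (-hamiltonian V (Function.update x k v)) / Z =
      Real.exp (-R) / Z * wt V b c v := by
    intro v
    rw [hR, wt, div_mul_eq_mul_div, ← Real.exp_add]; ring_nf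
  have e2 : ∀ v u, siteMap V k (Function.update x k v) u = Function.update x k (Qt V b c u) := by
    intro v u
    rw [siteMap, Function.update_idem, height_update, Function.update_of_ne (by omega),
      Function.update_of_ne (by omega)]
  have hf' : Measurable fun u => f (Function.update x k u) := by fun_prop
  have hw := h.measurable_wt' b c
  have hZw := h.integral_wt_pos b c
  have hc0 : 0 ≤ Real.exp (-R) / Z := by positivity
  simp only [Pi.mul_apply, e1, e2]
  rw [h.lintegral_Qt b c hf', lintegral_dens hw hf', lintegral_mul_const _ (by fun_prop)]
  have e3 : ∫⁻ a, ENNReal.ofReal (Real.exp (-R) / Z * wt V b c a) =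
      ENNReal.ofReal (Real.exp (-R) / Z * ∫ u, wt V b c u) := by
    rw [← ofReal_integral_eq_lintegral_ofReal ((h.integrable_wt b c).const_mul _)
      (ae_of_all _ fun u => mul_nonneg hc0 (wt_pos _ _ _ _).le), integral_const_mul]
  rw [e3, ← lintegral_const_mul _ (by fun_prop)]
  refine lintegral_congr fun u => ?_
  rw [← mul_assoc, ← ENNReal.ofReal_mul (by positivity)]
  congr 2
  field_simp

lemma Coercive.evolve_gibbs (h : Coercive V κ C K) (hN : 2 ≤ N) (n : ℕ) :
    evolve (siteMap V) n (gibbs V N) = gibbs V N :=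
  have := nonempty_sites hN
  evolve_eq_self (h.siteStep_gibbs hN) n

end
end GradPhi
end

/-! ### Contraction of the mean height differences. -/

noncomputable section
namespace GradPhi

section
variable {V : ℝ → ℝ} {κ C : ℝ} {K : ℕ} {N : ℕ}

/-- The mean distance of the heights at `k` under a coupling. -/
def meanGap (Γ : Measure (Omega N × Omega N)) (k : ℕ) : ℝ≥0∞ :=
  ∫⁻ p, ENNReal.ofReal |height p.1 k - height p.2 k| ∂Γ

lemma measurable_gap (k : ℕ) :
    Measurable fun p : Omega N × Omega N => ENNReal.ofReal |height p.1 k - height p.2 k| := by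
  have h1 : Measurable fun p : Omega N × Omega N => height p.1 k :=
    (measurable_height k).comp measurable_fst
  have h2 : Measurable fun p : Omega N × Omega N => height p.2 k :=
    (measurable_height k).comp measurable_snd
  fun_prop

/-- Two copies of the Gibbs sampler driven by the same sites and uniform variables. -/
abbrev twoMap (V : ℝ → ℝ) (N : ℕ) := pairMap (siteMap V (N := N)) (siteMap V (N := N))

lemma Coercive.measurable_twoMap (h : Coercive V κ C K) (i : ↥(Finset.Ioo 0 N)) :
    Measurable fun p : (Omega N × Omega N) × ℝ => twoMap V N i p.1 p.2 :=
  measurable_pairMap h.measurable_siteMap h.measurable_siteMap i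

lemma meanGap_of_not_mem (Γ : Measure (Omega N × Omega N)) {k : ℕ} (hk : k ∉ Finset.Ioo 0 N) :
    meanGap Γ k = 0 := by
  simp only [meanGap, height, hk, dite_false]; simp

lemma Coercive.meanGap_siteStep_of_ne (h : Coercive V κ C K) (Γ : Measure (Omega N × Omega N))
    [IsProbabilityMeasure Γ] (i : ↥(Finset.Ioo 0 N)) {k : ℕ} (hk : k ≠ i) :
    meanGap (siteStep (twoMap V N i) Γ) k = meanGap Γ k := by
  rw [meanGap, lintegral_siteStep (h.measurable_twoMap i) _ (measurable_gap k), meanGap]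
  refine lintegral_congr fun p => ?_
  simp only [twoMap, pairMap, height_siteMap, pathMap, Function.update_of_ne hk, lintegral_const,
    measure_univ, mul_one]

lemma Coercive.meanGap_siteStep_self (h : Coercive V κ C K) (Γ : Measure (Omega N × Omega N))
    [IsProbabilityMeasure Γ] (i : ↥(Finset.Ioo 0 N)) :
    meanGap (siteStep (twoMap V N i) Γ) i ≤
      ENNReal.ofReal (1 / 2) * (meanGap Γ (i - 1) + meanGap Γ (i + 1)) := by
  rw [meanGap, lintegral_siteStep (h.measurable_twoMap i) _ (measurable_gap i), meanGap, meanGap,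
    ← lintegral_add_left (measurable_gap _),
    ← lintegral_const_mul' _ _ ENNReal.ofReal_ne_top]
  refine lintegral_mono fun p => ?_
  simp only [twoMap, pairMap, height_siteMap, pathMap, Function.update_self]
  refine (h.lintegral_abs_Qt_sub_le _ _ _ _).trans ?_
  rw [← ENNReal.ofReal_add (abs_nonneg _) (abs_nonneg _), ← ENNReal.ofReal_mul (by norm_num)]
  apply ENNReal.ofReal_le_ofReal
  linarith

/-- A maximum principle. The profile `w` is a supersolution of the averaging operator with
eigenvalue `q`; the site `k` is the updated one with probability `1 / (N - 1)`, and only then is `w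
k` replaced by `q * w k`. -/
lemma Coercive.meanGap_step_le (h : Coercive V κ C K) (hN : 2 ≤ N)
    (Γ : Measure (Omega N × Omega N)) [IsProbabilityMeasure Γ] {w : ℕ → ℝ} {q : ℝ}
    (hw : ∀ k ≤ N, 0 ≤ w k) (hq : 0 ≤ q)
    (hwq : ∀ k, 0 < k → k < N → (w (k - 1) + w (k + 1)) / 2 ≤ q * w k)
    (hΓ : ∀ k ≤ N, meanGap Γ k ≤ ENNReal.ofReal (w k)) {k : ℕ} (hk : k ≤ N) :
    meanGap (step (twoMap V N) Γ) k ≤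
      ENNReal.ofReal ((1 - (1 - q) / ((N - 1 : ℕ) : ℝ)) * w k) := by
  have hc : (1 : ℝ) ≤ ((N - 1 : ℕ) : ℝ) := by exact_mod_cast (by omega : 1 ≤ N - 1)
  by_cases hkm : k ∈ Finset.Ioo 0 N
  · have hk' := Finset.mem_Ioo.1 hkm
    lift k to ↥(Finset.Ioo 0 N) using hkm
    rw [meanGap, lintegral_step_eq_sum, card_sites, ← Finset.add_sum_erase _ _ (Finset.mem_univ k)]
    have h1 : meanGap (siteStep (twoMap V N k) Γ) k ≤ ENNReal.ofReal (q * w k) := by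
      refine (h.meanGap_siteStep_self Γ k).trans ?_
      calc ENNReal.ofReal (1 / 2) * (meanGap Γ (k - 1) + meanGap Γ (k + 1))
          ≤ ENNReal.ofReal (1 / 2) * (ENNReal.ofReal (w (k - 1)) + ENNReal.ofReal (w (k + 1))) := by
            gcongr
            · exact hΓ _ (by omega)
            · exact hΓ _ (by omega)
        _ = ENNReal.ofReal ((w (k - 1) + w (k + 1)) / 2) := by
            rw [← ENNReal.ofReal_add (hw _ (by omega)) (hw _ (by omega)),
              ← ENNReal.ofReal_mul (by norm_num)]
            congr 1; ring
        _ ≤ _ := ENNReal.ofReal_le_ofReal (hwq k hk'.1 hk'.2)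
    have h2 : ∀ i ∈ Finset.univ.erase k, meanGap (siteStep (twoMap V N i) Γ) k ≤
        ENNReal.ofReal (w k) := by
      intro i hi
      have hi' : (k : ℕ) ≠ i := fun hh => (Finset.mem_erase.1 hi).1 (Subtype.ext hh.symm)
      rw [h.meanGap_siteStep_of_ne Γ i hi']
      exact hΓ k hk
    have h3 := Finset.sum_le_sum h2
    rw [Finset.sum_const, Finset.card_erase_of_mem (Finset.mem_univ _), Finset.card_univ,
      card_sites, nsmul_eq_mul] at h3
    calc _ ≤ ((N - 1 : ℕ) : ℝ≥0∞)⁻¹ * (ENNReal.ofReal (q * w k) +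
          ((N - 1 - 1 : ℕ) : ℝ≥0∞) * ENNReal.ofReal (w k)) := by
          refine mul_le_mul_right ?_ _
          exact add_le_add h1 h3
      _ = _ := by
          rw [← ENNReal.ofReal_natCast, ← ENNReal.ofReal_natCast,
            ← ENNReal.ofReal_inv_of_pos (by linarith), ← ENNReal.ofReal_mul (by positivity),
            ← ENNReal.ofReal_add (mul_nonneg hq (hw _ hk)) (mul_nonneg (by positivity) (hw _ hk)),
            ← ENNReal.ofReal_mul (by positivity)]
          congr 1
          rw [Nat.cast_sub (by omega : 1 ≤ N - 1)]
          have : ((N - 1 : ℕ) : ℝ) ≠ 0 := by linarith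
          field_simp
          push_cast
          ring
  · rw [meanGap_of_not_mem _ hkm]
    exact zero_le

lemma Coercive.meanGap_evolve_le (h : Coercive V κ C K) (hN : 2 ≤ N)
    (Γ : Measure (Omega N × Omega N)) [IsProbabilityMeasure Γ] {w : ℕ → ℝ} {q : ℝ}
    (hw : ∀ k ≤ N, 0 ≤ w k) (hq : 0 ≤ q)
    (hwq : ∀ k, 0 < k → k < N → (w (k - 1) + w (k + 1)) / 2 ≤ q * w k)
    (hΓ : ∀ k ≤ N, meanGap Γ k ≤ ENNReal.ofReal (w k)) (n : ℕ) {k : ℕ} (hk : k ≤ N) :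
    meanGap (evolve (twoMap V N) n Γ) k ≤
      ENNReal.ofReal ((1 - (1 - q) / ((N - 1 : ℕ) : ℝ)) ^ n * w k) := by
  have := nonempty_sites hN
  have hc : (1 : ℝ) ≤ ((N - 1 : ℕ) : ℝ) := by exact_mod_cast (by omega : 1 ≤ N - 1)
  have hr : 0 ≤ 1 - (1 - q) / ((N - 1 : ℕ) : ℝ) := by
    rw [sub_nonneg, div_le_one (by linarith)]; linarith
  induction n generalizing k with
  | zero => rw [pow_zero, one_mul]; exact hΓ k hk
  | succ n ih =>
    have := isProbabilityMeasure_evolve h.measurable_twoMap n Γ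
    rw [evolve_succ, pow_succ', mul_assoc]
    refine h.meanGap_step_le hN _ (w := fun k => (1 - (1 - q) / ((N - 1 : ℕ) : ℝ)) ^ n * w k)
      (fun k hk => mul_nonneg (pow_nonneg hr n) (hw k hk)) hq (fun k h0 h1 => ?_)
      (fun k hk => ih hk) hk
    have := mul_le_mul_of_nonneg_left (hwq k h0 h1) (pow_nonneg hr n)
    linarith

/-- By the half-angle formula this is the concavity bound `s * sin (y / 2) ≤ sin (s * (y / 2))`,
squared. It measures the loss of rate when the frequency `π / N` is lowered by a factor. -/
lemma one_sub_cos_mul_ge {s y : ℝ} (hs : 0 ≤ s) (hs1 : s ≤ 1) (hy : 0 ≤ y) (hy1 : y ≤ Real.pi) :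
    s ^ 2 * (1 - Real.cos y) ≤ 1 - Real.cos (s * y) := by
  have e : ∀ z : ℝ, 1 - Real.cos z = 2 * Real.sin (z / 2) ^ 2 := by
    intro z
    have := Real.cos_sq (z / 2)
    rw [show 2 * (z / 2) = z by ring] at this
    have h2 := Real.sin_sq_add_cos_sq (z / 2)
    linarith
  rw [e, e]
  have hpi := Real.pi_pos
  have h1 := strictConcaveOn_sin_Icc.concaveOn.2 (x := 0) (y := y / 2) ⟨le_rfl, hpi.le⟩
    ⟨by linarith, by linarith⟩ (show 0 ≤ 1 - s by linarith) hs (by ring)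
  simp only [smul_eq_mul, Real.sin_zero, mul_zero, zero_add] at h1
  have h0 : 0 ≤ Real.sin (y / 2) := Real.sin_nonneg_of_nonneg_of_le_pi (by linarith) (by linarith)
  have h2 : s * y / 2 = s * (y / 2) := by ring
  rw [h2]
  have := pow_le_pow_left₀ (mul_nonneg hs h0) h1 2
  rw [mul_pow] at this
  linarith

/-- Contraction of the mean heights at almost the optimal rate. -/
lemma Coercive.meanGap_evolve_le_exp (h : Coercive V κ C K) (hN : 2 ≤ N) {η : ℝ} (hη : 0 < η)
    (hη1 : η < 1) (Γ : Measure (Omega N × Omega N)) [IsProbabilityMeasure Γ] {D : ℝ} (hD : 0 ≤ D)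
    (hΓ : ∀ k ≤ N, meanGap Γ k ≤ ENNReal.ofReal D) (n : ℕ) {k : ℕ} (hk : k ≤ N) :
    meanGap (evolve (twoMap V N) n Γ) k ≤ ENNReal.ofReal
      (D / Real.sin (Real.pi * η / 2) *
        Real.exp (-((1 - η) ^ 2 * lam N * n / ((N - 1 : ℕ) : ℝ)))) := by
  have hpi := Real.pi_pos
  have hN0 : (2 : ℝ) ≤ N := by exact_mod_cast hN
  have hc : (1 : ℝ) ≤ ((N - 1 : ℕ) : ℝ) := by exact_mod_cast (by omega : 1 ≤ N - 1)
  -- A frequency slightly below the Dirichlet one: the cosine mode is then at least `sin (π η / 2)`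
  -- up to both ends, so a constant initial profile is dominated at the price of a factor
  -- independent of `N`.
  set α := (1 - η) * (Real.pi / N) with hα
  have hα0 : 0 ≤ α := mul_nonneg (by linarith) (by positivity)
  have hpN : Real.pi / N ≤ Real.pi / 2 := by gcongr
  have hα1 : α ≤ Real.pi / 2 := by nlinarith [div_pos hpi (by linarith : (0 : ℝ) < N)]
  have hm0 : 0 < Real.sin (Real.pi * η / 2) :=
    Real.sin_pos_of_pos_of_lt_pi (by positivity) (by nlinarith)
  set m := Real.sin (Real.pi * η / 2) with hm
  have hq0 : 0 ≤ Real.cos α := Real.cos_nonneg_of_neg_pi_div_two_le_of_le (by linarith) hα1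
  set v : ℕ → ℝ := fun k => Real.cos (α * (k - N / 2)) with hv
  have hvm : ∀ k ≤ N, m ≤ v k := by
    intro k hk
    have hkN : (k : ℝ) ≤ N := by exact_mod_cast hk
    have hk0 : (0 : ℝ) ≤ k := by positivity
    have e : m = Real.cos (Real.pi / 2 - Real.pi * η / 2) := by rw [Real.cos_pi_div_two_sub]
    rw [e, hv]
    dsimp only
    rw [← Real.cos_abs (α * _)]
    have hb : |α * (k - N / 2)| ≤ Real.pi / 2 - Real.pi * η / 2 := by
      have e2 : Real.pi / 2 - Real.pi * η / 2 = α * (N / 2) := by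
        rw [hα]; field_simp
      rw [e2, abs_mul, abs_of_nonneg hα0]
      refine mul_le_mul_of_nonneg_left ?_ hα0
      rw [abs_le]; constructor <;> linarith
    exact Real.cos_le_cos_of_nonneg_of_le_pi (abs_nonneg _) (by nlinarith) hb
  have hv1 : ∀ k, v k ≤ 1 := fun k => Real.cos_le_one _
  have key := h.meanGap_evolve_le hN Γ (w := fun k => D / m * v k) (q := Real.cos α)
    (fun k hk => mul_nonneg (by positivity) (hm0.le.trans (hvm k hk))) hq0 (fun k h0 h1 => ?_)
    (fun k hk => (hΓ k hk).trans (ENNReal.ofReal_le_ofReal ?_)) n hk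
  · refine key.trans (ENNReal.ofReal_le_ofReal ?_)
    have h1 : 1 - (1 - Real.cos α) / ((N - 1 : ℕ) : ℝ) ≤
        Real.exp (-((1 - η) ^ 2 * lam N / ((N - 1 : ℕ) : ℝ))) := by
      have h2 := one_sub_cos_mul_ge (s := 1 - η) (y := Real.pi / N) (by linarith) (by linarith)
        (by positivity) (by linarith)
      have h3 := Real.add_one_le_exp (-((1 - η) ^ 2 * lam N / ((N - 1 : ℕ) : ℝ)))
      have h4 : (1 - η) ^ 2 * lam N / ((N - 1 : ℕ) : ℝ) ≤
          (1 - Real.cos α) / ((N - 1 : ℕ) : ℝ) := by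
        gcongr; exact h2
      linarith
    have h0 : 0 ≤ 1 - (1 - Real.cos α) / ((N - 1 : ℕ) : ℝ) := by
      rw [sub_nonneg, div_le_one (by linarith)]; linarith
    calc (1 - (1 - Real.cos α) / ((N - 1 : ℕ) : ℝ)) ^ n * (D / m * v k)
        ≤ Real.exp (-((1 - η) ^ 2 * lam N / ((N - 1 : ℕ) : ℝ))) ^ n * (D / m * 1) := by
          have := hm0.le.trans (hvm k hk)
          gcongr
          exact hv1 k
      _ = _ := by
          rw [← Real.exp_nat_mul, mul_one, mul_comm]
          congr 2
          ring
  · have e : v (k - 1) + v (k + 1) = 2 * Real.cos α * v k := by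
      simp only [hv]
      rw [Nat.cast_sub (by omega : 1 ≤ k)]
      push_cast
      rw [show α * ((k : ℝ) - 1 - N / 2) = α * (k - N / 2) - α by ring,
        show α * ((k : ℝ) + 1 - N / 2) = α * (k - N / 2) + α by ring, Real.cos_sub, Real.cos_add]
      ring
    rw [← mul_add, e]
    apply le_of_eq; ring
  · have := hvm k hk
    rw [div_mul_eq_mul_div, le_div_iff₀ hm0]
    exact mul_le_mul_of_nonneg_left this hD

end
end GradPhi
end

/-! ### Tilted single-bond laws with means of both signs. -/

noncomputable section
namespace GradPhi

/-- Unnormalised single-bond density. -/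
def bondW (V : ℝ → ℝ) (a x : ℝ) : ℝ := Real.exp (-(V x - a * x))

lemma bondW_pos (V : ℝ → ℝ) (a x : ℝ) : 0 < bondW V a x := Real.exp_pos _

lemma Coercive.abs_bondW_le {V : ℝ → ℝ} {κ C a : ℝ} {K : ℕ}
    (h : Coercive (fun x => V x - a * x) κ C K) (u : ℝ) :
    |bondW V a u| ≤ Real.exp C * Real.exp (-κ * |u - 0|) := by
  rw [abs_of_pos (bondW_pos _ _ _), bondW, ← Real.exp_add, sub_zero]
  apply Real.exp_le_exp.2
  have := h.lower u
  linarith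

lemma Coercive.measurable_bondW {V : ℝ → ℝ} {κ C a : ℝ} {K : ℕ}
    (h : Coercive (fun x => V x - a * x) κ C K) : Measurable (bondW V a) := by
  have := h.meas
  unfold bondW; fun_prop

lemma Coercive.integrable_mul_bondW {V : ℝ → ℝ} {κ C a : ℝ} {K : ℕ}
    (h : Coercive (fun x => V x - a * x) κ C K) {g : ℝ → ℝ} (hg : Measurable g)
    {B : ℝ} {n : ℕ} (hgb : ∀ u, |g u| ≤ B * (1 + |u|) ^ n) :
    Integrable fun u => g u * bondW V a u :=
  integrable_mul_of_exp_bound (b := 0) h.kpos h.measurable_bondW hg h.abs_bondW_le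
    (by simpa using hgb)

lemma Coercive.integrable_bondW {V : ℝ → ℝ} {κ C a : ℝ} {K : ℕ}
    (h : Coercive (fun x => V x - a * x) κ C K) : Integrable (bondW V a) := by
  simpa using h.integrable_mul_bondW (g := fun _ => 1) measurable_const (B := 1) (n := 0) (by simp)

lemma Coercive.integrable_id_mul_bondW {V : ℝ → ℝ} {κ C a : ℝ} {K : ℕ}
    (h : Coercive (fun x => V x - a * x) κ C K) : Integrable fun u => u * bondW V a u :=
  h.integrable_mul_bondW (g := fun u => u) measurable_id (B := 1) (n := 1) (by simp)

/-- A slope strictly between the two slopes at infinity leaves a margin `κ` on either side. This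
gives linear growth far away, and the remaining compact interval is absorbed in the constant. -/
lemma exists_coercive {V : ℝ → ℝ} (hV : ConvexOn ℝ univ V)
    (hgr : ∃ C K : ℝ, 0 < C ∧ 1 ≤ K ∧ ∀ x : ℝ, |V x| ≤ C * (1 + |x|) ^ K) {sp sm : EReal}
    (hsp : Tendsto (fun x : ℝ => ((V x / x : ℝ) : EReal)) atTop (𝓝 sp))
    (hsm : Tendsto (fun x : ℝ => ((V x / x : ℝ) : EReal)) atBot (𝓝 sm)) {a : ℝ}
    (h1 : sm < a) (h2 : (a : EReal) < sp) :
    ∃ (κ C : ℝ) (K : ℕ), Coercive (fun x => V x - a * x) κ C K := by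
  obtain ⟨C, K, hC, hK, hg⟩ := hgr
  obtain ⟨p, hp1, hp2⟩ := EReal.exists_between_coe_real h2
  obtain ⟨m, hm1, hm2⟩ := EReal.exists_between_coe_real h1
  rw [EReal.coe_lt_coe_iff] at hp1 hm2
  obtain ⟨R1, hR1⟩ := eventually_atTop.1 (hsp.eventually (lt_mem_nhds hp2))
  obtain ⟨R2, hR2⟩ := eventually_atBot.1 (hsm.eventually (gt_mem_nhds hm1))
  set κ := min (p - a) (a - m) with hκ
  have hκ0 : 0 < κ := lt_min (by linarith) (by linarith)
  set R := max (max R1 (-R2)) 1 with hR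
  have hcont : Continuous V := continuousOn_univ.1 (hV.continuousOn isOpen_univ)
  obtain ⟨B, hB⟩ := (isCompact_Icc (a := -R) (b := R)).bddBelow_image
    (f := fun x => V x - a * x - κ * |x|) (by fun_prop)
  have hlin : ConvexOn ℝ univ (fun x => V x - a * x) := by
    have : ConvexOn ℝ univ (fun x : ℝ => -(a * x)) :=
      ((LinearMap.mulLeft ℝ (-a)).convexOn convex_univ).congr fun x _ => by simp
    exact (hV.add this).congr fun x _ => by simp [sub_eq_add_neg]
  refine ⟨κ, max (C + |a|) |B|, ⌈K⌉₊, hlin, hκ0, ?_, fun x => ?_, fun x => ?_⟩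
  · exact lt_of_lt_of_le (by positivity) (le_max_left _ _)
  · have hle := le_max_right (C + |a|) |B|
    rcases le_or_gt |x| R with hx | hx
    · have := hB ⟨x, abs_le.1 hx, rfl⟩
      have h3 := neg_abs_le B
      dsimp only at this
      linarith
    · have h0 := abs_nonneg B
      have hR1' : R1 ≤ R := (le_max_left _ _).trans (le_max_left _ _)
      have hR2' : -R2 ≤ R := (le_max_right _ _).trans (le_max_left _ _)
      have hR3 : 1 ≤ R := le_max_right _ _
      rcases lt_or_ge 0 x with h0x | h0x
      · rw [abs_of_pos h0x] at hx ⊢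
        have := hR1 x (by linarith)
        rw [EReal.coe_lt_coe_iff, lt_div_iff₀ h0x] at this
        have hk : κ ≤ p - a := min_le_left _ _
        nlinarith
      · rw [abs_of_nonpos h0x] at hx ⊢
        have := hR2 x (by linarith)
        rw [EReal.coe_lt_coe_iff, div_lt_iff_of_neg (by linarith)] at this
        have hk : κ ≤ a - m := min_le_right _ _
        nlinarith
  · have h3 : (1 + |x|) ^ K ≤ (1 + |x|) ^ ⌈K⌉₊ := by
      rw [← Real.rpow_natCast]
      exact Real.rpow_le_rpow_of_exponent_le (by linarith [abs_nonneg x]) (Nat.le_ceil K)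
    have h4 : 1 + |x| ≤ (1 + |x|) ^ ⌈K⌉₊ :=
      le_self_pow₀ (by linarith [abs_nonneg x]) (Nat.ceil_pos.2 (by linarith)).ne'
    have h5 := abs_sub (V x) (a * x)
    calc |V x - a * x| ≤ |V x| + |a| * |x| := by rw [← abs_mul]; exact h5
      _ ≤ C * (1 + |x|) ^ ⌈K⌉₊ + |a| * (1 + |x|) ^ ⌈K⌉₊ := by
          have := mul_le_mul_of_nonneg_left h3 hC.le
          have h6 := mul_le_mul_of_nonneg_left (show |x| ≤ (1 + |x|) ^ ⌈K⌉₊ by linarith)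
            (abs_nonneg a)
          linarith [hg x]
      _ = (C + |a|) * (1 + |x|) ^ ⌈K⌉₊ := by ring
      _ ≤ _ := by gcongr; exact le_max_left _ _

/-- Tilting the single-bond density close to the slope of the potential at `+∞` makes the mean
positive. -/
lemma exists_tilt_pos_mean {V : ℝ → ℝ} (hV : ConvexOn ℝ univ V) {sp : EReal}
    (hsp : Tendsto (fun x : ℝ => ((V x / x : ℝ) : EReal)) atTop (𝓝 sp)) {a₀ : ℝ}
    (h₀ : (a₀ : EReal) < sp) (hc : ∀ a : ℝ, a₀ ≤ a → (a : EReal) < sp →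
      ∃ (κ C : ℝ) (K : ℕ), Coercive (fun x => V x - a * x) κ C K) :
    ∃ a : ℝ, a₀ ≤ a ∧ (a : EReal) < sp ∧ 0 < ∫ x, x * bondW V a x := by
  obtain ⟨κ₀, C₀, K₀, hc₀⟩ := hc a₀ le_rfl h₀
  set M := ∫ x in Iic 0, x * bondW V a₀ x with hM
  -- If the weight is at least `exp (-(V 0 + 1))` on `[0, R]`, then the positive half contributes at
  -- least the first term, and `R` is taken large enough to outweigh the negative half `M` computed
  -- at the tilt `a₀`.
  obtain ⟨R, hR0, hR⟩ : ∃ R : ℝ, 0 < R ∧ 0 < Real.exp (-(V 0 + 1)) * (R ^ 2 / 2) + M := by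
    have hp := Real.exp_pos (-(V 0 + 1))
    refine ⟨2 * (|M| / Real.exp (-(V 0 + 1)) + 1), by positivity, ?_⟩
    have h1 : |M| / Real.exp (-(V 0 + 1)) * Real.exp (-(V 0 + 1)) = |M| := by field_simp
    have h2 : 0 ≤ |M| / Real.exp (-(V 0 + 1)) := by positivity
    have h3 := neg_abs_le M
    set E := Real.exp (-(V 0 + 1))
    set y := |M| / E
    have h4 : E * ((2 * (y + 1)) ^ 2 / 2) = 2 * (E * y ^ 2) + 4 * (y * E) + 2 * E := by ring
    have h5 : 0 ≤ E * y ^ 2 := by positivity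
    have h6 := abs_nonneg M
    rw [h4, h1]
    linarith
  -- By convexity, chord slopes from the origin increase to the slope at infinity.
  have hslope : (((V R - V 0) / R : ℝ) : EReal) ≤ sp := by
    have hlim : Tendsto (fun x : ℝ => ((((V R - V 0) / R + V 0 / x : ℝ)) : EReal)) atTop
        (𝓝 (((V R - V 0) / R : ℝ) : EReal)) := by
      rw [EReal.tendsto_coe]
      have h := (tendsto_const_nhds (x := V 0) (f := atTop (α := ℝ))).div_atTop tendsto_id
      simpa using h.const_add ((V R - V 0) / R)
    refine le_of_tendsto_of_tendsto hlim hsp ?_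
    filter_upwards [eventually_gt_atTop R] with x hx
    rw [EReal.coe_le_coe_iff]
    have hx0 : 0 < x := hR0.trans hx
    have h3 := hV.2 (mem_univ 0) (mem_univ x) (show 0 ≤ 1 - R / x by
      rw [sub_nonneg, div_le_one hx0]; exact hx.le) (show 0 ≤ R / x by positivity) (by ring)
    simp only [smul_eq_mul, mul_zero, zero_add, div_mul_cancel₀ _ hx0.ne'] at h3
    rw [← le_sub_iff_add_le, ← sub_div, div_le_div_iff₀ hR0 hx0]
    have h4 : x * V R ≤ x * ((1 - R / x) * V 0 + R / x * V x) :=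
      mul_le_mul_of_nonneg_left h3 hx0.le
    have h5 : x * ((1 - R / x) * V 0 + R / x * V x) = (x - R) * V 0 + R * V x := by
      field_simp
    nlinarith
  -- The slack `-1` keeps the tilt strictly below `sp`, while convexity still gives `V x - a * x ≤ V
  -- 0 + 1` on `[0, R]`.
  obtain ⟨a, ha0, ha1, ha2⟩ : ∃ a : ℝ, a₀ ≤ a ∧ (a : EReal) < sp ∧ (V R - V 0 - 1) / R ≤ a := by
    have hlt : (((V R - V 0 - 1) / R : ℝ) : EReal) < sp := by
      refine lt_of_lt_of_le ?_ hslope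
      rw [EReal.coe_lt_coe_iff]
      exact div_lt_div_of_pos_right (by linarith) hR0
    refine ⟨max a₀ ((V R - V 0 - 1) / R), le_max_left _ _, ?_, le_max_right _ _⟩
    rcases max_choice a₀ ((V R - V 0 - 1) / R) with h | h <;> rw [h] <;> assumption
  refine ⟨a, ha0, ha1, hR.trans_le ?_⟩
  obtain ⟨κ, C, K, hca⟩ := hc a ha0 ha1
  have hi := hca.integrable_id_mul_bondW
  have e := integral_add_compl (s := Iic (0 : ℝ)) measurableSet_Iic hi
  rw [compl_Iic] at e
  -- Increasing the tilt lowers the weight of the negative half-line, so its contribution to the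
  -- mean only rises.
  have h1 : M ≤ ∫ x in Iic 0, x * bondW V a x := by
    refine setIntegral_mono_on hc₀.integrable_id_mul_bondW.integrableOn hi.integrableOn
      measurableSet_Iic fun x hx => ?_
    have hx' : x ≤ 0 := hx
    refine mul_le_mul_of_nonpos_left ?_ hx'
    apply Real.exp_le_exp.2
    nlinarith
  have h2 : Real.exp (-(V 0 + 1)) * (R ^ 2 / 2) ≤ ∫ x in Ioi 0, x * bondW V a x := by
    calc Real.exp (-(V 0 + 1)) * (R ^ 2 / 2) = ∫ x in Ioc 0 R, x * Real.exp (-(V 0 + 1)) := by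
          rw [integral_mul_const, ← intervalIntegral.integral_of_le hR0.le, integral_id]; ring
      _ ≤ ∫ x in Ioc 0 R, x * bondW V a x := by
          refine setIntegral_mono_on ?_ hi.integrableOn measurableSet_Ioc fun x hx => ?_
          · exact (Continuous.integrableOn_Icc (by fun_prop)).mono_set Ioc_subset_Icc_self
          refine mul_le_mul_of_nonneg_left ?_ hx.1.le
          apply Real.exp_le_exp.2
          have hx0 : 0 < x := hx.1
          have hxR : x ≤ R := hx.2
          have h3 := hV.2 (mem_univ 0) (mem_univ R) (show 0 ≤ 1 - x / R by
            rw [sub_nonneg, div_le_one hR0]; exact hxR) (show 0 ≤ x / R by positivity) (by ring)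
          simp only [smul_eq_mul, mul_zero, zero_add, div_mul_cancel₀ _ hR0.ne'] at h3
          rw [div_le_iff₀ hR0] at ha2
          have h4 : x / R ≤ 1 := (div_le_one hR0).2 hxR
          have h5 : 0 ≤ x / R := by positivity
          have h6 : x / R * (V R - V 0 - 1) ≤ x / R * (a * R) :=
            mul_le_mul_of_nonneg_left ha2 h5
          have h7 : x / R * (a * R) = a * x := by field_simp
          nlinarith
      _ ≤ _ := by
          refine setIntegral_mono_set hi.integrableOn ?_ (LE.le.eventuallyLE Ioc_subset_Ioi_self)
          filter_upwards [ae_restrict_mem measurableSet_Ioi] with x hx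
          exact mul_nonneg (le_of_lt hx) (bondW_pos _ _ _).le
  linarith

/-- After subtracting a linear function from an admissible potential, it is coercive, and so are
two tilts, whose single-bond laws have means of opposite signs. -/
lemma IsAdmissible.exists_tilts {V : ℝ → ℝ} (hV : IsAdmissible V) :
    ∃ a₀ am ap : ℝ, am ≤ ap ∧
      (∃ (κ C : ℝ) (K : ℕ), Coercive (fun x => V x - a₀ * x) κ C K) ∧
      (∃ (κ C : ℝ) (K : ℕ), Coercive (fun x => (V x - a₀ * x) - am * x) κ C K) ∧
      (∃ (κ C : ℝ) (K : ℕ), Coercive (fun x => (V x - a₀ * x) - ap * x) κ C K) ∧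
      ∫ x, x * bondW (fun x => V x - a₀ * x) am x < 0 ∧
      0 < ∫ x, x * bondW (fun x => V x - a₀ * x) ap x := by
  obtain ⟨sp, sm, hsp, hsm, hlt⟩ := hV.nonaffine
  obtain ⟨a₀, h1, h2⟩ := EReal.exists_between_coe_real hlt
  have hc : ∀ a : ℝ, sm < a → (a : EReal) < sp →
      ∃ (κ C : ℝ) (K : ℕ), Coercive (fun x => V x - a * x) κ C K := fun a ha hb =>
    exists_coercive hV.convex hV.growth hsp hsm ha hb
  obtain ⟨ap, hp0, hp1, hp2⟩ := exists_tilt_pos_mean hV.convex hsp h2 fun a ha hb =>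
    hc a (h1.trans_le (EReal.coe_le_coe_iff.2 ha)) hb
  -- the reflected potential
  have hW : ConvexOn ℝ univ fun x => V (-x) := by
    have := hV.convex.comp_linearMap (-LinearMap.id : ℝ →ₗ[ℝ] ℝ)
    simpa [Function.comp_def] using this
  have hWp : Tendsto (fun x : ℝ => ((V (-x) / x : ℝ) : EReal)) atTop (𝓝 (-sm)) := by
    have := (continuous_neg.tendsto sm).comp (hsm.comp tendsto_neg_atTop_atBot)
    refine this.congr fun x => ?_
    simp only [Function.comp, ← EReal.coe_neg]
    congr 1
    rw [div_neg, neg_neg]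
  have hcW : ∀ a : ℝ, -a₀ ≤ a → (a : EReal) < -sm →
      ∃ (κ C : ℝ) (K : ℕ), Coercive (fun x => V (-x) - a * x) κ C K := by
    intro a ha hb
    have hb' : sm < ((-a : ℝ) : EReal) := by
      rw [EReal.coe_neg]; exact EReal.lt_neg_comm.1 hb
    obtain ⟨κ, C, K, h⟩ := hc (-a) hb' (lt_of_le_of_lt (EReal.coe_le_coe_iff.2 (by linarith)) h2)
    have hconv := h.convex.comp_linearMap (-LinearMap.id : ℝ →ₗ[ℝ] ℝ)
    refine ⟨κ, C, K, ⟨?_, h.kpos, h.cpos, fun x => ?_, fun x => ?_⟩⟩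
    · exact hconv.congr fun x _ => by simp [sub_eq_add_neg]
    · simpa using h.lower (-x)
    · simpa using h.growth (-x)
  have h1' : ((-a₀ : ℝ) : EReal) < -sm := by
    rw [EReal.coe_neg]; exact EReal.neg_lt_neg_iff.2 h1
  obtain ⟨am, hm0, hm1, hm2⟩ := exists_tilt_pos_mean hW hWp h1' hcW
  have hm1' : sm < ((-am : ℝ) : EReal) := by
    rw [EReal.coe_neg]; exact EReal.lt_neg_comm.1 hm1
  -- Tilt `am` of the reflected potential is tilt `-am` of `V`; both tilts are recorded relative to
  -- the potential `V x - a₀ * x`.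
  refine ⟨a₀, -am - a₀, ap - a₀, by linarith, hc a₀ h1 h2, ?_, ?_, ?_, ?_⟩
  · have e : (fun x => (V x - a₀ * x) - (-am - a₀) * x) = fun x => V x - (-am) * x := by
      ext x; ring
    rw [e]
    exact hc (-am) hm1' (lt_of_le_of_lt (EReal.coe_le_coe_iff.2 (by linarith)) h2)
  · have e : (fun x => (V x - a₀ * x) - (ap - a₀) * x) = fun x => V x - ap * x := by
      ext x; ring
    rw [e]
    exact hc ap (h1.trans_le (EReal.coe_le_coe_iff.2 hp0)) hp1
  · have e : ∀ x, x * bondW (fun x => V x - a₀ * x) (-am - a₀) x =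
        -((-x) * bondW (fun x => V (-x)) am (-x)) := by
      intro x
      simp only [bondW, neg_neg]
      ring_nf
    simp_rw [e]
    rw [integral_neg, integral_neg_eq_self (fun x => x * bondW (fun x => V (-x)) am x)]
    linarith
  · have e : ∀ x, bondW (fun x => V x - a₀ * x) (ap - a₀) x = bondW V ap x := by
      intro x
      simp only [bondW]; ring_nf
    simp_rw [e]
    exact hp2

end GradPhi
end

/-! ### Free paths with independent tilted increments are invariant. -/

noncomputable section
namespace GradPhi

section Free
variable {V : ℝ → ℝ} {κ C κ' C' a : ℝ} {K K' N : ℕ}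

/-- The law of an increment of the free path with tilt `a`. -/
abbrev bondLaw (V : ℝ → ℝ) (a : ℝ) : Measure ℝ := dens (bondW V a)

lemma Coercive.isProbabilityMeasure_bondLaw (h : Coercive (fun x => V x - a * x) κ C K) :
    IsProbabilityMeasure (bondLaw V a) :=
  isProbabilityMeasure_dens h.integrable_bondW (bondW_pos V a)

/-- Resampling two increments given their sum leaves their joint law invariant. -/
lemma Coercive.lintegral_bondLaw_pair (h : Coercive V κ C K)
    (ha : Coercive (fun x => V x - a * x) κ' C' K') {H : ℝ × ℝ → ℝ≥0∞} (hH : Measurable H) :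
    ∫⁻ x, ∫⁻ y, ∫⁻ U, H (Qt V 0 (x + y) U, x + y - Qt V 0 (x + y) U) ∂unif
      ∂bondLaw V a ∂bondLaw V a = ∫⁻ x, ∫⁻ y, H (x, y) ∂bondLaw V a ∂bondLaw V a := by
  have := ha.isProbabilityMeasure_bondLaw
  set Z := ∫ s, bondW V a s with hZ
  have hZ0 : 0 < Z := integral_pos_of_pos ha.integrable_bondW (bondW_pos V a)
  have hφ := ha.measurable_bondW
  have hw := h.measurable_wt
  set φ : ℝ → ℝ≥0∞ := fun x => ENNReal.ofReal (bondW V a x / Z) with hφdef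
  have hφm : Measurable φ := by fun_prop
  -- The tilt only sees the sum of the two increments. Given this sum, the first increment has the
  -- heat-bath density of the untilted potential, for every `a`.
  have hφφ : ∀ S s, φ s * φ (S - s) = ENNReal.ofReal (Real.exp (a * S) / Z ^ 2 * wt V 0 S s) := by
    intro S s
    rw [hφdef, ← ENNReal.ofReal_mul (div_nonneg (bondW_pos _ _ _).le hZ0.le)]
    congr 1
    rw [div_mul_div_comm, div_mul_eq_mul_div, pow_two]
    congr 1
    rw [bondW, bondW, wt, ← Real.exp_add, ← Real.exp_add]
    ring_nf
  -- change of variables from the second increment to the sum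
  have key : ∀ G : ℝ × ℝ → ℝ≥0∞, Measurable G →
      ∫⁻ x, ∫⁻ y, G (x, x + y) ∂bondLaw V a ∂bondLaw V a =
        ∫⁻ S, ∫⁻ x, ENNReal.ofReal (Real.exp (a * S) / Z ^ 2 * wt V 0 S x) * G (x, S) := by
    intro G hG
    have hG2 : Measurable fun p : ℝ × ℝ => G (p.1, p.1 + p.2) :=
      hG.comp (measurable_fst.prodMk (measurable_fst.add measurable_snd))
    rw [lintegral_dens hφ hG2.lintegral_prod_right']
    have e1 : ∀ x, ENNReal.ofReal (bondW V a x / Z) * ∫⁻ y, G (x, x + y) ∂bondLaw V a =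
        ∫⁻ S, ENNReal.ofReal (Real.exp (a * S) / Z ^ 2 * wt V 0 S x) * G (x, S) := by
      intro x
      have hGx : Measurable fun y => G (x, x + y) := by fun_prop
      rw [lintegral_dens hφ hGx, ← lintegral_sub_right_eq_self _ x,
        ← lintegral_const_mul _ (by fun_prop)]
      refine lintegral_congr fun S => ?_
      rw [← mul_assoc, add_sub_cancel, ← hφφ]
    simp_rw [← hZ, e1]
    rw [lintegral_lintegral_swap]
    refine (Measurable.mul ?_ hG).aemeasurable
    have : Measurable fun p : ℝ × ℝ => wt V 0 p.2 p.1 :=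
      hw.comp (f := fun p : ℝ × ℝ => ((0, p.2), p.1)) (by fun_prop)
    fun_prop
  have hJ : Measurable fun S : ℝ => ∫⁻ U, H (Qt V 0 S U, S - Qt V 0 S U) ∂unif := by
    have hQ : Measurable fun p : ℝ × ℝ => Qt V 0 p.1 p.2 :=
      h.measurable_Qt.comp (f := fun p : ℝ × ℝ => ((0, p.1), p.2)) (by fun_prop)
    exact Measurable.lintegral_prod_right' (f := fun p : ℝ × ℝ =>
      H (Qt V 0 p.1 p.2, p.1 - Qt V 0 p.1 p.2)) (by fun_prop)
  rw [key (fun p => ∫⁻ U, H (Qt V 0 p.2 U, p.2 - Qt V 0 p.2 U) ∂unif) (hJ.comp measurable_snd)]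
  have e2 := key (fun p => H (p.1, p.2 - p.1)) (by fun_prop)
  simp only [add_sub_cancel_left] at e2
  rw [e2]
  refine lintegral_congr fun S => ?_
  have hwS := h.measurable_wt' 0 S
  have hHS : Measurable fun s => H (s, S - s) := by fun_prop
  have hZS := h.integral_wt_pos 0 S
  have hA : 0 ≤ Real.exp (a * S) / Z ^ 2 := by positivity
  dsimp only
  rw [lintegral_mul_const _ (by fun_prop), h.lintegral_Qt 0 S (f := fun s => H (s, S - s)) hHS,
    lintegral_dens hwS hHS,
    ← ofReal_integral_eq_lintegral_ofReal ((h.integrable_wt 0 S).const_mul _)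
      (ae_of_all _ fun u => mul_nonneg hA (wt_pos _ _ _ _).le), integral_const_mul,
    ← lintegral_const_mul _ (by fun_prop)]
  refine lintegral_congr fun s => ?_
  rw [← mul_assoc, ← ENNReal.ofReal_mul (by positivity)]
  congr 2
  field_simp

/-- The path with given increments, started from zero. -/
def freePath (ζ : Fin N → ℝ) (k : ℕ) : ℝ := ∑ j : Fin N, if (j : ℕ) < k then ζ j else 0

lemma measurable_freePath : Measurable (freePath (N := N)) := by
  refine measurable_pi_lambda _ fun k => Finset.measurable_sum _ fun j _ => ?_
  split_ifs <;> fun_prop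

lemma freePath_zero (ζ : Fin N → ℝ) : freePath ζ 0 = 0 := by simp [freePath]

lemma freePath_succ (ζ : Fin N → ℝ) (i : Fin N) :
    freePath ζ (i + 1) = freePath ζ i + ζ i := by
  have : ζ i = ∑ j : Fin N, if j = i then ζ j else 0 := by simp
  rw [freePath, freePath, this, ← Finset.sum_add_distrib]
  refine Finset.sum_congr rfl fun j _ => ?_
  by_cases h1 : (j : ℕ) < i
  · have : j ≠ i := fun h => by subst h; omega
    simp [h1, this, Nat.lt_succ_of_lt h1]
  · by_cases h2 : j = i
    · subst h2; simp
    · have : ¬ (j : ℕ) < i + 1 := fun h => h2 (Fin.ext (by omega))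
      simp [h1, h2, this]

lemma freePath_update (ζ : Fin N → ℝ) (i : Fin N) (x : ℝ) (k : ℕ) :
    freePath (Function.update ζ i x) k = freePath ζ k + if (i : ℕ) < k then x - ζ i else 0 := by
  have : (if (i : ℕ) < k then x - ζ i else 0) =
      ∑ j : Fin N, if j = i then (if (i : ℕ) < k then x - ζ i else 0) else 0 := by simp
  rw [freePath, freePath, this, ← Finset.sum_add_distrib]
  refine Finset.sum_congr rfl fun j _ => ?_
  by_cases h : j = i
  · subst h
    by_cases hk : (j : ℕ) < k <;> simp [hk]
  · simp [h]

/-- The law of the free path with independent tilted increments. -/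
def freeLaw (V : ℝ → ℝ) (a : ℝ) (N : ℕ) : Measure (ℕ → ℝ) :=
  (Measure.pi fun _ : Fin N => bondLaw V a).map freePath

lemma Coercive.isProbabilityMeasure_freeLaw (ha : Coercive (fun x => V x - a * x) κ' C' K') :
    IsProbabilityMeasure (freeLaw V a N) :=
  have := ha.isProbabilityMeasure_bondLaw
  Measure.isProbabilityMeasure_map measurable_freePath.aemeasurable

/-- An update at `k` only redistributes the two adjacent increments, keeping their sum, so after
marginalising over these two coordinates the claim is `Coercive.lintegral_bondLaw_pair`. The right
end is not pinned, and the increments are genuinely independent. -/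
lemma Coercive.siteStep_freeLaw (h : Coercive V κ C K)
    (ha : Coercive (fun x => V x - a * x) κ' C' K') (k : ↥(Finset.Ioo 0 N)) :
    siteStep (pathMap V k) (freeLaw V a N) = freeLaw V a N := by
  have := ha.isProbabilityMeasure_bondLaw
  have := ha.isProbabilityMeasure_freeLaw (N := N)
  obtain ⟨k, hk⟩ := k
  have hk' := Finset.mem_Ioo.1 hk
  refine Measure.ext_of_lintegral _ fun F hF => ?_
  have hg := measurable_lintegral_unif (h.measurable_pathMap k) hF
  have hfp := measurable_freePath (N := N)
  dsimp only
  rw [lintegral_siteStep (h.measurable_pathMap k) _ hF, freeLaw, lintegral_map hg hfp,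
    lintegral_map hF hfp]
  -- The increment with index `j` leads from `j` to `j + 1`, so the bonds at the site `k` have
  -- indices `k - 1` and `k`.
  set i : Fin N := ⟨k - 1, by omega⟩ with hi
  set j : Fin N := ⟨k, hk'.2⟩ with hj
  have hij : i ≠ j := fun hh => by
    have := congrArg Fin.val hh
    simp only [hi, hj] at this
    omega
  have hnot : i ∉ ({j} : Finset (Fin N)) := by simpa using hij
  have hm1 : Measurable fun ζ : Fin N → ℝ => ∫⁻ u, F (pathMap V k (freePath ζ) u) ∂unif :=
    hg.comp hfp
  have hm2 : Measurable fun ζ : Fin N → ℝ => F (freePath ζ) := hF.comp hfp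
  refine lintegral_eq_of_lmarginal_eq (insert i {j}) hm1 hm2 ?_
  ext ζ
  rw [lmarginal_insert _ hm1 hnot, lmarginal_insert _ hm2 hnot]
  simp only [lmarginal_singleton]
  set Ψ : ℝ × ℝ → ℕ → ℝ := fun p => freePath (Function.update (Function.update ζ i p.1) j p.2)
    with hΨ
  have hΨm : Measurable Ψ := by
    refine hfp.comp ?_
    refine measurable_pi_lambda _ fun m => ?_
    by_cases hmj : m = j
    · subst hmj; simp only [Function.update_self]; exact measurable_snd
    · simp only [Function.update_of_ne hmj]
      by_cases hmi : m = i
      · subst hmi; simp only [Function.update_self]; exact measurable_fst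
      · simp only [Function.update_of_ne hmi]; exact measurable_const
  have hΨval : ∀ p m, Ψ p m = freePath ζ m + (if (i : ℕ) < m then p.1 - ζ i else 0) +
      if (j : ℕ) < m then p.2 - ζ j else 0 := by
    intro p m
    simp only [hΨ]
    rw [freePath_update, freePath_update, Function.update_of_ne hij.symm]
  have hup : ∀ x y U, pathMap V k (Ψ (x, y)) U =
      Ψ (Qt V 0 (x + y) U, x + y - Qt V 0 (x + y) U) := by
    intro x y U
    have v1 : Ψ (x, y) (k - 1) = freePath ζ (k - 1) := by
      rw [hΨval]; simp only [hi, hj, lt_irrefl, if_false, add_zero]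
      rw [if_neg (by omega)]; ring
    have v2 : ∀ p : ℝ × ℝ, Ψ p (k + 1) = freePath ζ (k - 1) + (p.1 + p.2) := by
      intro p
      rw [hΨval]; simp only [hi, hj]
      rw [if_pos (by omega), if_pos (by omega)]
      have s1 := freePath_succ ζ j
      have s2 := freePath_succ ζ i
      have s3 : (i : ℕ) + 1 = k := by simp only [hi]; omega
      rw [s3] at s2
      change freePath ζ (k + 1) = freePath ζ k + ζ j at s1
      change freePath ζ k = freePath ζ (k - 1) + ζ i at s2
      rw [s1, s2]
      ring
    have v3 : Qt V (Ψ (x, y) (k - 1)) (Ψ (x, y) (k + 1)) U =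
        Qt V 0 (x + y) U + freePath ζ (k - 1) := by
      rw [v1, v2, ← h.Qt_shift]
      congr 1 <;> ring
    ext m
    rw [pathMap, v3]
    rcases lt_trichotomy m k with hm | hm | hm
    · rw [Function.update_of_ne hm.ne, hΨval, hΨval]
      simp only [hi, hj]
      rw [if_neg (by omega), if_neg (by omega), if_neg (by omega), if_neg (by omega)]
    · subst hm
      rw [Function.update_self, hΨval]
      simp only [hi, hj, lt_irrefl, if_false, add_zero]
      rw [if_pos (by omega)]
      have s2 := freePath_succ ζ i
      have s3 : (i : ℕ) + 1 = m := by simp only [hi]; omega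
      rw [s3] at s2
      change freePath ζ m = freePath ζ (m - 1) + ζ i at s2
      rw [s2]; ring
    · rw [Function.update_of_ne hm.ne', hΨval, hΨval]
      simp only [hi, hj]
      rw [if_pos (by omega), if_pos (by omega), if_pos (by omega), if_pos (by omega)]
      ring
  change ∫⁻ x, ∫⁻ y, ∫⁻ U, F (pathMap V k (Ψ (x, y)) U) ∂unif ∂bondLaw V a ∂bondLaw V a =
    ∫⁻ x, ∫⁻ y, F (Ψ (x, y)) ∂bondLaw V a ∂bondLaw V a
  simp_rw [hup]
  exact h.lintegral_bondLaw_pair ha (H := fun p => F (Ψ p)) (hF.comp hΨm)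

lemma Coercive.evolve_freeLaw (h : Coercive V κ C K)
    (ha : Coercive (fun x => V x - a * x) κ' C' K') (hN : 2 ≤ N) (n : ℕ) :
    evolve (fun k : ↥(Finset.Ioo 0 N) => pathMap V k) n (freeLaw V a N) = freeLaw V a N :=
  have := nonempty_sites hN
  evolve_eq_self (h.siteStep_freeLaw ha) n

end Free
end GradPhi
end

/-! ### Domination of the pinned increments by those of free paths. -/

noncomputable section
namespace GradPhi

section Domination
variable {V : ℝ → ℝ} {κ C κ' C' a : ℝ} {K K' N : ℕ}

/-- The pairs of a configuration and a path with larger increments (if `s = 1`), or smaller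
increments (if `s = -1`). -/
def domSet (N : ℕ) (s : ℝ) : Set (Omega N × (ℕ → ℝ)) :=
  {p | ∀ j < N, s * (height p.1 (j + 1) - height p.1 j) ≤ s * (p.2 (j + 1) - p.2 j)}

lemma measurable_height_fst (k : ℕ) :
    Measurable fun p : Omega N × (ℕ → ℝ) => height p.1 k :=
  (measurable_height k).comp measurable_fst

lemma measurableSet_domSet (s : ℝ) : MeasurableSet (domSet N s) := by
  have : domSet N s = ⋂ j, ⋂ (_ : j < N),
      {p | s * (height p.1 (j + 1) - height p.1 j) ≤ s * (p.2 (j + 1) - p.2 j)} := by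
    ext p; simp [domSet]
  rw [this]
  refine MeasurableSet.iInter fun j => MeasurableSet.iInter fun _ => measurableSet_le ?_ ?_
  · exact ((measurable_height_fst _).sub (measurable_height_fst _)).const_mul _
  · fun_prop

lemma Coercive.pathMap_increments_le (h : Coercive V κ C K) {y z : ℕ → ℝ}
    (hyz : ∀ j < N, y (j + 1) - y j ≤ z (j + 1) - z j) {k : ℕ} (hk : 0 < k) (hkN : k < N) (u : ℝ) :
    ∀ j < N, pathMap V k y u (j + 1) - pathMap V k y u j ≤
      pathMap V k z u (j + 1) - pathMap V k z u j := by
  have h1 := hyz (k - 1) (by omega)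
  have h2 := hyz k hkN
  rw [Nat.sub_add_cancel hk] at h1
  have hQ := h.Qt_sub_le (b := y (k - 1)) (c := y (k + 1)) (b' := z (k - 1)) (c' := z (k + 1))
    (by linarith) u
  intro j hj
  unfold pathMap
  by_cases hjk : j = k
  · subst hjk
    rw [Function.update_self, Function.update_self, Function.update_of_ne (by omega),
      Function.update_of_ne (by omega)]
    exact hQ.2
  · by_cases hjk' : j + 1 = k
    · subst hjk'
      rw [Function.update_self, Function.update_self, Function.update_of_ne (by omega),
        Function.update_of_ne (by omega)]
      exact hQ.1
    · rw [Function.update_of_ne hjk, Function.update_of_ne hjk, Function.update_of_ne hjk',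
        Function.update_of_ne hjk']
      exact hyz j hj

/-- A configuration and a free path driven by the same sites and uniform variables. -/
abbrev freeMap (V : ℝ → ℝ) (N : ℕ) :=
  pairMap (siteMap V (N := N)) fun k : ↥(Finset.Ioo 0 N) => pathMap V k

lemma Coercive.measurable_freeMap (h : Coercive V κ C K) (i : ↥(Finset.Ioo 0 N)) :
    Measurable fun p : (Omega N × (ℕ → ℝ)) × ℝ => freeMap V N i p.1 p.2 :=
  measurable_pairMap h.measurable_siteMap (fun k => h.measurable_pathMap k) i

lemma Coercive.freeMap_mem_domSet (h : Coercive V κ C K) {s : ℝ} (hs : s = 1 ∨ s = -1)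
    (k : ↥(Finset.Ioo 0 N)) (p : Omega N × (ℕ → ℝ)) (hp : p ∈ domSet N s) (u : ℝ) :
    freeMap V N k p u ∈ domSet N s := by
  have hk := Finset.mem_Ioo.1 k.2
  intro j hj
  simp only [freeMap, pairMap, height_siteMap]
  rcases hs with rfl | rfl
  · have := h.pathMap_increments_le (y := height p.1) (z := p.2) (N := N)
      (fun j hj => by simpa using hp j hj) hk.1 hk.2 u j hj
    linarith
  · have := h.pathMap_increments_le (y := p.2) (z := height p.1) (N := N)
      (fun j hj => by have := hp j hj; linarith) hk.1 hk.2 u j hj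
    linarith

/-- `μ` integrates nonnegative functions to at most twice their `ν`-integrals. -/
def TwiceLE {α : Type*} [MeasurableSpace α] (μ ν : Measure α) : Prop :=
  ∀ F : α → ℝ≥0∞, Measurable F → ∫⁻ x, F x ∂μ ≤ 2 * ∫⁻ x, F x ∂ν

lemma lintegral_increment_freeLaw (ha : Coercive (fun x => V x - a * x) κ' C' K') {j : ℕ}
    (hj : j < N) {ψ : ℝ → ℝ≥0∞} (hψ : Measurable ψ) :
    ∫⁻ z, ψ (z (j + 1) - z j) ∂freeLaw V a N = ∫⁻ x, ψ x ∂bondLaw V a := by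
  have := ha.isProbabilityMeasure_bondLaw
  rw [freeLaw, lintegral_map (by fun_prop) measurable_freePath]
  have e : ∀ ζ : Fin N → ℝ, freePath ζ (j + 1) - freePath ζ j = ζ ⟨j, hj⟩ := by
    intro ζ
    have := freePath_succ ζ ⟨j, hj⟩
    simp only at this
    rw [this]; ring
  simp_rw [e]
  have hmp := measurePreserving_eval (fun _ : Fin N => bondLaw V a) ⟨j, hj⟩
  rw [← hmp.lintegral_comp hψ]

/-- The configuration and a free path receive the same updates, and domination of increments
persists. The law of the free path stays within a factor two of the invariant free law, since that
comparison is tested against all nonnegative functions and so passes through the Markov operator.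
The second clause, after one more update at a prescribed site, serves to bound the displacement in a
single update. -/
lemma Coercive.lintegral_increment_le (h : Coercive V κ C K)
    (ha : Coercive (fun x => V x - a * x) κ' C' K') (hN : 2 ≤ N) {s : ℝ} (hs : s = 1 ∨ s = -1)
    (Γ : Measure (Omega N × (ℕ → ℝ))) [IsProbabilityMeasure Γ]
    (hΓ : ∀ᵐ p ∂Γ, p ∈ domSet N s) (hΓ2 : TwiceLE (Γ.map Prod.snd) (freeLaw V a N))
    {ψ : ℝ → ℝ≥0∞} (hψ : Measurable ψ) (hψm : Monotone ψ) (n : ℕ) {j : ℕ} (hj : j < N) :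
    ∫⁻ x, ψ (s * (height x (j + 1) - height x j)) ∂evolve (siteMap V) n (Γ.map Prod.fst) ≤
      2 * ∫⁻ x, ψ (s * x) ∂bondLaw V a ∧
    ∀ k, ∫⁻ x, ψ (s * (height x (j + 1) - height x j))
        ∂siteStep (siteMap V k) (evolve (siteMap V) n (Γ.map Prod.fst)) ≤
      2 * ∫⁻ x, ψ (s * x) ∂bondLaw V a := by
  have hne := nonempty_sites hN
  have hm1 := fun i => h.measurable_siteMap (N := N) i
  have hm2 := fun i => h.measurable_freeMap (N := N) i
  have hm3 := fun k : ↥(Finset.Ioo 0 N) => h.measurable_pathMap k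
  have hp1 := isProbabilityMeasure_evolve hm2 n Γ
  have hfs : IsProbabilityMeasure (Γ.map Prod.fst) :=
    Measure.isProbabilityMeasure_map measurable_fst.aemeasurable
  have hsn : IsProbabilityMeasure (Γ.map Prod.snd) :=
    Measure.isProbabilityMeasure_map measurable_snd.aemeasurable
  have hfree := ha.isProbabilityMeasure_freeLaw (N := N)
  have hF1 : Measurable fun x : Omega N => ψ (s * (height x (j + 1) - height x j)) :=
    hψ.comp (((measurable_height _).sub (measurable_height _)).const_mul _)
  have hF2 : Measurable fun z : ℕ → ℝ => ψ (s * (z (j + 1) - z j)) := by fun_prop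
  have e1 : (evolve (freeMap V N) n Γ).map Prod.fst = evolve (siteMap V) n (Γ.map Prod.fst) :=
    map_evolve measurable_fst hm2 hm1 (fun _ _ _ => rfl) n Γ
  have e2 : (evolve (freeMap V N) n Γ).map Prod.snd =
      evolve (fun k : ↥(Finset.Ioo 0 N) => pathMap V k) n (Γ.map Prod.snd) :=
    map_evolve measurable_snd hm2 hm3 (fun _ _ _ => rfl) n Γ
  have hdom := ae_evolve hm2 (measurableSet_domSet s)
    (fun i x hx u => h.freeMap_mem_domSet hs i x hx u) Γ hΓ n
  have hpe := isProbabilityMeasure_evolve hm3 n (Γ.map Prod.snd)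
  have fin : ∫⁻ z, ψ (s * (z (j + 1) - z j)) ∂freeLaw V a N = ∫⁻ x, ψ (s * x) ∂bondLaw V a :=
    lintegral_increment_freeLaw ha hj (ψ := fun x => ψ (s * x)) (by fun_prop)
  have tw : ∀ F : (ℕ → ℝ) → ℝ≥0∞, Measurable F →
      ∫⁻ z, F z ∂evolve (fun k : ↥(Finset.Ioo 0 N) => pathMap V k) n (Γ.map Prod.snd) ≤
        2 * ∫⁻ z, F z ∂freeLaw V a N := by
    intro F hF
    rw [lintegral_evolve hm3 _ n hF]
    refine (hΓ2 _ (measurable_iterate_stepOp hm3 hF n)).trans ?_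
    rw [← lintegral_evolve hm3 _ n hF, h.evolve_freeLaw ha hN]
  -- comparison of the two marginals of a dominated coupling
  have cmp : ∀ Γ' : Measure (Omega N × (ℕ → ℝ)), (∀ᵐ p ∂Γ', p ∈ domSet N s) →
      ∫⁻ x, ψ (s * (height x (j + 1) - height x j)) ∂Γ'.map Prod.fst ≤
        ∫⁻ z, ψ (s * (z (j + 1) - z j)) ∂Γ'.map Prod.snd := by
    intro Γ' hΓ'
    rw [lintegral_map hF1 measurable_fst, lintegral_map hF2 measurable_snd]
    refine lintegral_mono_ae ?_
    filter_upwards [hΓ'] with p hp using hψm (hp j hj)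
  constructor
  · rw [← e1]
    refine (cmp _ hdom).trans ?_
    rw [e2]
    exact (tw _ hF2).trans_eq (by rw [fin])
  · intro k
    have hdom' := ae_siteStep (hm2 k) (measurableSet_domSet s)
      (fun x hx u => h.freeMap_mem_domSet hs k x hx u) _ hdom
    rw [← e1, ← map_siteStep measurable_fst (hm2 k) (hm1 k) (fun _ _ => rfl)]
    refine (cmp _ hdom').trans ?_
    rw [map_siteStep measurable_snd (hm2 k) (hm3 k) (fun _ _ => rfl), e2,
      lintegral_siteStep (hm3 k) _ hF2]
    refine (tw _ (measurable_lintegral_unif (hm3 k) hF2)).trans ?_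
    rw [← lintegral_siteStep (hm3 k) _ hF2, h.siteStep_freeLaw ha, fin]

end Domination
end GradPhi
end

/-! ### Increments driven by uniform variables, and their concentration. -/

noncomputable section
namespace GradPhi

/-- The quantile function of the tilted increment, extended by zero. -/
def bondQuantile (V : ℝ → ℝ) (a U : ℝ) : ℝ :=
  if U ∈ Ioo (0 : ℝ) 1 then quantile (bondLaw V a) U else 0

section Quantile
variable {V : ℝ → ℝ} {κ C κ' C' a a' : ℝ} {K K' N : ℕ}

lemma Coercive.measurable_bondQuantile (h : Coercive (fun x => V x - a * x) κ C K) :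
    Measurable (bondQuantile V a) := by
  have := h.isProbabilityMeasure_bondLaw
  refine measurable_of_Iic fun s => ?_
  have e : bondQuantile V a ⁻¹' Iic s =
      (Ioo (0 : ℝ) 1 ∩ {U | U ≤ (bondLaw V a).real (Iic s)}) ∪
      ((Ioo (0 : ℝ) 1)ᶜ ∩ {_U | 0 ≤ s}) := by
    ext U
    by_cases hU : U ∈ Ioo (0 : ℝ) 1
    · have hq := quantile_le_iff (μ := bondLaw V a) hU s
      simp only [bondQuantile, mem_preimage, mem_Iic, mem_union, mem_inter_iff, mem_ofPred_eq, hU,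
        if_true, true_and, mem_compl_iff, not_true, false_and, or_false, hq]
    · simp only [bondQuantile, mem_preimage, mem_Iic, mem_union, mem_inter_iff, mem_ofPred_eq, hU,
        if_false, false_and, mem_compl_iff, not_false_eq_true, true_and, false_or]
  rw [e]
  exact (measurableSet_Ioo.inter measurableSet_Iic).union
    (measurableSet_Ioo.compl.inter (measurableSet_le measurable_const measurable_const))

lemma Coercive.map_bondQuantile (h : Coercive (fun x => V x - a * x) κ C K) :
    unif.map (bondQuantile V a) = bondLaw V a :=
  have := h.isProbabilityMeasure_bondLaw
  map_unif_eq h.measurable_bondQuantile fun _ hU => if_pos hU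

lemma Coercive.bondQuantile_mono (h : Coercive (fun x => V x - a * x) κ C K)
    (h' : Coercive (fun x => V x - a' * x) κ' C' K') (haa : a ≤ a') (U : ℝ) :
    bondQuantile V a U ≤ bondQuantile V a' U := by
  have := h.isProbabilityMeasure_bondLaw
  have := h'.isProbabilityMeasure_bondLaw
  unfold bondQuantile
  split_ifs with hU
  · refine quantile_mono (fun s => ?_) hU
    refine dens_Iic_le_of_mlr h.measurable_bondW h'.measurable_bondW h.integrable_bondW
      h'.integrable_bondW (bondW_pos _ _) (bondW_pos _ _) (fun u v huv => ?_) s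
    simp only [bondW]
    rw [← Real.exp_add, ← Real.exp_add]
    apply Real.exp_le_exp.2
    nlinarith [mul_le_mul_of_nonneg_right haa (sub_nonneg.2 huv)]
  · exact le_rfl

lemma Coercive.exp_integrable_bondQuantile (h : Coercive (fun x => V x - a * x) κ C K) :
    Integrable (fun U => Real.exp (κ / 2 * |bondQuantile V a U|)) unif := by
  have hm : Measurable fun x : ℝ => Real.exp (κ / 2 * |x|) := by fun_prop
  have : Integrable (fun x : ℝ => Real.exp (κ / 2 * |x|)) (bondLaw V a) := by
    refine integrable_dens h.measurable_bondW (bondW_pos _ _) ?_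
    refine ((integrable_exp_neg_mul_abs_sub (half_pos h.kpos) 0).const_mul (Real.exp C)).mono'
      (hm.mul h.measurable_bondW).aestronglyMeasurable (ae_of_all _ fun x => ?_)
    have h1 := h.abs_bondW_le x
    rw [Real.norm_eq_abs, abs_mul, abs_of_pos (Real.exp_pos _)]
    refine (mul_le_mul_of_nonneg_left h1 (Real.exp_pos _).le).trans_eq ?_
    rw [sub_zero, ← Real.exp_add, ← Real.exp_add, ← Real.exp_add]
    congr 1; ring
  rw [← h.map_bondQuantile] at this
  exact this.comp_measurable h.measurable_bondQuantile

lemma Coercive.integral_bondQuantile (h : Coercive (fun x => V x - a * x) κ C K) :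
    ∫ U, bondQuantile V a U ∂unif = (∫ x, x * bondW V a x) / ∫ x, bondW V a x := by
  rw [← integral_dens h.measurable_bondW (bondW_pos _ _) fun x => x]
  change _ = ∫ x, x ∂bondLaw V a
  rw [← h.map_bondQuantile, integral_map h.measurable_bondQuantile.aemeasurable (by fun_prop)]

end Quantile

section Concentration

variable {g : ℝ → ℝ} {t : ℝ}

lemma integrable_of_exp_abs (hg : Measurable g) (ht : 0 < t)
    (hexp : Integrable (fun U => Real.exp (t * |g U|)) unif) : Integrable g unif := by
  refine (hexp.const_mul t⁻¹).mono' hg.aestronglyMeasurable (ae_of_all _ fun U => ?_)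
  have := Real.add_one_le_exp (t * |g U|)
  rw [Real.norm_eq_abs, inv_mul_eq_div, le_div_iff₀ ht]
  linarith

lemma memLp_two_of_exp_abs (hg : Measurable g) (ht : 0 < t)
    (hexp : Integrable (fun U => Real.exp (t * |g U|)) unif) : MemLp g 2 unif := by
  rw [memLp_two_iff_integrable_sq hg.aestronglyMeasurable]
  refine (hexp.const_mul (2 / t ^ 2)).mono' (hg.pow_const 2).aestronglyMeasurable
    (ae_of_all _ fun U => ?_)
  have := Real.quadratic_le_exp_of_nonneg (x := t * |g U|) (by positivity)
  rw [Real.norm_eq_abs, abs_of_nonneg (sq_nonneg _), div_mul_eq_mul_div, le_div_iff₀ (by positivity),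
    ← sq_abs (g U)]
  nlinarith [mul_nonneg ht.le (abs_nonneg (g U))]

/-- A centred variable with exponential moments has moment generating function `1 + o(s)`. -/
lemma exists_mgf_le (hg : Measurable g) (ht : 0 < t)
    (hexp : Integrable (fun U => Real.exp (t * |g U|)) unif) (h0 : ∫ U, g U ∂unif = 0) :
    ∃ s₀ > 0, ∀ s ∈ Ioo 0 s₀, Integrable (fun U => Real.exp (s * g U)) unif ∧
      ∫ U, Real.exp (s * g U) ∂unif ≤ Real.exp (s / 16) := by
  have hI : ∀ s ∈ Ioo (-t) t, Integrable (fun U => Real.exp (s * g U)) unif := by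
    intro s hs
    refine hexp.mono' (by fun_prop) (ae_of_all _ fun U => ?_)
    rw [Real.norm_eq_abs, abs_of_pos (Real.exp_pos _)]
    apply Real.exp_le_exp.2
    refine (le_abs_self _).trans ?_
    rw [abs_mul]
    exact mul_le_mul_of_nonneg_right (abs_le.2 ⟨hs.1.le, hs.2.le⟩) (abs_nonneg _)
  have hmem : (0 : ℝ) ∈ interior (integrableExpSet g unif) :=
    mem_interior.2 ⟨Ioo (-t) t, hI, isOpen_Ioo, by simp [ht]⟩
  have hd := hasDerivAt_mgf hmem
  have hd0 : HasDerivAt (mgf g unif) 0 0 := by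
    convert hd using 1
    simp [h0]
  have hlo := hd0.isLittleO.def (show (0 : ℝ) < 1 / 16 by norm_num)
  obtain ⟨ε, hε, hball⟩ := Metric.eventually_nhds_iff.1 hlo
  refine ⟨min ε t, lt_min hε ht, fun s hs => ⟨hI s ⟨by linarith [hs.1], hs.2.trans_le
    (min_le_right _ _)⟩, ?_⟩⟩
  have := hball (y := s) (by
    rw [Real.dist_eq, sub_zero, abs_of_pos hs.1]; exact hs.2.trans_le (min_le_left _ _))
  simp only [mgf_zero, smul_zero, sub_zero, Real.norm_eq_abs, abs_of_pos hs.1] at this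
  have h1 := (le_abs_self _).trans this
  have h2 := Real.add_one_le_exp (s / 16)
  change mgf g unif s ≤ _
  linarith

variable {N : ℕ}

/-- The law of the independent uniform variables driving the increments. -/
abbrev unifPi (N : ℕ) : Measure (Fin N → ℝ) := Measure.pi fun _ => unif

/-- The path with increments obtained from uniform variables. -/
abbrev drivenPath (g : ℝ → ℝ) (ω : Fin N → ℝ) (k : ℕ) : ℝ := freePath (fun i => g (ω i)) k

lemma measurable_drivenPath (hg : Measurable g) :
    Measurable fun ω : Fin N → ℝ => drivenPath g ω :=
  measurable_freePath.comp (measurable_pi_lambda _ fun i => hg.comp (measurable_pi_apply i))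

lemma measurable_drivenPath_apply (hg : Measurable g) (k : ℕ) :
    Measurable fun ω : Fin N → ℝ => drivenPath g ω k :=
  (measurable_pi_apply k).comp (measurable_drivenPath hg)

lemma drivenPath_sub_const (g : ℝ → ℝ) (m : ℝ) (ω : Fin N → ℝ) {k : ℕ} (hk : k ≤ N) :
    drivenPath (fun U => g U - m) ω k = drivenPath g ω k - m * k := by
  have e : (m * k : ℝ) = ∑ j : Fin N, if (j : ℕ) < k then m else 0 := by
    rw [Finset.sum_ite, Finset.sum_const_zero, add_zero, Finset.sum_const, nsmul_eq_mul, mul_comm]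
    congr 2
    rw [Fin.card_filter_val_lt, min_eq_right hk]
  simp only [drivenPath, freePath]
  rw [e, ← Finset.sum_sub_distrib]
  refine Finset.sum_congr rfl fun j _ => ?_
  split_ifs <;> simp

/-- Chernoff's bound: the threshold contributes `exp (-s N / 8)`, and at most `N` factors `exp (s /
16)` consume half of the exponent. The bound is uniform in `k`. -/
lemma unifPi_tail_le {s : ℝ} (hs : 0 < s) (hI : Integrable (fun U => Real.exp (s * g U)) unif)
    (hmgf : ∫ U, Real.exp (s * g U) ∂unif ≤ Real.exp (s / 16)) (k : ℕ) :
    (unifPi N).real {ω | (N : ℝ) / 8 ≤ drivenPath g ω k} ≤ Real.exp (-(s / 16) * N) := by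
  set f : Fin N → ℝ → ℝ := fun j U => if (j : ℕ) < k then Real.exp (s * g U) else 1 with hf
  have hfI : ∀ j, Integrable (f j) unif := by
    intro j
    by_cases hj : (j : ℕ) < k <;> simp [hf, hj, hI]
  have e : ∀ ω : Fin N → ℝ, Real.exp (s * drivenPath g ω k) = ∏ j, f j (ω j) := by
    intro ω
    simp only [drivenPath, freePath]
    rw [Finset.mul_sum, Real.exp_sum]
    refine Finset.prod_congr rfl fun j _ => ?_
    by_cases hj : (j : ℕ) < k <;> simp [hf, hj]
  have hint : Integrable (fun ω : Fin N → ℝ => Real.exp (s * drivenPath g ω k)) (unifPi N) := by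
    simp_rw [e]
    exact Integrable.fintype_prod hfI
  refine (measure_ge_le_exp_mul_mgf _ hs.le hint).trans ?_
  have hprod : mgf (fun ω : Fin N → ℝ => drivenPath g ω k) (unifPi N) s ≤
      Real.exp (s / 16) ^ N := by
    rw [mgf]
    simp_rw [e]
    rw [integral_fintype_prod_eq_prod]
    refine (Finset.prod_le_prod (g := fun _ => Real.exp (s / 16))
      (fun j _ => integral_nonneg fun U => ?_) fun j _ => ?_).trans_eq (by simp)
    · by_cases hj : (j : ℕ) < k <;> simp [hf, hj, Real.exp_nonneg]
    by_cases hj : (j : ℕ) < k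
    · simpa [hf, hj] using hmgf
    · simp only [hf, hj, if_false, integral_const, probReal_univ, smul_eq_mul, mul_one]
      exact Real.one_le_exp (by positivity)
  refine (mul_le_mul_of_nonneg_left hprod (Real.exp_pos _).le).trans_eq ?_
  rw [← Real.exp_nat_mul, ← Real.exp_add]
  congr 1; ring

lemma integral_sq_drivenPath_le (hg : Measurable g) (ht : 0 < t)
    (hexp : Integrable (fun U => Real.exp (t * |g U|)) unif) (h0 : ∫ U, g U ∂unif = 0) (k : ℕ) :
    ∫⁻ ω, ENNReal.ofReal ((drivenPath g ω k) ^ 2) ∂unifPi N ≤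
      ENNReal.ofReal ((∫ U, g U ^ 2 ∂unif) * N) := by
  set f : Fin N → ℝ → ℝ := fun j U => if (j : ℕ) < k then g U else 0 with hf
  have hm := memLp_two_of_exp_abs hg ht hexp
  have hfm : ∀ j, MemLp (f j) 2 unif := by
    intro j
    by_cases hj : (j : ℕ) < k <;> simp [hf, hj, hm]
  have hf0 : ∀ j, ∫ U, f j U ∂unif = 0 := by
    intro j
    by_cases hj : (j : ℕ) < k <;> simp [hf, hj, h0]
  have hpre : ∀ j, MemLp (fun ω : Fin N → ℝ => f j (ω j)) 2 (unifPi N) := fun j =>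
    (hfm j).comp_measurePreserving (measurePreserving_eval (fun _ : Fin N => unif) j)
  have hsum : MemLp (fun ω : Fin N → ℝ => drivenPath g ω k) 2 (unifPi N) := by
    have : (fun ω : Fin N → ℝ => drivenPath g ω k) = fun ω => ∑ j, f j (ω j) := rfl
    rw [this]
    exact memLp_finsetSum _ fun j _ => hpre j
  have hmean : ∫ ω, drivenPath g ω k ∂unifPi N = 0 := by
    change ∫ ω, ∑ j, f j (ω j) ∂unifPi N = 0
    rw [integral_finsetSum _ fun j _ => (hpre j).integrable (by norm_num)]
    refine Finset.sum_eq_zero fun j _ => ?_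
    rw [← hf0 j]
    exact (measurePreserving_eval (fun _ : Fin N => unif) j).hasLaw.integral_comp
      (hfm j).aestronglyMeasurable
  have hvar : ∫ ω, (drivenPath g ω k) ^ 2 ∂unifPi N = ∑ j, Var[f j; unif] := by
    rw [← variance_sum_pi (μ := fun _ : Fin N => unif) hfm, variance_eq_integral]
    · have : (∑ i, fun ω : Fin N → ℝ => f i (ω i)) = fun ω => drivenPath g ω k := by
        ext ω; simp [hf, freePath]
      rw [this, hmean]; simp
    · exact (Finset.aemeasurable_sum _ fun j _ => (hpre j).aestronglyMeasurable.aemeasurable)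
  rw [← ofReal_integral_eq_lintegral_ofReal hsum.integrable_sq (ae_of_all _ fun _ => sq_nonneg _),
    hvar]
  apply ENNReal.ofReal_le_ofReal
  refine (Finset.sum_le_card_nsmul _ _ (∫ U, g U ^ 2 ∂unif) fun j _ => ?_).trans_eq
    (by simp [mul_comm])
  refine (variance_le_expectation_sq (hfm j).aestronglyMeasurable).trans ?_
  refine integral_mono ((hfm j).integrable_sq) hm.integrable_sq fun U => ?_
  by_cases hj : (j : ℕ) < k <;> simp [hf, hj, sq_nonneg]

end Concentration
end GradPhi
end

/-! ### Ingredients of the tent: tail bounds, interpolated increments, minima of paths. -/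

noncomputable section
namespace GradPhi

section Initial
variable {N : ℕ}

lemma exists_unifPi_tail {g : ℝ → ℝ} {t ρ : ℝ} (hg : Measurable g) (ht : 0 < t) (hρ : 0 < ρ)
    (hexp : Integrable (fun U => Real.exp (t * |g U|)) unif) (h0 : ∫ U, g U ∂unif = 0) :
    ∃ s > 0, ∀ (N k : ℕ), unifPi N {ω | ρ * N ≤ |drivenPath g ω k|} ≤
      ENNReal.ofReal (2 * Real.exp (-s * N)) := by
  have hρ8 : 0 < 8 * ρ := by positivity
  -- rescale so that the threshold becomes `N / 8`
  have key : ∀ σ : ℝ, |σ| = 1 → ∃ s₀ > 0, ∀ s ∈ Ioo 0 s₀, ∀ N k : ℕ,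
      unifPi N {ω | ρ * N ≤ σ * drivenPath g ω k} ≤
        ENNReal.ofReal (Real.exp (-(s / 16) * N)) := by
    intro σ hσ
    obtain ⟨s₀, hs₀, h⟩ := exists_mgf_le (g := fun U => σ / (8 * ρ) * g U) (t := t * (8 * ρ))
      (by fun_prop) (by positivity) (by
        refine hexp.congr (ae_of_all _ fun U => ?_)
        simp only
        rw [abs_mul, abs_div, hσ, abs_of_pos hρ8]
        congr 1; field_simp) (by rw [integral_const_mul, h0, mul_zero])
    refine ⟨s₀, hs₀, fun s hs N k => ?_⟩
    have h1 := unifPi_tail_le (N := N) hs.1 (h s hs).1 (h s hs).2 k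
    replace h1 := ENNReal.ofReal_le_ofReal h1
    rw [ofReal_measureReal] at h1
    refine le_trans (measure_mono fun ω hω => ?_) h1
    rw [mem_ofPred_eq] at hω ⊢
    have e : drivenPath (fun U => σ / (8 * ρ) * g U) ω k = σ / (8 * ρ) * drivenPath g ω k := by
      simp only [drivenPath, freePath]
      rw [Finset.mul_sum]
      refine Finset.sum_congr rfl fun j _ => ?_
      split_ifs <;> simp
    rw [e, div_mul_eq_mul_div, le_div_iff₀ hρ8]
    linarith
  obtain ⟨s₁, hs₁, h₁⟩ := key 1 (by simp)
  obtain ⟨s₂, hs₂, h₂⟩ := key (-1) (by simp)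
  set s := min s₁ s₂ / 2 with hs
  have hs0 : 0 < min s₁ s₂ := lt_min hs₁ hs₂
  have m1 := min_le_left s₁ s₂
  have m2 := min_le_right s₁ s₂
  refine ⟨s / 16, by positivity, fun N k => ?_⟩
  have sub : {ω : Fin N → ℝ | ρ * N ≤ |drivenPath g ω k|} ⊆
      {ω | ρ * N ≤ 1 * drivenPath g ω k} ∪ {ω | ρ * N ≤ -1 * drivenPath g ω k} := by
    intro ω hω
    rw [mem_ofPred_eq] at hω
    rcases le_abs.1 hω with h | h
    · left; rw [mem_ofPred_eq]; linarith
    · right; rw [mem_ofPred_eq]; linarith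
  refine (measure_mono sub).trans ((measure_union_le _ _).trans ?_)
  rw [two_mul, ENNReal.ofReal_add (Real.exp_pos _).le (Real.exp_pos _).le]
  exact add_le_add (h₁ s ⟨by linarith, by linarith⟩ N k) (h₂ s ⟨by linarith, by linarith⟩ N k)

/-- Interpolation between two increment profiles, with small opposite means. -/
lemma exists_interpolation {qm qp : ℝ → ℝ} {t t' : ℝ} (hm : Measurable qm) (hp : Measurable qp)
    (hle : ∀ U, qm U ≤ qp U) (ht : 0 < t) (ht' : 0 < t')
    (hme : Integrable (fun U => Real.exp (t * |qm U|)) unif)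
    (hpe : Integrable (fun U => Real.exp (t' * |qp U|)) unif)
    (hm0 : ∫ U, qm U ∂unif < 0) (hp0 : 0 < ∫ U, qp U ∂unif) :
    ∃ r ∈ Ioc (0 : ℝ) (1 / 4), ∃ s > 0, ∀ σ : ℝ, |σ| = 1 → ∃ g : ℝ → ℝ, Measurable g ∧
      (∀ U, qm U ≤ g U ∧ g U ≤ qp U) ∧ Integrable (fun U => Real.exp (s * |g U|)) unif ∧
      ∫ U, g U ∂unif = σ * r := by
  set mm := ∫ U, qm U ∂unif
  set mp := ∫ U, qp U ∂unif
  have hmi := integrable_of_exp_abs hm ht hme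
  have hpi := integrable_of_exp_abs hp ht' hpe
  -- One slope serves both signs, hence the two bounds by the available means; the cap `1 / 4` will
  -- keep the tent below height `N`.
  set r := min (1 / 4) (min mp (-mm)) with hr
  have hr0 : 0 < r := lt_min (by norm_num) (lt_min hp0 (by linarith))
  have hr1 : r ≤ 1 / 4 := min_le_left _ _
  have hr2 : r ≤ mp := (min_le_right _ _).trans (min_le_left _ _)
  have hr3 : r ≤ -mm := (min_le_right _ _).trans (min_le_right _ _)
  refine ⟨r, ⟨hr0, hr1⟩, min t t', lt_min ht ht', fun σ hσ => ?_⟩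
  have hσr : |σ * r| = r := by rw [abs_mul, hσ, abs_of_pos hr0, one_mul]
  have hσ1 := (abs_le.1 hσr.le).1
  have hσ2 := (abs_le.1 hσr.le).2
  have hd : 0 < mp - mm := by linarith
  -- The weight for which the convex combination of the two profiles has mean `σ * r`.
  set w := (σ * r - mm) / (mp - mm) with hw
  have hw0 : 0 ≤ w := div_nonneg (by linarith) hd.le
  have hw1 : w ≤ 1 := (div_le_one hd).2 (by linarith)
  refine ⟨fun U => w * qp U + (1 - w) * qm U, by fun_prop, fun U => ⟨?_, ?_⟩, ?_, ?_⟩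
  · nlinarith [hle U]
  · nlinarith [hle U]
  · refine (hme.add hpe).mono' (by fun_prop) (ae_of_all _ fun U => ?_)
    rw [Real.norm_eq_abs, abs_of_pos (Real.exp_pos _), Pi.add_apply]
    have h1 : |w * qp U + (1 - w) * qm U| ≤ max |qm U| |qp U| := by
      have a1 := le_max_left |qm U| |qp U|
      have a2 := le_max_right |qm U| |qp U|
      refine (abs_add_le _ _).trans ?_
      rw [abs_mul, abs_mul, abs_of_nonneg hw0, abs_of_nonneg (sub_nonneg.2 hw1)]
      nlinarith
    have hst := lt_min ht ht'
    rcases max_cases |qm U| |qp U| with ⟨h2, _⟩ | ⟨h2, _⟩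
    · have : Real.exp (min t t' * |w * qp U + (1 - w) * qm U|) ≤ Real.exp (t * |qm U|) := by
        apply Real.exp_le_exp.2
        exact mul_le_mul (min_le_left _ _) (h1.trans h2.le) (abs_nonneg _) ht.le
      linarith [Real.exp_pos (t' * |qp U|)]
    · have : Real.exp (min t t' * |w * qp U + (1 - w) * qm U|) ≤ Real.exp (t' * |qp U|) := by
        apply Real.exp_le_exp.2
        exact mul_le_mul (min_le_right _ _) (h1.trans h2.le) (abs_nonneg _) ht'.le
      linarith [Real.exp_pos (t * |qm U|)]
  · rw [integral_add (hpi.const_mul _) (hmi.const_mul _), integral_const_mul, integral_const_mul]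
    change w * mp + (1 - w) * mm = σ * r
    have : w * (mp - mm) = σ * r - mm := div_mul_cancel₀ _ hd.ne'
    linarith

/-- The tent-shaped configuration obtained from an ascending and a descending path. -/
def tent (N : ℕ) (A B : ℕ → ℝ) : Omega N := fun k => min (A k) (B k - B N)

/-- The sign conditions make the branch vanishing at each end the smaller one there, so the formula
agrees with the pinned boundary values. -/
lemma height_tent {A B : ℕ → ℝ} (hA0 : A 0 = 0) (hB0 : B 0 = 0) (hA : 0 ≤ A N) (hB : B N ≤ 0)
    {k : ℕ} (hk : k ≤ N) : height (tent N A B) k = min (A k) (B k - B N) := by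
  unfold height
  split_ifs with h
  · rfl
  · rw [Finset.mem_Ioo] at h
    rcases Nat.eq_zero_or_pos k with rfl | hk0
    · rw [hA0, hB0, min_eq_left (by linarith)]
    · have : k = N := by omega
      rw [this, sub_self, min_eq_right hA]

/-- Taking the minimum of two paths preserves common bounds on their increments, also where the
minimum switches branch. -/
lemma min_sub_min_bounds {a b a' b' l u : ℝ} (h1 : l ≤ a' - a) (h2 : a' - a ≤ u) (h3 : l ≤ b' - b)
    (h4 : b' - b ≤ u) : l ≤ min a' b' - min a b ∧ min a' b' - min a b ≤ u := by
  constructor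
  · rcases min_cases a' b' with ⟨h, _⟩ | ⟨h, _⟩ <;> rw [h]
    · linarith [min_le_left a b]
    · linarith [min_le_right a b]
  · rcases min_cases a b with ⟨h, _⟩ | ⟨h, _⟩ <;> rw [h]
    · linarith [min_le_left a' b']
    · linarith [min_le_right a' b']

lemma twiceLE_cond {α : Type*} [MeasurableSpace α] {μ : Measure α} {s : Set α}
    (h : 2⁻¹ ≤ μ s) : TwiceLE μ[|s] μ := by
  intro F _
  rw [ProbabilityTheory.cond, lintegral_smul_measure, smul_eq_mul]
  have : (μ s)⁻¹ ≤ 2 := by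
    rw [ENNReal.inv_le_iff_inv_le]; exact h
  exact mul_le_mul' this (setLIntegral_le_lintegral _ _)

lemma TwiceLE.map {α β : Type*} [MeasurableSpace α] [MeasurableSpace β] {μ ν : Measure α}
    (h : TwiceLE μ ν) {f : α → β} (hf : Measurable f) : TwiceLE (μ.map f) (ν.map f) := by
  intro F hF
  rw [lintegral_map hF hf, lintegral_map hF hf]
  exact h _ (hF.comp hf)

lemma map_drivenPath {V : ℝ → ℝ} {κ C a : ℝ} {K : ℕ}
    (h : Coercive (fun x => V x - a * x) κ C K) :
    (unifPi N).map (fun ω => drivenPath (bondQuantile V a) ω) = freeLaw V a N := by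
  have hq := h.measurable_bondQuantile
  have hp := h.isProbabilityMeasure_bondLaw
  have hmap := h.map_bondQuantile
  have hσ : ∀ _ : Fin N, SigmaFinite (unif.map (bondQuantile V a)) := fun _ => by
    rw [hmap]; infer_instance
  rw [freeLaw, ← hmap, ← Measure.pi_map_pi fun _ => hq.aemeasurable,
    Measure.map_map measurable_freePath (by fun_prop)]
  rfl

lemma eventually_nat_mul_exp_le {s : ℝ} (hs : 0 < s) :
    ∀ᶠ N : ℕ in atTop, ((N : ℝ) + 1) * (4 * Real.exp (-s * N)) ≤ 1 / 2 := by
  have h1 : Tendsto (fun x : ℝ => x ^ 1 * Real.exp (-s * x)) atTop (𝓝 0) := by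
    have := tendsto_rpow_mul_exp_neg_mul_atTop_nhds_zero 1 s hs
    simpa using this
  have h2 : Tendsto (fun x : ℝ => x ^ 0 * Real.exp (-s * x)) atTop (𝓝 0) := by
    have := tendsto_rpow_mul_exp_neg_mul_atTop_nhds_zero 0 s hs
    simpa using this
  have h3 := ((h1.add h2).const_mul 4).comp tendsto_natCast_atTop_atTop
  have := h3.eventually (ge_mem_nhds (show (4 * (0 + 0) : ℝ) < 1 / 2 by norm_num))
  filter_upwards [this] with N hN
  simp only [Function.comp, pow_one, pow_zero, one_mul] at hN
  linarith

end Initial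
end GradPhi
end

/-! ### Existence of tent laws. -/

noncomputable section
namespace GradPhi

variable {V : ℝ → ℝ} {κ C κm Cm κp Cp am ap : ℝ} {K Km Kp N : ℕ}

/-- An initial law on tent-shaped configurations, whose increments are dominated from both sides
by those of the free paths with tilts `am` and `ap`. -/
structure IsTentLaw (V : ℝ → ℝ) (am ap r S : ℝ) (ν : Measure (Omega N)) : Prop where
  upper : ∃ Γ : Measure (Omega N × (ℕ → ℝ)), IsProbabilityMeasure Γ ∧ Γ.map Prod.fst = ν ∧
    (∀ᵐ p ∂Γ, p ∈ domSet N 1) ∧ TwiceLE (Γ.map Prod.snd) (freeLaw V ap N)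
  lower : ∃ Γ : Measure (Omega N × (ℕ → ℝ)), IsProbabilityMeasure Γ ∧ Γ.map Prod.fst = ν ∧
    (∀ᵐ p ∂Γ, p ∈ domSet N (-1)) ∧ TwiceLE (Γ.map Prod.snd) (freeLaw V am N)
  bound : ∀ᵐ x ∂ν, ∀ k, |x k| ≤ (N : ℝ)
  variance : ∀ k : ↥(Finset.Ioo 0 N),
    ∫⁻ x, ENNReal.ofReal ((x k - r * min (k : ℝ) (N - k)) ^ 2) ∂ν ≤ ENNReal.ofReal (S * N)

lemma IsTentLaw.isProbabilityMeasure {r S : ℝ} {ν : Measure (Omega N)}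
    (h : IsTentLaw V am ap r S ν) : IsProbabilityMeasure ν := by
  obtain ⟨Γ, hΓ, rfl, -⟩ := h.upper
  exact Measure.isProbabilityMeasure_map measurable_fst.aemeasurable

lemma measurable_tent : Measurable fun p : (ℕ → ℝ) × (ℕ → ℝ) => tent N p.1 p.2 := by
  unfold tent
  refine measurable_pi_lambda _ fun k => ?_
  fun_prop

/-- The ascending and the descending branch are driven by the same uniform variables as the two free
paths, through functions `g₁`, `g₂` of means `r` and `-r` lying between the two quantile functions.
The tent's increments are thereby sandwiched pointwise. Pinning at both ends and heights at most `N`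
hold on the event that the centred branches stay below `r * N`, which has probability at least one
half by the exponential tails and a union bound; conditioning on it costs the factor in `TwiceLE`.
-/
theorem exists_isTentLaw (hm : Coercive (fun x => V x - am * x) κm Cm Km)
    (hp : Coercive (fun x => V x - ap * x) κp Cp Kp) (hle : am ≤ ap)
    (hm0 : ∫ x, x * bondW V am x < 0) (hp0 : 0 < ∫ x, x * bondW V ap x) :
    ∃ r > 0, ∃ S ≥ 0, ∃ N₀ : ℕ, ∀ N ≥ N₀, ∃ ν : Measure (Omega N), IsTentLaw V am ap r S ν := by
  have hqm := hm.measurable_bondQuantile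
  have hqp := hp.measurable_bondQuantile
  have hZm := integral_pos_of_pos hm.integrable_bondW (bondW_pos _ _)
  have hZp := integral_pos_of_pos hp.integrable_bondW (bondW_pos _ _)
  obtain ⟨r, ⟨hr0, hr1⟩, t, ht, hg⟩ := exists_interpolation hqm hqp
    (fun U => hm.bondQuantile_mono hp hle U) (half_pos hm.kpos) (half_pos hp.kpos)
    hm.exp_integrable_bondQuantile hp.exp_integrable_bondQuantile
    (by rw [hm.integral_bondQuantile]; exact div_neg_of_neg_of_pos hm0 hZm)
    (by rw [hp.integral_bondQuantile]; exact div_pos hp0 hZp)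
  obtain ⟨g₁, hg₁, hb₁, he₁, hi₁⟩ := hg 1 (by simp)
  obtain ⟨g₂, hg₂, hb₂, he₂, hi₂⟩ := hg (-1) (by simp)
  -- centred versions
  have cen : ∀ (g : ℝ → ℝ) (m : ℝ), Measurable g →
      Integrable (fun U => Real.exp (t * |g U|)) unif → ∫ U, g U ∂unif = m →
      Integrable (fun U => Real.exp (t * |g U - m|)) unif ∧ ∫ U, (g U - m) ∂unif = 0 := by
    intro g m hg he hi
    refine ⟨(he.const_mul (Real.exp (t * |m|))).mono' (by fun_prop) (ae_of_all _ fun U => ?_), ?_⟩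
    · rw [Real.norm_eq_abs, abs_of_pos (Real.exp_pos _), ← Real.exp_add, ← mul_add]
      apply Real.exp_le_exp.2
      refine mul_le_mul_of_nonneg_left ?_ ht.le
      rw [add_comm]; exact abs_sub _ _
    · rw [integral_sub (integrable_of_exp_abs hg ht he) (integrable_const _), hi]; simp
  obtain ⟨ce₁, ci₁⟩ := cen g₁ _ hg₁ he₁ hi₁
  obtain ⟨ce₂, ci₂⟩ := cen g₂ _ hg₂ he₂ hi₂
  have cm₁ : Measurable fun U => g₁ U - 1 * r := by fun_prop
  have cm₂ : Measurable fun U => g₂ U - -1 * r := by fun_prop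
  obtain ⟨s₁, hs₁, ht₁⟩ := exists_unifPi_tail cm₁ ht hr0 ce₁ ci₁
  obtain ⟨s₂, hs₂, ht₂⟩ := exists_unifPi_tail cm₂ ht hr0 ce₂ ci₂
  set σ₁ := ∫ U, (g₁ U - 1 * r) ^ 2 ∂unif with hσ₁
  set σ₂ := ∫ U, (g₂ U - -1 * r) ^ 2 ∂unif with hσ₂
  have hσ₁0 : 0 ≤ σ₁ := integral_nonneg fun _ => sq_nonneg _
  have hσ₂0 : 0 ≤ σ₂ := integral_nonneg fun _ => sq_nonneg _
  have hs : 0 < min s₁ s₂ := lt_min hs₁ hs₂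
  obtain ⟨N₀, hN₀⟩ := eventually_atTop.1 (eventually_nat_mul_exp_le hs)
  -- The factor `2` is the cost of conditioning. The rest bounds the squared deviation of the
  -- minimum by `3 (a_k² + b_k² + b_N²)`, where `b` enters twice because the descending branch is
  -- recentred at its endpoint.
  refine ⟨r, hr0, 2 * (3 * (σ₁ + σ₂ + σ₂)), by positivity, N₀, fun N hN => ?_⟩
  -- the centred paths
  set a : (Fin N → ℝ) → ℕ → ℝ := fun ω k => drivenPath (fun U => g₁ U - 1 * r) ω k with ha
  set b : (Fin N → ℝ) → ℕ → ℝ := fun ω k => drivenPath (fun U => g₂ U - -1 * r) ω k with hb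
  have ma : ∀ k, Measurable fun ω => a ω k := measurable_drivenPath_apply cm₁
  have mb : ∀ k, Measurable fun ω => b ω k := measurable_drivenPath_apply cm₂
  have ea : ∀ ω k, k ≤ N → drivenPath g₁ ω k = a ω k + r * k := fun ω k hk => by
    simp only [ha]; rw [drivenPath_sub_const _ _ _ hk]; ring
  have eb : ∀ ω k, k ≤ N → drivenPath g₂ ω k = b ω k - r * k := fun ω k hk => by
    simp only [hb]; rw [drivenPath_sub_const _ _ _ hk]; ring
  set G : Set (Fin N → ℝ) := ⋂ k ∈ Finset.range (N + 1),
    ({ω | r * N ≤ |a ω k|}ᶜ ∩ {ω | r * N ≤ |b ω k|}ᶜ) with hG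
  have hGm : MeasurableSet G := by
    refine Finset.measurableSet_biInter _ fun k _ => ?_
    exact (measurableSet_le measurable_const (ma k).abs).compl.inter
      (measurableSet_le measurable_const (mb k).abs).compl
  have hGω : ∀ ω ∈ G, ∀ k ≤ N, |a ω k| < r * N ∧ |b ω k| < r * N := by
    intro ω hω k hk
    have := mem_iInter₂.1 hω k (Finset.mem_range.2 (by omega))
    simpa using this
  have hGc : unifPi N Gᶜ ≤ 2⁻¹ := by
    have sub : Gᶜ ⊆ ⋃ k ∈ Finset.range (N + 1),
        ({ω | r * N ≤ |a ω k|} ∪ {ω | r * N ≤ |b ω k|}) := by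
      rw [hG]
      simp only [compl_iInter, compl_inter, compl_compl]
      exact subset_rfl
    refine (measure_mono sub).trans ((measure_biUnion_finset_le _ _).trans ?_)
    have each : ∀ k, unifPi N ({ω | r * N ≤ |a ω k|} ∪ {ω | r * N ≤ |b ω k|}) ≤
        ENNReal.ofReal (4 * Real.exp (-(min s₁ s₂) * N)) := by
      intro k
      refine (measure_union_le _ _).trans ((add_le_add (ht₁ N k) (ht₂ N k)).trans ?_)
      rw [← ENNReal.ofReal_add (by positivity) (by positivity)]
      apply ENNReal.ofReal_le_ofReal
      have hN0 : (0 : ℝ) ≤ N := N.cast_nonneg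
      have l1 : Real.exp (-s₁ * N) ≤ Real.exp (-(min s₁ s₂) * N) :=
        Real.exp_le_exp.2 (by nlinarith [min_le_left s₁ s₂])
      have l2 : Real.exp (-s₂ * N) ≤ Real.exp (-(min s₁ s₂) * N) :=
        Real.exp_le_exp.2 (by nlinarith [min_le_right s₁ s₂])
      linarith
    refine (Finset.sum_le_sum fun k _ => each k).trans ?_
    rw [Finset.sum_const, Finset.card_range, nsmul_eq_mul, ← ENNReal.ofReal_natCast,
      ← ENNReal.ofReal_mul (by positivity)]
    refine (ENNReal.ofReal_le_ofReal (q := 1 / 2) (by push_cast; exact hN₀ N hN)).trans_eq ?_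
    rw [ENNReal.ofReal_div_of_pos (by norm_num)]; simp
  have hGp : 2⁻¹ ≤ unifPi N G := by
    have h1 := prob_compl_eq_one_sub (μ := unifPi N) hGm.compl
    rw [compl_compl] at h1
    rw [h1]
    refine le_trans ?_ (tsub_le_tsub_left hGc 1)
    rw [ENNReal.one_sub_inv_two]
  have hG0 : unifPi N G ≠ 0 := fun h => by rw [h] at hGp; simp at hGp
  have hcp : IsProbabilityMeasure ((unifPi N)[|G]) := cond_isProbabilityMeasure hG0
  have htw := twiceLE_cond hGp
  have hmem : ∀ᵐ ω ∂(unifPi N)[|G], ω ∈ G := ae_cond_mem hGm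
  set X : (Fin N → ℝ) → Omega N := fun ω => tent N (drivenPath g₁ ω) (drivenPath g₂ ω) with hX
  have mX : Measurable X :=
    measurable_tent.comp ((measurable_drivenPath hg₁).prodMk (measurable_drivenPath hg₂))
  have hXk : ∀ ω ∈ G, ∀ k ≤ N, height (X ω) k =
      min (drivenPath g₁ ω k) (drivenPath g₂ ω k - drivenPath g₂ ω N) := by
    intro ω hω k hk
    have h1 := hGω ω hω N le_rfl
    have h2 := abs_lt.1 h1.1
    have h3 := abs_lt.1 h1.2
    refine height_tent (freePath_zero _) (freePath_zero _) ?_ ?_ hk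
    · change 0 ≤ drivenPath g₁ ω N
      rw [ea ω N le_rfl]; linarith
    · change drivenPath g₂ ω N ≤ 0
      rw [eb ω N le_rfl]; linarith
  -- the two dominating couplings
  have coupling : ∀ (s a' : ℝ) (q : ℝ → ℝ), Measurable q →
      (unifPi N).map (fun ω => drivenPath q ω) = freeLaw V a' N →
      (∀ ω ∈ G, (X ω, drivenPath q ω) ∈ domSet N s) →
      ∃ Γ : Measure (Omega N × (ℕ → ℝ)), IsProbabilityMeasure Γ ∧
        Γ.map Prod.fst = ((unifPi N)[|G]).map X ∧
        (∀ᵐ p ∂Γ, p ∈ domSet N s) ∧ TwiceLE (Γ.map Prod.snd) (freeLaw V a' N) := by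
    intro s a' q hq hmap hdom
    have mq := measurable_drivenPath (N := N) hq
    have mXq : Measurable fun ω => (X ω, drivenPath q ω) := mX.prodMk mq
    refine ⟨((unifPi N)[|G]).map fun ω => (X ω, drivenPath q ω),
      Measure.isProbabilityMeasure_map mXq.aemeasurable, ?_, ?_, ?_⟩
    · rw [Measure.map_map measurable_fst mXq]; rfl
    · refine (ae_map_iff mXq.aemeasurable (measurableSet_domSet s)).2 ?_
      filter_upwards [hmem] with ω hω using hdom ω hω
    · rw [Measure.map_map measurable_snd mXq, ← hmap]
      exact htw.map mq
  have incr : ∀ ω ∈ G, ∀ j (hj : j < N),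
      bondQuantile V am (ω ⟨j, hj⟩) ≤ height (X ω) (j + 1) - height (X ω) j ∧
        height (X ω) (j + 1) - height (X ω) j ≤ bondQuantile V ap (ω ⟨j, hj⟩) := by
    intro ω hω j hj
    rw [hXk ω hω (j + 1) hj, hXk ω hω j hj.le]
    have e1 : drivenPath g₁ ω (j + 1) = drivenPath g₁ ω j + g₁ (ω ⟨j, hj⟩) :=
      freePath_succ _ ⟨j, hj⟩
    have e2 : drivenPath g₂ ω (j + 1) = drivenPath g₂ ω j + g₂ (ω ⟨j, hj⟩) :=
      freePath_succ _ ⟨j, hj⟩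
    have i1 := hb₁ (ω ⟨j, hj⟩)
    have i2 := hb₂ (ω ⟨j, hj⟩)
    exact min_sub_min_bounds (by linarith) (by linarith) (by linarith) (by linarith)
  refine ⟨((unifPi N)[|G]).map X, ?_, ?_, ?_, ?_⟩
  · refine coupling 1 ap _ hqp (map_drivenPath hp) fun ω hω j hj => ?_
    have e : drivenPath (bondQuantile V ap) ω (j + 1) =
        drivenPath (bondQuantile V ap) ω j + bondQuantile V ap (ω ⟨j, hj⟩) :=
      freePath_succ _ ⟨j, hj⟩
    have := (incr ω hω j hj).2
    dsimp only
    linarith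
  · refine coupling (-1) am _ hqm (map_drivenPath hm) fun ω hω j hj => ?_
    have e : drivenPath (bondQuantile V am) ω (j + 1) =
        drivenPath (bondQuantile V am) ω j + bondQuantile V am (ω ⟨j, hj⟩) :=
      freePath_succ _ ⟨j, hj⟩
    have := (incr ω hω j hj).1
    dsimp only
    linarith
  · have hms : MeasurableSet {x : Omega N | ∀ k, |x k| ≤ (N : ℝ)} := by
      have : {x : Omega N | ∀ k, |x k| ≤ (N : ℝ)} = ⋂ k, {x | |x k| ≤ (N : ℝ)} := by
        ext; simp
      rw [this]
      exact MeasurableSet.iInter fun k =>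
        measurableSet_le (measurable_pi_apply k).abs measurable_const
    refine (ae_map_iff mX.aemeasurable hms).2 ?_
    filter_upwards [hmem] with ω hω k
    have hk := Finset.mem_Ioo.1 k.2
    have hkN : ((k : ℕ) : ℝ) ≤ N := by exact_mod_cast hk.2.le
    have hk0 : (0 : ℝ) ≤ (k : ℕ) := Nat.cast_nonneg _
    have h1 := hGω ω hω k hk.2.le
    have h2 := hGω ω hω N le_rfl
    have p1 := abs_lt.1 h1.1
    have p2 := abs_lt.1 h1.2
    have p3 := abs_lt.1 h2.2
    simp only [hX, tent]
    rw [ea ω k hk.2.le, eb ω k hk.2.le, eb ω N le_rfl]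
    have q1 : r * N ≤ N / 4 := by nlinarith [N.cast_nonneg (α := ℝ)]
    have q2 : r * (k : ℕ) ≤ N / 4 := by nlinarith
    have q3 : 0 ≤ r * ((k : ℕ) : ℝ) := by positivity
    rcases min_cases (a ω k + r * (k : ℕ)) (b ω k - r * (k : ℕ) - (b ω N - r * N)) with
      ⟨h, _⟩ | ⟨h, _⟩ <;> rw [h, abs_le] <;> constructor <;> linarith
  · intro k
    have hk := Finset.mem_Ioo.1 k.2
    have mF : Measurable fun x : Omega N =>
        ENNReal.ofReal ((x k - r * min ((k : ℕ) : ℝ) (N - (k : ℕ))) ^ 2) := by fun_prop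
    rw [lintegral_map mF mX]
    refine (htw _ (mF.comp mX)).trans ?_
    have v1 := integral_sq_drivenPath_le (N := N) cm₁ ht ce₁ ci₁ k
    have v2 := integral_sq_drivenPath_le (N := N) cm₂ ht ce₂ ci₂ k
    have v3 := integral_sq_drivenPath_le (N := N) cm₂ ht ce₂ ci₂ N
    have pw : ∀ ω, ENNReal.ofReal ((X ω k - r * min ((k : ℕ) : ℝ) (N - (k : ℕ))) ^ 2) ≤
        3 * (ENNReal.ofReal (a ω k ^ 2) + ENNReal.ofReal (b ω k ^ 2) +
          ENNReal.ofReal (b ω N ^ 2)) := by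
      intro ω
      rw [← ENNReal.ofReal_add (sq_nonneg _) (sq_nonneg _),
        ← ENNReal.ofReal_add (by positivity) (sq_nonneg _),
        show (3 : ℝ≥0∞) = ENNReal.ofReal 3 by simp, ← ENNReal.ofReal_mul (by norm_num)]
      apply ENNReal.ofReal_le_ofReal
      simp only [hX, tent]
      rw [ea ω k hk.2.le, eb ω k hk.2.le, eb ω N le_rfl]
      set m := b ω k - b ω N with hmdef
      have e1 : r * min ((k : ℕ) : ℝ) (N - (k : ℕ)) =
          min (r * (k : ℕ)) (r * N - r * (k : ℕ)) := by
        rw [mul_min_of_nonneg _ _ hr0.le, mul_sub]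
      rw [e1]
      -- The minimum is 1-Lipschitz for the maximum norm, so only the centred fluctuations of the
      -- branches remain.
      have l1 := (abs_min_sub_min_le_max (a ω k + r * (k : ℕ))
        (b ω k - r * (k : ℕ) - (b ω N - r * N)) (r * (k : ℕ)) (r * N - r * (k : ℕ)))
      rw [show a ω k + r * (k : ℕ) - r * (k : ℕ) = a ω k by ring,
        show b ω k - r * (k : ℕ) - (b ω N - r * N) - (r * N - r * (k : ℕ)) = m by
          rw [hmdef]; ring] at l1
      rw [← sq_abs (min _ _ - min _ _)]
      refine (pow_le_pow_left₀ (abs_nonneg _) l1 2).trans ?_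
      rcases max_cases |a ω k| |m| with ⟨h, _⟩ | ⟨h, _⟩ <;> rw [h, sq_abs]
      · nlinarith [sq_nonneg (a ω k), sq_nonneg (b ω k), sq_nonneg (b ω N)]
      · rw [hmdef]
        nlinarith [sq_nonneg (a ω k), sq_nonneg (b ω k + b ω N), sq_nonneg (b ω k),
          sq_nonneg (b ω N)]
    refine (mul_le_mul_right (lintegral_mono pw) 2).trans ?_
    have m1 : Measurable fun ω => ENNReal.ofReal (a ω k ^ 2) := ((ma k).pow_const 2).ennreal_ofReal
    have m2 : Measurable fun ω => ENNReal.ofReal (b ω k ^ 2) := ((mb k).pow_const 2).ennreal_ofReal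
    have m3 : Measurable fun ω => ENNReal.ofReal (b ω N ^ 2) := ((mb N).pow_const 2).ennreal_ofReal
    rw [lintegral_const_mul 3 (f := fun ω => ENNReal.ofReal (a ω k ^ 2) +
      ENNReal.ofReal (b ω k ^ 2) + ENNReal.ofReal (b ω N ^ 2)) ((m1.add m2).add m3),
      lintegral_add_right _ m3,
      lintegral_add_right _ m2]
    refine (mul_le_mul_right (mul_le_mul_right (add_le_add (add_le_add v1 v2) v3) 3) 2).trans_eq ?_
    rw [← ENNReal.ofReal_add (by positivity) (by positivity),
      ← ENNReal.ofReal_add (by positivity) (by positivity),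
      show (3 : ℝ≥0∞) = ENNReal.ofReal 3 by simp, show (2 : ℝ≥0∞) = ENNReal.ofReal 2 by simp,
      ← ENNReal.ofReal_mul (by norm_num), ← ENNReal.ofReal_mul (by norm_num)]
    congr 1; ring

end GradPhi
end

/-! ### Uniform moments along the evolution and at equilibrium. -/

noncomputable section
namespace GradPhi

variable {V : ℝ → ℝ} {κ C κm Cm κp Cp am ap r S : ℝ} {K Km Kp N : ℕ}

lemma Coercive.lintegral_pow_bondLaw_lt_top {a : ℝ} (h : Coercive (fun x => V x - a * x) κ C K)
    (p : ℕ) : ∫⁻ x, ENNReal.ofReal (|x| ^ p) ∂bondLaw V a < ∞ := by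
  have hi : Integrable (fun x : ℝ => |x| ^ p) (bondLaw V a) := by
    refine integrable_dens h.measurable_bondW (bondW_pos _ _)
      (h.integrable_mul_bondW (by fun_prop) (B := 1) (n := p) fun u => ?_)
    rw [one_mul, abs_of_nonneg (by positivity)]
    exact pow_le_pow_left₀ (abs_nonneg _) (by linarith [abs_nonneg u]) p
  exact hi.lintegral_lt_top

/-- The moments of the increments stay bounded along the evolution from a tent law. -/
lemma Coercive.exists_increment_moments (h : Coercive V κ C K)
    (hm : Coercive (fun x => V x - am * x) κm Cm Km)
    (hp : Coercive (fun x => V x - ap * x) κp Cp Kp) (p : ℕ) :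
    ∃ M ≥ 0, ∀ (N : ℕ) (r S : ℝ) (ν : Measure (Omega N)), 2 ≤ N → IsTentLaw V am ap r S ν →
      ∀ n : ℕ, ∀ j < N,
        (∫⁻ x, ENNReal.ofReal (|height x (j + 1) - height x j| ^ p) ∂evolve (siteMap V) n ν ≤
          ENNReal.ofReal M) ∧
        ∀ k, ∫⁻ x, ENNReal.ofReal (|height x (j + 1) - height x j| ^ p)
          ∂siteStep (siteMap V k) (evolve (siteMap V) n ν) ≤ ENNReal.ofReal M := by
  set Mp := ∫⁻ x, ENNReal.ofReal (|x| ^ p) ∂bondLaw V ap with hMp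
  set Mm := ∫⁻ x, ENNReal.ofReal (|x| ^ p) ∂bondLaw V am with hMm
  have htop : 2 * Mp + 2 * Mm ≠ ∞ :=
    ENNReal.add_ne_top.2 ⟨ENNReal.mul_ne_top (by simp) (hp.lintegral_pow_bondLaw_lt_top p).ne,
      ENNReal.mul_ne_top (by simp) (hm.lintegral_pow_bondLaw_lt_top p).ne⟩
  refine ⟨(2 * Mp + 2 * Mm).toReal, ENNReal.toReal_nonneg, fun N r S ν hN hν n j hj => ?_⟩
  rw [ENNReal.ofReal_toReal htop]
  -- Each domination is one-sided and needs a monotone function: positive parts are compared with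
  -- the tilt `ap`, negative parts with the tilt `am`.
  set ψ : ℝ → ℝ≥0∞ := fun t => ENNReal.ofReal ((max t 0) ^ p) with hψ
  have hψm : Measurable ψ := by fun_prop
  have hψmono : Monotone ψ := fun a b hab =>
    ENNReal.ofReal_le_ofReal (pow_le_pow_left₀ (le_max_right _ _) (max_le_max_right 0 hab) p)
  have hsum : ∀ t, ENNReal.ofReal (|t| ^ p) ≤ ψ (1 * t) + ψ (-1 * t) := by
    intro t
    rcases le_total 0 t with ht | ht
    · refine le_trans ?_ le_self_add
      simp only [hψ]; rw [one_mul, max_eq_left ht, abs_of_nonneg ht]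
    · refine le_trans ?_ le_add_self
      simp only [hψ]; rw [neg_one_mul, max_eq_left (by linarith), abs_of_nonpos ht]
  have hle : ∀ s : ℝ, |s| = 1 → ∀ t, ψ (s * t) ≤ ENNReal.ofReal (|t| ^ p) := by
    intro s hs t
    apply ENNReal.ofReal_le_ofReal
    refine pow_le_pow_left₀ (le_max_right _ _) (max_le ?_ (abs_nonneg _)) p
    refine (le_abs_self _).trans ?_
    rw [abs_mul, hs, one_mul]
  have comb : ∀ μ : Measure (Omega N),
      ∫⁻ x, ψ (1 * (height x (j + 1) - height x j)) ∂μ ≤ 2 * ∫⁻ x, ψ (1 * x) ∂bondLaw V ap →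
      ∫⁻ x, ψ (-1 * (height x (j + 1) - height x j)) ∂μ ≤ 2 * ∫⁻ x, ψ (-1 * x) ∂bondLaw V am →
      ∫⁻ x, ENNReal.ofReal (|height x (j + 1) - height x j| ^ p) ∂μ ≤ 2 * Mp + 2 * Mm := by
    intro μ h1 h2
    refine (lintegral_mono fun x => hsum _).trans ?_
    have hmeas : Measurable fun x : Omega N => ψ (1 * (height x (j + 1) - height x j)) :=
      hψm.comp (((measurable_height _).sub (measurable_height _)).const_mul _)
    rw [lintegral_add_left hmeas]
    refine (add_le_add h1 h2).trans (add_le_add ?_ ?_)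
    · exact mul_le_mul_right (lintegral_mono fun x => hle 1 (by simp) x) 2
    · exact mul_le_mul_right (lintegral_mono fun x => hle (-1) (by simp) x) 2
  obtain ⟨Γp, _, ep, dp, tp⟩ := hν.upper
  obtain ⟨Γm, _, em, dm, tm⟩ := hν.lower
  have hup := h.lintegral_increment_le hp hN (Or.inl rfl) Γp dp tp hψm hψmono n hj
  have hlo := h.lintegral_increment_le hm hN (Or.inr rfl) Γm dm tm hψm hψmono n hj
  rw [ep] at hup
  rw [em] at hlo
  exact ⟨comb _ hup.1 hlo.1, fun k => comb _ (hup.2 k) (hlo.2 k)⟩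

lemma lam_pos (hN : 2 ≤ N) : 0 < lam N := by
  have hN' : (0 : ℝ) < N := by exact_mod_cast (by omega : 0 < N)
  have h1 : 0 < Real.pi / N := div_pos Real.pi_pos hN'
  have h2 : Real.pi / N ≤ Real.pi := div_le_self Real.pi_pos.le (by exact_mod_cast (by omega))
  have := Real.cos_lt_cos_of_nonneg_of_le_pi le_rfl h2 h1
  rw [Real.cos_zero] at this
  unfold lam; linarith

section Limit
variable {ν : Measure (Omega N)}

lemma map_fst_evolve_prod (h : Coercive V κ C K) (hN : 2 ≤ N) [IsProbabilityMeasure ν]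
    {μ : Measure (Omega N)} [IsProbabilityMeasure μ] (n : ℕ) :
    (evolve (twoMap V N) n (ν.prod μ)).map Prod.fst = evolve (siteMap V) n ν ∧
      (evolve (twoMap V N) n (ν.prod μ)).map Prod.snd = evolve (siteMap V) n μ := by
  have := nonempty_sites hN
  constructor
  · rw [map_evolve measurable_fst h.measurable_twoMap h.measurable_siteMap (fun _ _ _ => rfl)]
    simp
  · rw [map_evolve measurable_snd h.measurable_twoMap h.measurable_siteMap (fun _ _ _ => rfl)]
    simp

lemma lintegral_abs_height_gibbs_lt_top (h : Coercive V κ C K) (hN : 2 ≤ N) (k : ℕ) :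
    ∫⁻ y, ENNReal.ofReal |height y k| ∂gibbs V N < ∞ := by
  by_cases hk : k ∈ Finset.Ioo 0 N
  · have := (h.integrable_gibbs hN ⟨k, hk⟩).abs.lintegral_lt_top
    have e : ∀ y : Omega N, height y k = y ⟨k, hk⟩ := fun y => height_coe y ⟨k, hk⟩
    simp_rw [e]; exact this
  · simp [height, hk]

lemma meanGap_prod_le [IsProbabilityMeasure ν] {μ : Measure (Omega N)} [IsProbabilityMeasure μ]
    (k : ℕ) : meanGap (ν.prod μ) k ≤
      ∫⁻ x, ENNReal.ofReal |height x k| ∂ν + ∫⁻ y, ENNReal.ofReal |height y k| ∂μ := by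
  have hh := (measurable_height (N := N) k).abs.ennreal_ofReal
  have hf : Measurable fun p : Omega N × Omega N => ENNReal.ofReal |height p.1 k| :=
    hh.comp measurable_fst
  have hs : Measurable fun p : Omega N × Omega N => ENNReal.ofReal |height p.2 k| :=
    hh.comp measurable_snd
  have e1 : ∫⁻ x, ENNReal.ofReal |height x k| ∂ν =
      ∫⁻ p, ENNReal.ofReal |height p.1 k| ∂ν.prod μ := by
    rw [lintegral_prod _ hf.aemeasurable]
    simp
  have e2 : ∫⁻ x, ENNReal.ofReal |height x k| ∂μ =
      ∫⁻ p, ENNReal.ofReal |height p.2 k| ∂ν.prod μ := by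
    rw [lintegral_prod _ hs.aemeasurable]
    simp
  rw [e1, e2, ← lintegral_add_left hf]
  refine lintegral_mono fun p => ?_
  rw [← ENNReal.ofReal_add (abs_nonneg _) (abs_nonneg _)]
  exact ENNReal.ofReal_le_ofReal (abs_sub _ _)

/-- The evolution of a bounded initial law approaches equilibrium in mean. -/
lemma tendsto_sum_meanGap (h : Coercive V κ C K) (hN : 2 ≤ N) [IsProbabilityMeasure ν]
    (hν : ∀ᵐ x ∂ν, ∀ k, |x k| ≤ (N : ℝ)) :
    Tendsto (fun n => ∑ k ∈ Finset.range (N + 1),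
      meanGap (evolve (twoMap V N) n (ν.prod (gibbs V N))) k) atTop (𝓝 0) := by
  have := h.isProbabilityMeasure_gibbs hN
  have hfin : ∀ k, meanGap (ν.prod (gibbs V N)) k < ∞ := by
    intro k
    refine (meanGap_prod_le k).trans_lt
      (ENNReal.add_lt_top.2 ⟨?_, lintegral_abs_height_gibbs_lt_top h hN k⟩)
    refine lt_of_le_of_lt (b := ∫⁻ _, ENNReal.ofReal N ∂ν) (lintegral_mono_ae ?_) (by simp)
    filter_upwards [hν] with x hx
    apply ENNReal.ofReal_le_ofReal
    unfold height
    split_ifs with hk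
    · exact hx _
    · simp
  set D : ℝ := ∑ k ∈ Finset.range (N + 1), (meanGap (ν.prod (gibbs V N)) k).toReal with hD
  have hD0 : 0 ≤ D := Finset.sum_nonneg fun _ _ => ENNReal.toReal_nonneg
  have hΓ : ∀ k ≤ N, meanGap (ν.prod (gibbs V N)) k ≤ ENNReal.ofReal D := by
    intro k hk
    rw [← ENNReal.ofReal_toReal (hfin k).ne]
    exact ENNReal.ofReal_le_ofReal (Finset.single_le_sum
      (f := fun k => (meanGap (ν.prod (gibbs V N)) k).toReal)
      (fun _ _ => ENNReal.toReal_nonneg) (Finset.mem_range.2 (by omega)))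
  have hlam := lam_pos hN
  have hN1 : (0 : ℝ) < ((N - 1 : ℕ) : ℝ) := by exact_mod_cast (by omega : 0 < N - 1)
  have key : ∀ k ∈ Finset.range (N + 1), Tendsto (fun n =>
      meanGap (evolve (twoMap V N) n (ν.prod (gibbs V N))) k) atTop (𝓝 0) := by
    intro k hk
    have hk' : k ≤ N := by have := Finset.mem_range.1 hk; omega
    refine tendsto_of_tendsto_of_tendsto_of_le_of_le tendsto_const_nhds ?_ (fun _ => zero_le)
      (fun n => h.meanGap_evolve_le_exp hN (η := 1 / 2) (by norm_num) (by norm_num) _ hD0 hΓ n hk')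
    rw [← ENNReal.ofReal_zero]
    apply ENNReal.tendsto_ofReal
    rw [← mul_zero (D / Real.sin (Real.pi * (1 / 2) / 2))]
    apply Tendsto.const_mul
    refine Real.tendsto_exp_neg_atTop_nhds_zero.comp ?_
    have e : ∀ n : ℕ, (1 - 1 / 2) ^ 2 * lam N * n / ((N - 1 : ℕ) : ℝ) =
        ((1 / 4) * lam N / ((N - 1 : ℕ) : ℝ)) * n := fun n => by ring
    simp_rw [e]
    exact tendsto_natCast_atTop_atTop.const_mul_atTop (by positivity)
  simpa using tendsto_finsetSum _ key

/-- Tail bounds for a Lipschitz observable along the evolution pass to equilibrium. -/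
lemma gibbs_tail_le (h : Coercive V κ C K) (hN : 2 ≤ N) [IsProbabilityMeasure ν]
    (hν : ∀ᵐ x ∂ν, ∀ k, |x k| ≤ (N : ℝ)) {L : Omega N → ℝ} (hL : Measurable L) {A : ℝ}
    (hA : 0 ≤ A) (hlip : ∀ x y, |L x - L y| ≤
      A * ∑ k ∈ Finset.range (N + 1), |height x k - height y k|) {s : ℝ} {c : ℝ≥0∞}
    (hc : ∀ᶠ n in atTop, evolve (siteMap V) n ν {x | s ≤ L x} ≤ c) :
    gibbs V N {x | s + 1 ≤ L x} ≤ c := by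
  have := h.isProbabilityMeasure_gibbs hN
  have := nonempty_sites hN
  have hlim : Tendsto (fun n => c + ENNReal.ofReal A * ∑ k ∈ Finset.range (N + 1),
      meanGap (evolve (twoMap V N) n (ν.prod (gibbs V N))) k) atTop (𝓝 (c + 0)) := by
    apply Tendsto.const_add
    have := ENNReal.Tendsto.const_mul (a := ENNReal.ofReal A)
      (tendsto_sum_meanGap h hN hν) (Or.inr ENNReal.ofReal_ne_top)
    simpa using this
  rw [add_zero] at hlim
  refine ge_of_tendsto hlim ?_
  filter_upwards [hc] with n hn
  set Γ := evolve (twoMap V N) n (ν.prod (gibbs V N)) with hΓ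
  have hfst := (map_fst_evolve_prod h hN (ν := ν) (μ := gibbs V N) n).1
  have hsnd := (map_fst_evolve_prod h hN (ν := ν) (μ := gibbs V N) n).2
  rw [h.evolve_gibbs hN, ← hΓ] at hsnd
  rw [← hΓ] at hfst
  have hms : ∀ t : ℝ, MeasurableSet {x | t ≤ L x} := fun t => measurableSet_le measurable_const hL
  rw [← hsnd, Measure.map_apply measurable_snd (hms _)]
  -- If only the stationary copy exceeds its threshold, the copies are at distance at least one in
  -- the Lipschitz bound; Markov's inequality and the vanishing mean gaps dispose of this event.
  have sub : Prod.snd ⁻¹' {x | s + 1 ≤ L x} ⊆ Prod.fst ⁻¹' {x | s ≤ L x} ∪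
      {p : Omega N × Omega N | (1 : ℝ≥0∞) ≤ ENNReal.ofReal A * ∑ k ∈ Finset.range (N + 1),
        ENNReal.ofReal |height p.1 k - height p.2 k|} := by
    intro p hp
    rw [mem_preimage, mem_ofPred_eq] at hp
    by_cases h1 : s ≤ L p.1
    · exact Or.inl h1
    · right
      rw [mem_ofPred_eq, ← ENNReal.ofReal_sum_of_nonneg fun _ _ => abs_nonneg _,
        ← ENNReal.ofReal_mul hA, ← ENNReal.ofReal_one]
      apply ENNReal.ofReal_le_ofReal
      refine le_trans ?_ (hlip p.1 p.2)
      rw [abs_sub_comm]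
      exact le_trans (by linarith) (le_abs_self _)
  refine (measure_mono sub).trans ((measure_union_le _ _).trans (add_le_add ?_ ?_))
  · rw [← Measure.map_apply measurable_fst (hms _), hfst]
    exact hn
  · have hm : Measurable fun p : Omega N × Omega N => ENNReal.ofReal A *
        ∑ k ∈ Finset.range (N + 1), ENNReal.ofReal |height p.1 k - height p.2 k| :=
      (Finset.measurable_sum _ fun k _ => measurable_gap k).const_mul _
    have := mul_meas_ge_le_lintegral (μ := Γ) hm 1
    rw [one_mul] at this
    refine this.trans_eq ?_
    rw [lintegral_const_mul _ (Finset.measurable_sum _ fun k _ => measurable_gap k),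
      lintegral_finsetSum _ fun k _ => measurable_gap k]
    rfl

/-- Bounds on the mean of a Lipschitz observable along the evolution pass to equilibrium. -/
lemma gibbs_lintegral_le (h : Coercive V κ C K) (hN : 2 ≤ N) [IsProbabilityMeasure ν]
    (hν : ∀ᵐ x ∂ν, ∀ k, |x k| ≤ (N : ℝ)) {F : Omega N → ℝ≥0∞} (hF : Measurable F) {A : ℝ≥0}
    (hlip : ∀ x y, F y ≤
      F x + A * ∑ k ∈ Finset.range (N + 1), ENNReal.ofReal |height x k - height y k|) {c : ℝ≥0∞}
    (hc : ∀ n, ∫⁻ x, F x ∂evolve (siteMap V) n ν ≤ c) :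
    ∫⁻ x, F x ∂gibbs V N ≤ c := by
  have := h.isProbabilityMeasure_gibbs hN
  have := nonempty_sites hN
  have hlim : Tendsto (fun n => c + A * ∑ k ∈ Finset.range (N + 1),
      meanGap (evolve (twoMap V N) n (ν.prod (gibbs V N))) k) atTop (𝓝 (c + 0)) := by
    apply Tendsto.const_add
    have := ENNReal.Tendsto.const_mul (a := (A : ℝ≥0∞)) (tendsto_sum_meanGap h hN hν)
      (Or.inr (by simp))
    simpa using this
  rw [add_zero] at hlim
  refine ge_of_tendsto' hlim fun n => ?_
  set Γ := evolve (twoMap V N) n (ν.prod (gibbs V N)) with hΓ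
  have hfst := (map_fst_evolve_prod h hN (ν := ν) (μ := gibbs V N) n).1
  have hsnd := (map_fst_evolve_prod h hN (ν := ν) (μ := gibbs V N) n).2
  rw [h.evolve_gibbs hN, ← hΓ] at hsnd
  rw [← hΓ] at hfst
  have hF1 : Measurable fun p : Omega N × Omega N => F p.1 := hF.comp measurable_fst
  have hg : Measurable fun p : Omega N × Omega N =>
      ∑ k ∈ Finset.range (N + 1), ENNReal.ofReal |height p.1 k - height p.2 k| :=
    Finset.measurable_sum _ fun k _ => measurable_gap k
  rw [← hsnd, lintegral_map hF measurable_snd]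
  refine (lintegral_mono fun p : Omega N × Omega N => hlip p.1 p.2).trans ?_
  rw [lintegral_add_left hF1, lintegral_const_mul _ hg,
    lintegral_finsetSum _ fun k _ => measurable_gap k, ← lintegral_map hF measurable_fst, hfst]
  exact add_le_add (hc n) le_rfl

end Limit

/-- Uniform moment bounds for the equilibrium increments and heights. -/
lemma exists_gibbs_moments (h : Coercive V κ C K)
    (hm : Coercive (fun x => V x - am * x) κm Cm Km)
    (hp : Coercive (fun x => V x - ap * x) κp Cp Kp) (p : ℕ) :
    ∃ M ≥ 0, ∀ (N : ℕ) (r S : ℝ) (ν : Measure (Omega N)), 2 ≤ N → IsTentLaw V am ap r S ν →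
      (∀ j < N, ∫⁻ x, ENNReal.ofReal (|height x (j + 1) - height x j| ^ p) ∂gibbs V N ≤
        ENNReal.ofReal M) ∧
      ∀ k ≤ N, ∫⁻ x, ENNReal.ofReal |height x k| ∂gibbs V N ≤ ENNReal.ofReal (M * N) := by
  have moments : ∀ p : ℕ, ∃ M ≥ 0, ∀ (N : ℕ) (r S : ℝ) (ν : Measure (Omega N)), 2 ≤ N →
      IsTentLaw V am ap r S ν → ∀ j < N,
        ∫⁻ x, ENNReal.ofReal (|height x (j + 1) - height x j| ^ p) ∂gibbs V N ≤
          ENNReal.ofReal M := by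
    intro p
    obtain ⟨M, hM, hmom⟩ := h.exists_increment_moments hm hp p
    refine ⟨M, hM, fun N r S ν hN hν j hj => ?_⟩
    have hνp := hν.isProbabilityMeasure
    set D : Omega N → ℝ := fun x => |height x (j + 1) - height x j| with hD
    have hDm : Measurable D := ((measurable_height _).sub (measurable_height _)).abs
    have hD0 : ∀ x, 0 ≤ D x := fun x => abs_nonneg _
    -- Truncation makes the power Lipschitz in the heights, so the bound passes to equilibrium;
    -- monotone convergence then removes the truncation.
    set F : ℕ → Omega N → ℝ≥0∞ := fun R x => ENNReal.ofReal (min (D x) R ^ p) with hFdef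
    have hFm : ∀ R, Measurable (F R) := fun R => by fun_prop
    have hmin0 : ∀ x (R : ℕ), 0 ≤ min (D x) R := fun x R => le_min (hD0 x) R.cast_nonneg
    have trunc : ∀ R, ∫⁻ x, F R x ∂gibbs V N ≤ ENNReal.ofReal M := by
      intro R
      refine gibbs_lintegral_le h hN hν.bound (hFm R) (A := 2 * (p * R ^ (p - 1) : ℝ≥0)) ?_ ?_
      · intro x y
        have e2 : ((2 * (p * R ^ (p - 1)) : ℝ≥0) : ℝ≥0∞) =
            ENNReal.ofReal (2 * (p * R ^ (p - 1))) := by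
          rw [← ENNReal.ofReal_coe_nnreal]; push_cast; rfl
        rw [e2, ← ENNReal.ofReal_sum_of_nonneg fun _ _ => abs_nonneg _,
          ← ENNReal.ofReal_mul (by positivity), ← ENNReal.ofReal_add (pow_nonneg (hmin0 _ _) _)
            (mul_nonneg (by positivity) (Finset.sum_nonneg fun _ _ => abs_nonneg _))]
        apply ENNReal.ofReal_le_ofReal
        have h1 := abs_pow_sub_pow_le (min (D y) R) (min (D x) R) p
        have h2 : |min (D y) R - min (D x) R| ≤ |D y - D x| := by
          refine (abs_min_sub_min_le_max _ _ _ _).trans ?_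
          simp
        have h3 : max |min (D y) (R : ℝ)| |min (D x) (R : ℝ)| ≤ R := by
          rw [abs_of_nonneg (hmin0 _ _), abs_of_nonneg (hmin0 _ _)]
          exact max_le (min_le_right _ _) (min_le_right _ _)
        have h4 : |D y - D x| ≤
            2 * ∑ k ∈ Finset.range (N + 1), |height x k - height y k| := by
          refine (abs_abs_sub_abs_le_abs_sub _ _).trans ?_
          have e : height y (j + 1) - height y j - (height x (j + 1) - height x j) =
            (height x j - height y j) - (height x (j + 1) - height y (j + 1)) := by ring
          rw [e, two_mul]
          refine (abs_sub _ _).trans (add_le_add ?_ ?_)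
          · exact Finset.single_le_sum (f := fun k => |height x k - height y k|)
              (fun _ _ => abs_nonneg _) (Finset.mem_range.2 (by omega : j < N + 1))
          · exact Finset.single_le_sum (f := fun k => |height x k - height y k|)
              (fun _ _ => abs_nonneg _) (Finset.mem_range.2 (by omega : j + 1 < N + 1))
        have h5 : |min (D y) R - min (D x) R| * p *
            max |min (D y) (R : ℝ)| |min (D x) (R : ℝ)| ^ (p - 1) ≤
            (2 * ∑ k ∈ Finset.range (N + 1), |height x k - height y k|) * p * R ^ (p - 1) := by
          have := h2.trans h4
          gcongr
        have h6 := (le_abs_self _).trans (h1.trans h5)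
        linarith
      · intro n
        refine le_trans (lintegral_mono fun x => ?_) (hmom N r S ν hN hν n j hj).1
        exact ENNReal.ofReal_le_ofReal (pow_le_pow_left₀ (hmin0 _ _) (min_le_left _ _) p)
    have hmono : Monotone F := fun R R' hR x => ENNReal.ofReal_le_ofReal
      (pow_le_pow_left₀ (hmin0 _ _) (min_le_min_left _ (by exact_mod_cast hR)) p)
    refine le_trans (lintegral_mono fun x => ?_)
      ((lintegral_iSup hFm hmono).trans_le (iSup_le trunc))
    obtain ⟨R, hR⟩ := exists_nat_ge (D x)
    refine le_iSup_of_le R ?_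
    simp only [hFdef, min_eq_left hR]
    exact le_rfl
  -- First moments of the increments bound the heights, summing along the path from zero.
  obtain ⟨M₁, hM₁, h₁⟩ := moments 1
  obtain ⟨M, hM, h₂⟩ := moments p
  refine ⟨max M M₁, le_max_of_le_left hM, fun N r S ν hN hν => ⟨fun j hj =>
    (h₂ N r S ν hN hν j hj).trans (ENNReal.ofReal_le_ofReal (le_max_left _ _)), ?_⟩⟩
  have inc : ∀ j < N, ∫⁻ x, ENNReal.ofReal |height x (j + 1) - height x j| ∂gibbs V N ≤
      ENNReal.ofReal (max M M₁) := by
    intro j hj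
    refine le_trans ?_ (ENNReal.ofReal_le_ofReal (le_max_right M M₁))
    simpa using h₁ N r S ν hN hν j hj
  have main : ∀ k ≤ N, ∫⁻ x, ENNReal.ofReal |height x k| ∂gibbs V N ≤
      ENNReal.ofReal (max M M₁ * k) := by
    intro k
    induction k with
    | zero => intro _; simp [height_zero]
    | succ k ih =>
      intro hk
      have hmi : Measurable fun x : Omega N => ENNReal.ofReal |height x (k + 1) - height x k| :=
        ((measurable_height _).sub (measurable_height _)).abs.ennreal_ofReal
      refine (lintegral_mono fun x => ?_).trans ((lintegral_add_left hmi
        (fun x : Omega N => ENNReal.ofReal |height x k|)).le.trans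
        ((add_le_add (inc k hk) (ih (by omega))).trans_eq ?_))
      · rw [← ENNReal.ofReal_add (abs_nonneg _) (abs_nonneg _)]
        apply ENNReal.ofReal_le_ofReal
        have := abs_add_le (height x (k + 1) - height x k) (height x k)
        rwa [sub_add_cancel] at this
      · have hM' : 0 ≤ max M M₁ := le_max_of_le_left hM
        rw [← ENNReal.ofReal_add hM' (by positivity)]
        push_cast; ring_nf
  intro k hk
  refine (main k hk).trans (ENNReal.ofReal_le_ofReal ?_)
  exact mul_le_mul_of_nonneg_left (by exact_mod_cast hk) (le_max_of_le_left hM)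

end GradPhi
end

/-! ### The lowest mode of the discrete Laplacian as an observable. -/

noncomputable section
namespace GradPhi

variable {V : ℝ → ℝ} {κ C κm Cm κp Cp am ap r S : ℝ} {K Km Kp N : ℕ}

/-- The weight of the lowest mode. -/
def sinW (N k : ℕ) : ℝ := Real.sin (Real.pi * k / N)

/-- The observable associated with the lowest mode of the discrete Laplacian. -/
def sineSum (x : Omega N) : ℝ := ∑ k : ↥(Finset.Ioo 0 N), sinW N k * x k

lemma measurable_sineSum : Measurable (sineSum (N := N)) := by
  unfold sineSum; fun_prop

lemma abs_sinW_le (N k : ℕ) : |sinW N k| ≤ 1 := Real.abs_sin_le_one _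

lemma sinW_nonneg {k : ℕ} (hk : k ≤ N) : 0 ≤ sinW N k := by
  rcases Nat.eq_zero_or_pos N with rfl | hN
  · simp [sinW]
  have hN' : (0 : ℝ) < N := by exact_mod_cast hN
  refine Real.sin_nonneg_of_nonneg_of_le_pi (by positivity) ?_
  rw [div_le_iff₀ hN']
  exact mul_le_mul_of_nonneg_left (by exact_mod_cast hk) Real.pi_pos.le

lemma sum_sites_eq (g : ℕ → ℝ) :
    ∑ k : ↥(Finset.Ioo 0 N), g k = ∑ i ∈ Finset.range (N - 1), g (i + 1) := by
  rw [Finset.sum_coe_sort (Finset.Ioo 0 N) g]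
  have : Finset.Ioo 0 N = Finset.Ico 1 N := by ext; simp; omega
  rw [this, Finset.sum_Ico_eq_sum_range]
  exact Finset.sum_congr rfl fun i _ => by rw [add_comm]

/-- Self-adjointness of the Dirichlet Laplacian: the difference of the summands telescopes, and the
boundary terms vanish. -/
lemma sum_mul_neighbours (s h : ℕ → ℝ) (hN : 1 ≤ N) (s0 : s 0 = 0) (sN : s N = 0) (h0 : h 0 = 0)
    (hN0 : h N = 0) :
    ∑ k : ↥(Finset.Ioo 0 N), s k * (h (k - 1) + h (k + 1)) =
      ∑ k : ↥(Finset.Ioo 0 N), (s (k - 1) + s (k + 1)) * h k := by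
  rw [sum_sites_eq fun k => s k * (h (k - 1) + h (k + 1)),
    sum_sites_eq fun k => (s (k - 1) + s (k + 1)) * h k, ← sub_eq_zero, ← Finset.sum_sub_distrib]
  have e : ∀ i, s (i + 1) * (h (i + 1 - 1) + h (i + 1 + 1)) -
      (s (i + 1 - 1) + s (i + 1 + 1)) * h (i + 1) =
      (fun i => s i * h (i + 1) - s (i + 1) * h i) (i + 1) -
        (fun i => s i * h (i + 1) - s (i + 1) * h i) i := by
    intro i; simp only [Nat.add_sub_cancel]; ring
  rw [Finset.sum_congr rfl fun i _ => e i,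
    Finset.sum_range_sub fun i => s i * h (i + 1) - s (i + 1) * h i]
  simp only [Nat.sub_add_cancel hN, s0, sN, h0, hN0]
  simp

lemma sinW_neighbours (hN : N ≠ 0) {k : ℕ} (hk : 0 < k) :
    sinW N (k - 1) + sinW N (k + 1) = 2 * (1 - lam N) * sinW N k := by
  have hN' : (N : ℝ) ≠ 0 := by exact_mod_cast hN
  obtain ⟨m, rfl⟩ : ∃ m, k = m + 1 := ⟨k - 1, by omega⟩
  have e1 : Real.pi * ((m + 1 - 1 : ℕ) : ℝ) / N =
      Real.pi * ((m + 1 : ℕ) : ℝ) / N - Real.pi / N := by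
    simp only [Nat.add_sub_cancel]; push_cast; field_simp; ring
  have e2 : Real.pi * ((m + 1 + 1 : ℕ) : ℝ) / N =
      Real.pi * ((m + 1 : ℕ) : ℝ) / N + Real.pi / N := by
    push_cast; field_simp
  unfold sinW lam
  rw [e1, e2, Real.sin_sub, Real.sin_add]
  ring

/-- The mean drift of the lowest mode. -/
lemma sum_sinW_drift (hN : 2 ≤ N) (x : Omega N) :
    ∑ k : ↥(Finset.Ioo 0 N),
      sinW N k * ((height x (k - 1) + height x (k + 1)) / 2 - x k) = -(lam N * sineSum x) := by
  have hN0 : (N : ℝ) ≠ 0 := by exact_mod_cast (by omega : N ≠ 0)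
  have h1 := sum_mul_neighbours (N := N) (sinW N) (height x) (by omega) (by simp [sinW])
    (by simp [sinW, hN0]) (height_zero x) (height_of_le x le_rfl)
  have h2 : ∀ k : ↥(Finset.Ioo 0 N), (sinW N (k - 1) + sinW N (k + 1)) * height x k =
      2 * (1 - lam N) * (sinW N k * x k) := by
    intro k
    rw [sinW_neighbours (by omega) (Finset.mem_Ioo.1 k.2).1, height_coe]; ring
  simp_rw [h2, ← Finset.mul_sum] at h1
  have h3 : ∀ k : ↥(Finset.Ioo 0 N),
      sinW N k * ((height x (k - 1) + height x (k + 1)) / 2 - x k) =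
      (1 / 2) * (sinW N k * (height x (k - 1) + height x (k + 1))) - sinW N k * x k := by
    intro k; ring
  simp_rw [h3]
  rw [Finset.sum_sub_distrib, ← Finset.mul_sum, h1, sineSum]
  ring

lemma sineSum_siteMap (V : ℝ → ℝ) (k : ↥(Finset.Ioo 0 N)) (x : Omega N) (u : ℝ) :
    sineSum (siteMap V k x u) = sineSum x + sinW N k * (siteMap V k x u k - x k) := by
  unfold sineSum
  rw [← sub_eq_iff_eq_add', ← Finset.sum_sub_distrib, Finset.sum_eq_single k]
  · ring
  · intro j _ hj
    have : siteMap V k x u j = x j := by simp [siteMap, Function.update_of_ne hj]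
    rw [this]; ring
  · simp

lemma siteMap_self (V : ℝ → ℝ) (k : ↥(Finset.Ioo 0 N)) (x : Omega N) (u : ℝ) :
    siteMap V k x u k = Qt V (height x (k - 1)) (height x (k + 1)) u := by
  simp [siteMap]

lemma Coercive.integrable_Qt_sub_sq (h : Coercive V κ C K) (b c a : ℝ) :
    Integrable (fun U => (Qt V b c U - a) ^ 2) unif := by
  refine h.integrable_comp_Qt b c (g := fun u => (u - a) ^ 2) (by fun_prop)
    (B := (1 + |b - a|) ^ 2) (n := 2) fun u => ?_
  rw [abs_of_nonneg (sq_nonneg _), ← mul_pow, ← sq_abs]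
  refine pow_le_pow_left₀ (abs_nonneg _) ?_ 2
  have := abs_add_le (u - b) (b - a)
  rw [sub_add_sub_cancel] at this
  nlinarith [abs_nonneg (u - b), abs_nonneg (b - a)]

/-- One step of the chain contracts the second moment of the lowest mode, up to noise. -/
lemma Coercive.stepOp_sineSum_sq_le (h : Coercive V κ C K) (hN : 2 ≤ N) (F : ℝ) (x : Omega N) :
    stepOp (siteMap V)
      (fun y : Omega N =>
        ENNReal.ofReal ((sineSum y - (1 - lam N / ((N - 1 : ℕ) : ℝ)) * F) ^ 2)) x ≤
      ENNReal.ofReal ((1 - lam N / ((N - 1 : ℕ) : ℝ)) ^ 2 * (sineSum x - F) ^ 2) +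
      (((N - 1 : ℕ) : ℝ≥0∞))⁻¹ *
        ∑ k, ∫⁻ u, ENNReal.ofReal ((siteMap V k x u k - x k) ^ 2) ∂unif := by
  have hN1 : (0 : ℝ) < ((N - 1 : ℕ) : ℝ) := by exact_mod_cast (by omega : 0 < N - 1)
  have hcinv : (((N - 1 : ℕ) : ℝ≥0∞))⁻¹ = ENNReal.ofReal (((N - 1 : ℕ) : ℝ)⁻¹) := by
    rw [ENNReal.ofReal_inv_of_pos hN1, ENNReal.ofReal_natCast]
  set q := lam N / ((N - 1 : ℕ) : ℝ) with hq
  set α := sineSum x - (1 - q) * F with hα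
  set Y : ↥(Finset.Ioo 0 N) → ℝ → ℝ := fun k u => siteMap V k x u k - x k with hY
  have hYe : ∀ k u, Y k u = Qt V (height x (k - 1)) (height x (k + 1)) u - x k := fun k u => by
    simp only [hY, siteMap_self]
  have hY1 : ∀ k, Integrable (Y k) unif := fun k => by
    refine ((h.integrable_Qt (height x (k - 1)) (height x (k + 1))).sub
      (integrable_const (x k))).congr (ae_of_all _ fun u => ?_)
    rw [hYe]; rfl
  have hY2 : ∀ k, Integrable (fun u => Y k u ^ 2) unif := fun k => by
    simp_rw [hYe]; exact h.integrable_Qt_sub_sq _ _ _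
  have hm : ∀ k, ∫ u, Y k u ∂unif = (height x (k - 1) + height x (k + 1)) / 2 - x k := by
    intro k
    simp_rw [hYe]
    rw [integral_sub (h.integrable_Qt _ _) (integrable_const _), h.integral_Qt]; simp
  have hsq : ∀ k : ↥(Finset.Ioo 0 N),
      ∫⁻ u, ENNReal.ofReal ((sineSum (siteMap V k x u) - (1 - q) * F) ^ 2) ∂unif =
      ENNReal.ofReal (α ^ 2 + 2 * α * (sinW N k *
        ((height x (k - 1) + height x (k + 1)) / 2 - x k)) +
          sinW N k ^ 2 * ∫ u, Y k u ^ 2 ∂unif) := by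
    intro k
    have e : ∀ u, (sineSum (siteMap V k x u) - (1 - q) * F) ^ 2 =
        α ^ 2 + (2 * α * sinW N k) * Y k u + sinW N k ^ 2 * Y k u ^ 2 := by
      intro u
      rw [sineSum_siteMap]; simp only [hα, hY]; ring
    have i1 : Integrable (fun u => α ^ 2 + (2 * α * sinW N k) * Y k u) unif :=
      (integrable_const _).add ((hY1 k).const_mul _)
    have i2 : Integrable (fun u => sinW N k ^ 2 * Y k u ^ 2) unif := (hY2 k).const_mul _
    simp_rw [e]
    rw [← ofReal_integral_eq_lintegral_ofReal (f := fun u => α ^ 2 + 2 * α * sinW N k * Y k u +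
      sinW N k ^ 2 * Y k u ^ 2) (i1.add i2) (ae_of_all _ fun u => by
        simp only [Pi.zero_apply]; rw [← e]; exact sq_nonneg _)]
    congr 1
    have s1 : ∫ u, (α ^ 2 + 2 * α * sinW N k * Y k u + sinW N k ^ 2 * Y k u ^ 2) ∂unif =
        ∫ u, (α ^ 2 + 2 * α * sinW N k * Y k u) ∂unif +
          ∫ u, sinW N k ^ 2 * Y k u ^ 2 ∂unif := integral_add i1 i2
    rw [s1, integral_add (integrable_const _) ((hY1 k).const_mul _), integral_const_mul,
      integral_const_mul, hm]
    simp; ring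
  have hterm : ∀ k : ↥(Finset.Ioo 0 N), 0 ≤ α ^ 2 + 2 * α * (sinW N k *
      ((height x (k - 1) + height x (k + 1)) / 2 - x k)) + sinW N k ^ 2 * ∫ u, Y k u ^ 2 ∂unif := by
    intro k
    have j : (∫ u, Y k u ∂unif) ^ 2 ≤ ∫ u, Y k u ^ 2 ∂unif := by
      have hv := variance_nonneg (Y k) unif
      rw [variance_eq_sub ((memLp_two_iff_integrable_sq (hY1 k).aestronglyMeasurable).2 (hY2 k))]
        at hv
      simpa using hv
    rw [hm] at j
    nlinarith [mul_le_mul_of_nonneg_left j (sq_nonneg (sinW N k)),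
      sq_nonneg (α + sinW N k * ((height x (k - 1) + height x (k + 1)) / 2 - x k))]
  have hvar0 : ∀ k, 0 ≤ ∫ u, Y k u ^ 2 ∂unif := fun k => integral_nonneg fun _ => sq_nonneg _
  have hrhs : ∀ k, ∫⁻ u, ENNReal.ofReal (Y k u ^ 2) ∂unif =
      ENNReal.ofReal (∫ u, Y k u ^ 2 ∂unif) := fun k =>
    (ofReal_integral_eq_lintegral_ofReal (hY2 k) (ae_of_all _ fun _ => sq_nonneg _)).symm
  have hr : ∀ k : ↥(Finset.Ioo 0 N),
      ∫⁻ u, ENNReal.ofReal ((siteMap V k x u k - x k) ^ 2) ∂unif =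
      ENNReal.ofReal (∫ u, Y k u ^ 2 ∂unif) := hrhs
  unfold stepOp
  simp_rw [hsq, hr]
  rw [card_sites, hcinv, ← ENNReal.ofReal_sum_of_nonneg fun k _ => hterm k,
    ← ENNReal.ofReal_sum_of_nonneg fun k _ => hvar0 k, ← ENNReal.ofReal_mul (by positivity),
    ← ENNReal.ofReal_mul (by positivity)]
  have hsum0 : 0 ≤ ∑ k, ∫ u, Y k u ^ 2 ∂unif := Finset.sum_nonneg fun k _ => hvar0 k
  rw [← ENNReal.ofReal_add (by positivity) (by positivity)]
  apply ENNReal.ofReal_le_ofReal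
  rw [Finset.sum_add_distrib, Finset.sum_add_distrib, ← Finset.mul_sum, sum_sinW_drift hN,
    Finset.sum_const, Finset.card_univ, card_sites, nsmul_eq_mul]
  have hs2 : ∑ k : ↥(Finset.Ioo 0 N), sinW N k ^ 2 * ∫ u, Y k u ^ 2 ∂unif ≤
      ∑ k, ∫ u, Y k u ^ 2 ∂unif := by
    refine Finset.sum_le_sum fun k _ => ?_
    have : sinW N k ^ 2 ≤ 1 := (sq_le_one_iff_abs_le_one _).2 (abs_sinW_le N k)
    nlinarith [hvar0 k]
  have hinv := mul_le_mul_of_nonneg_left hs2 (inv_nonneg.2 hN1.le)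
  -- Averaging over sites turns the drift into `-q * sineSum x`. Completing the square produces the
  -- contracted deviation, and the term `-(q * sineSum x) ^ 2` has a favourable sign.
  have e1 : ((N - 1 : ℕ) : ℝ)⁻¹ * (((N - 1 : ℕ) : ℝ) * α ^ 2 + 2 * α * -(lam N * sineSum x)) =
      (α - q * sineSum x) ^ 2 - (q * sineSum x) ^ 2 := by
    rw [hq]; field_simp; ring
  have e2 : α - q * sineSum x = (1 - q) * (sineSum x - F) := by rw [hα]; ring
  rw [mul_add, e1, e2, mul_pow]
  nlinarith [sq_nonneg (q * sineSum x)]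

end GradPhi
end

/-! ### Size and variance of the lowest mode from a tent law. -/

noncomputable section
namespace GradPhi

variable {V : ℝ → ℝ} {κ C κm Cm κp Cp am ap r S : ℝ} {K Km Kp N : ℕ}

lemma lam_ge (hN : 2 ≤ N) : 2 / (N : ℝ) ^ 2 ≤ lam N := by
  have hN' : (0 : ℝ) < N := by exact_mod_cast (by omega : 0 < N)
  have hx : |Real.pi / N| ≤ Real.pi := by
    rw [abs_of_nonneg (by positivity)]
    exact div_le_self Real.pi_pos.le (by exact_mod_cast (by omega))
  have h1 := Real.cos_le_one_sub_mul_cos_sq hx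
  have h2 : 2 / Real.pi ^ 2 * (Real.pi / N) ^ 2 = 2 / (N : ℝ) ^ 2 := by
    have := Real.pi_pos.ne'
    field_simp
  rw [h2] at h1
  unfold lam; linarith

lemma lam_le_two (N : ℕ) : lam N ≤ 2 := by
  have := Real.neg_one_le_cos (Real.pi / N)
  unfold lam; linarith

lemma lam_div_le_one (hN : 3 ≤ N) : lam N / ((N - 1 : ℕ) : ℝ) ≤ 1 := by
  have h2 : (2 : ℝ) ≤ ((N - 1 : ℕ) : ℝ) := by exact_mod_cast (by omega : 2 ≤ N - 1)
  rw [div_le_one (by linarith)]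
  exact (lam_le_two N).trans h2

/-- The mean square displacement in one update is bounded. -/
lemma lintegral_displacement_le (h : Coercive V κ C K) {μ : Measure (Omega N)}
    [IsProbabilityMeasure μ] (k : ↥(Finset.Ioo 0 N)) {M : ℝ} (hM : 0 ≤ M)
    (h1 : ∫⁻ x, ENNReal.ofReal (|height x k - height x (k - 1)| ^ 2) ∂μ ≤ ENNReal.ofReal M)
    (h2 : ∫⁻ x, ENNReal.ofReal (|height x k - height x (k - 1)| ^ 2) ∂siteStep (siteMap V k) μ ≤
      ENNReal.ofReal M) :
    ∫⁻ x, ∫⁻ u, ENNReal.ofReal ((siteMap V k x u k - x k) ^ 2) ∂unif ∂μ ≤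
      ENNReal.ofReal (4 * M) := by
  have hk := Finset.mem_Ioo.1 k.2
  have hmf : Measurable fun x : Omega N =>
      ENNReal.ofReal (|height x k - height x (k - 1)| ^ 2) :=
    (((measurable_height _).sub (measurable_height _)).abs.pow_const 2).ennreal_ofReal
  have hms := h.measurable_siteMap (N := N) k
  rw [lintegral_siteStep hms _ hmf] at h2
  -- The height at `k - 1` does not change, so the displacement at `k` is the difference of one
  -- increment before and after the update, and increment moments suffice.
  have pw : ∀ x u, ENNReal.ofReal ((siteMap V k x u k - x k) ^ 2) ≤
      2 * ENNReal.ofReal (|height (siteMap V k x u) k - height (siteMap V k x u) (k - 1)| ^ 2) +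
      2 * ENNReal.ofReal (|height x k - height x (k - 1)| ^ 2) := by
    intro x u
    rw [show (2 : ℝ≥0∞) = ENNReal.ofReal 2 by simp, ← ENNReal.ofReal_mul (by norm_num),
      ← ENNReal.ofReal_mul (by norm_num), ← ENNReal.ofReal_add (by positivity) (by positivity)]
    apply ENNReal.ofReal_le_ofReal
    have e : height (siteMap V k x u) (k - 1) = height x (k - 1) := by
      rw [height_siteMap, pathMap, Function.update_of_ne (by omega)]
    rw [e, height_coe, height_coe, sq_abs, sq_abs]
    nlinarith [sq_nonneg ((siteMap V k x u k - height x (k - 1)) + (x k - height x (k - 1)))]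
  have hu : ∀ x, Measurable fun u => ENNReal.ofReal
      (|height (siteMap V k x u) k - height (siteMap V k x u) (k - 1)| ^ 2) := fun x =>
    hmf.comp (hms.comp (f := fun u => (x, u)) (by fun_prop))
  refine (lintegral_mono fun x => lintegral_mono fun u => pw x u).trans ?_
  have e1 : ∀ x, ∫⁻ u, (2 * ENNReal.ofReal (|height (siteMap V k x u) k -
      height (siteMap V k x u) (k - 1)| ^ 2) +
      2 * ENNReal.ofReal (|height x k - height x (k - 1)| ^ 2)) ∂unif =
      2 * ∫⁻ u, ENNReal.ofReal (|height (siteMap V k x u) k -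
        height (siteMap V k x u) (k - 1)| ^ 2) ∂unif +
      2 * ENNReal.ofReal (|height x k - height x (k - 1)| ^ 2) := by
    intro x
    rw [lintegral_add_right _ measurable_const, lintegral_const_mul _ (hu x), lintegral_const]
    simp
  simp_rw [e1]
  rw [lintegral_add_right _ (hmf.const_mul 2),
    lintegral_const_mul 2 (measurable_lintegral_unif hms hmf), lintegral_const_mul _ hmf]
  refine (add_le_add (mul_le_mul_right h2 2) (mul_le_mul_right h1 2)).trans_eq ?_
  rw [show (2 : ℝ≥0∞) = ENNReal.ofReal 2 by simp, ← ENNReal.ofReal_mul (by norm_num),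
    ← ENNReal.ofReal_add (by positivity) (by positivity)]
  congr 1; ring

/-- The amplitude of the lowest mode of the tent. -/
def tentMode (N : ℕ) (r : ℝ) : ℝ :=
  ∑ k : ↥(Finset.Ioo 0 N), sinW N k * (r * min ((k : ℕ) : ℝ) (N - (k : ℕ)))

/-- Only the sites with `N / 4 ≤ k ≤ N / 2` are kept: there are at least `N / 8` of them, with sine
at least `1 / 2` and tent height at least `r * N / 4`. -/
lemma tentMode_ge (hr : 0 ≤ r) (hN : 16 ≤ N) : r / 64 * (N : ℝ) ^ 2 ≤ tentMode N r := by
  have hN' : (0 : ℝ) < N := by exact_mod_cast (by omega : 0 < N)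
  set T : Finset ↥(Finset.Ioo 0 N) :=
    Finset.univ.filter fun k => N ≤ 4 * (k : ℕ) ∧ 2 * (k : ℕ) ≤ N with hT
  have nonneg : ∀ k : ↥(Finset.Ioo 0 N),
      0 ≤ sinW N k * (r * min ((k : ℕ) : ℝ) (N - (k : ℕ))) := by
    intro k
    have hk := Finset.mem_Ioo.1 k.2
    have hk' : ((k : ℕ) : ℝ) ≤ N := by exact_mod_cast hk.2.le
    exact mul_nonneg (sinW_nonneg hk.2.le)
      (mul_nonneg hr (le_min (Nat.cast_nonneg _) (by linarith)))
  have term : ∀ k ∈ T, r * N / 8 ≤ sinW N k * (r * min ((k : ℕ) : ℝ) (N - (k : ℕ))) := by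
    intro k hk
    obtain ⟨h1, h2⟩ := (Finset.mem_filter.1 hk).2
    have h1' : (N : ℝ) ≤ 4 * (k : ℕ) := by exact_mod_cast h1
    have h2' : 2 * ((k : ℕ) : ℝ) ≤ N := by exact_mod_cast h2
    have hs : 1 / 2 ≤ sinW N k := by
      have hx : Real.pi * (k : ℕ) / N ≤ Real.pi / 2 := by
        rw [div_le_div_iff₀ hN' (by norm_num)]
        nlinarith [Real.pi_pos]
      refine le_trans ?_ (Real.mul_le_sin (by positivity) hx)
      have e : 2 / Real.pi * (Real.pi * ((k : ℕ) : ℝ) / N) = 2 * (k : ℕ) / N := by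
        have := Real.pi_pos.ne'
        field_simp
      rw [e, div_le_div_iff₀ (by norm_num) hN']
      linarith
    have hmin : (N : ℝ) / 4 ≤ min ((k : ℕ) : ℝ) (N - (k : ℕ)) := le_min (by linarith) (by linarith)
    have := mul_le_mul hs (mul_le_mul_of_nonneg_left hmin hr) (by positivity) (by linarith)
    linarith
  have hcard : (N : ℝ) / 8 ≤ T.card := by
    have : N / 2 - N / 4 - 1 ≤ T.card := by
      have hsub : (Finset.Icc (N / 4 + 1) (N / 2)) ⊆
          T.image fun k : ↥(Finset.Ioo 0 N) => (k : ℕ) := by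
        intro m hm
        rw [Finset.mem_Icc] at hm
        refine Finset.mem_image.2 ⟨(⟨m, by rw [Finset.mem_Ioo]; omega⟩ : ↥(Finset.Ioo 0 N)), ?_, rfl⟩
        rw [hT, Finset.mem_filter]
        refine ⟨Finset.mem_univ _, ?_, ?_⟩ <;> dsimp only <;> omega
      have := (Finset.card_le_card hsub).trans Finset.card_image_le
      rw [Nat.card_Icc] at this
      omega
    have h8 : N ≤ 8 * T.card := by omega
    have : (N : ℝ) ≤ 8 * (T.card : ℝ) := by exact_mod_cast h8
    linarith
  calc r / 64 * (N : ℝ) ^ 2 = (N / 8 : ℝ) * (r * N / 8) := by ring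
    _ ≤ T.card * (r * N / 8) := mul_le_mul_of_nonneg_right hcard (by positivity)
    _ = T.card • (r * N / 8) := by rw [nsmul_eq_mul]
    _ ≤ ∑ k ∈ T, sinW N k * (r * min ((k : ℕ) : ℝ) (N - (k : ℕ))) :=
        Finset.card_nsmul_le_sum _ _ _ term
    _ ≤ tentMode N r :=
        Finset.sum_le_univ_sum_of_nonneg nonneg

/-- Cauchy–Schwarz over the sites, without using any independence. The resulting order `N ^ 3` is
the one that the dynamics preserves. -/
lemma IsTentLaw.sineSum_variance {ν : Measure (Omega N)} (hν : IsTentLaw V am ap r S ν)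
    (hS : 0 ≤ S) :
    ∫⁻ x, ENNReal.ofReal ((sineSum x - tentMode N r) ^ 2) ∂ν ≤
      ENNReal.ofReal (S * (N : ℝ) ^ 3) := by
  have pw : ∀ x : Omega N, ENNReal.ofReal ((sineSum x - tentMode N r) ^ 2) ≤
      ENNReal.ofReal N * ∑ k : ↥(Finset.Ioo 0 N),
        ENNReal.ofReal ((x k - r * min ((k : ℕ) : ℝ) (N - (k : ℕ))) ^ 2) := by
    intro x
    rw [← ENNReal.ofReal_sum_of_nonneg fun _ _ => sq_nonneg _,
      ← ENNReal.ofReal_mul (Nat.cast_nonneg _)]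
    apply ENNReal.ofReal_le_ofReal
    rw [sineSum, tentMode, ← Finset.sum_sub_distrib]
    refine sq_sum_le_card_mul_sum_sq.trans ?_
    rw [Finset.card_univ, card_sites]
    refine mul_le_mul (by exact_mod_cast Nat.sub_le N 1) (Finset.sum_le_sum fun k _ => ?_)
      (Finset.sum_nonneg fun _ _ => sq_nonneg _) (Nat.cast_nonneg _)
    rw [← mul_sub, mul_pow]
    have : sinW N k ^ 2 ≤ 1 := (sq_le_one_iff_abs_le_one _).2 (abs_sinW_le N k)
    nlinarith [sq_nonneg (x k - r * min ((k : ℕ) : ℝ) (N - (k : ℕ)))]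
  refine (lintegral_mono pw).trans ?_
  have hmk : ∀ k : ↥(Finset.Ioo 0 N), Measurable fun x : Omega N =>
      ENNReal.ofReal ((x k - r * min ((k : ℕ) : ℝ) (N - (k : ℕ))) ^ 2) := fun k => by fun_prop
  rw [lintegral_const_mul _ (Finset.measurable_sum _ fun k _ => hmk k),
    lintegral_finsetSum _ fun k _ => hmk k]
  refine (mul_le_mul_right (Finset.sum_le_sum fun k _ => hν.variance k) _).trans ?_
  rw [Finset.sum_const, Finset.card_univ, card_sites, nsmul_eq_mul, ← ENNReal.ofReal_natCast,
    ← ENNReal.ofReal_mul (Nat.cast_nonneg _), ← ENNReal.ofReal_mul (Nat.cast_nonneg _)]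
  apply ENNReal.ofReal_le_ofReal
  have h1 : ((N - 1 : ℕ) : ℝ) ≤ N := by exact_mod_cast Nat.sub_le N 1
  have h0 : (0 : ℝ) ≤ N := N.cast_nonneg
  calc (N : ℝ) * (((N - 1 : ℕ) : ℝ) * (S * N)) ≤ N * (N * (S * N)) := by gcongr
    _ = S * (N : ℝ) ^ 3 := by ring

/-- The lowest mode is concentrated around its mean along the evolution from a tent law. -/
theorem exists_sineSum_variance (h : Coercive V κ C K)
    (hm : Coercive (fun x => V x - am * x) κm Cm Km)
    (hp : Coercive (fun x => V x - ap * x) κp Cp Kp) (hS : 0 ≤ S) :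
    ∃ B ≥ 0, ∀ (N : ℕ) (ν : Measure (Omega N)), 3 ≤ N → IsTentLaw V am ap r S ν → ∀ n : ℕ,
      ∫⁻ x, ENNReal.ofReal
        ((sineSum x - (1 - lam N / ((N - 1 : ℕ) : ℝ)) ^ n * tentMode N r) ^ 2)
          ∂evolve (siteMap V) n ν ≤ ENNReal.ofReal (B * (N : ℝ) ^ 3) := by
  obtain ⟨M, hM, hmom⟩ := h.exists_increment_moments hm hp 2
  -- `S` covers the initial variance. One update adds noise at most `4 * M` and contracts by `1 - q`
  -- with `q * N ^ 3 ≥ 2`, so the term `2 * M` makes the bound self-reproducing.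
  refine ⟨S + 2 * M, by positivity, fun N ν hN hν => ?_⟩
  have hN2 : 2 ≤ N := by omega
  have hνp := hν.isProbabilityMeasure
  have := nonempty_sites hN2
  have hmeas := fun i => h.measurable_siteMap (N := N) i
  set q := lam N / ((N - 1 : ℕ) : ℝ) with hq
  have hN0 : (0 : ℝ) < N := by exact_mod_cast (by omega : 0 < N)
  have hN1 : (0 : ℝ) < ((N - 1 : ℕ) : ℝ) := by exact_mod_cast (by omega : 0 < N - 1)
  have hq1 : q ≤ 1 := lam_div_le_one hN
  have hq0 : 0 < q := div_pos (lam_pos hN2) hN1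
  have hqge : 2 ≤ q * (N : ℝ) ^ 3 := by
    have h1 := lam_ge hN2
    rw [div_le_iff₀ (by positivity)] at h1
    have h2 : ((N - 1 : ℕ) : ℝ) ≤ N := by exact_mod_cast Nat.sub_le N 1
    have h3 : q * ((N - 1 : ℕ) : ℝ) = lam N := div_mul_cancel₀ _ hN1.ne'
    calc (2 : ℝ) ≤ lam N * (N : ℝ) ^ 2 := h1
      _ = q * ((N - 1 : ℕ) : ℝ) * (N : ℝ) ^ 2 := by rw [h3]
      _ ≤ q * N * (N : ℝ) ^ 2 := by gcongr
      _ = q * (N : ℝ) ^ 3 := by ring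
  intro n
  induction n with
  | zero =>
    rw [pow_zero, one_mul, evolve_zero]
    refine (hν.sineSum_variance hS).trans (ENNReal.ofReal_le_ofReal ?_)
    nlinarith [mul_nonneg hM (pow_nonneg hN0.le 3)]
  | succ n ih =>
    have hpn := isProbabilityMeasure_evolve hmeas n ν
    set F := (1 - q) ^ n * tentMode N r with hF
    have hF' : (1 - q) ^ (n + 1) * tentMode N r = (1 - q) * F := by rw [hF]; ring
    have hsm := measurable_sineSum (N := N)
    have hmF : ∀ G : ℝ, Measurable fun x : Omega N => ENNReal.ofReal ((sineSum x - G) ^ 2) :=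
      fun G => by fun_prop
    rw [hF', evolve_succ, lintegral_step hmeas _ (hmF _)]
    refine (lintegral_mono fun x => h.stepOp_sineSum_sq_le hN2 F x).trans ?_
    rw [← hq]
    have e1 : ∀ x : Omega N, ENNReal.ofReal ((1 - q) ^ 2 * (sineSum x - F) ^ 2) =
        ENNReal.ofReal ((1 - q) ^ 2) * ENNReal.ofReal ((sineSum x - F) ^ 2) := fun x =>
      ENNReal.ofReal_mul (sq_nonneg _)
    simp_rw [e1]
    rw [lintegral_add_left ((hmF F).const_mul _), lintegral_const_mul _ (hmF F)]
    have hdm : ∀ k : ↥(Finset.Ioo 0 N), Measurable fun x : Omega N =>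
        ∫⁻ u, ENNReal.ofReal ((siteMap V k x u k - x k) ^ 2) ∂unif := by
      intro k
      have m1 : Measurable fun p : Omega N × ℝ => siteMap V k p.1 p.2 k :=
        (measurable_pi_apply k).comp (hmeas k)
      have m2 : Measurable fun p : Omega N × ℝ =>
          ENNReal.ofReal ((siteMap V k p.1 p.2 k - p.1 k) ^ 2) := by fun_prop
      exact m2.lintegral_prod_right'
    have noise : ∫⁻ x, (((N - 1 : ℕ) : ℝ≥0∞))⁻¹ *
        ∑ k, ∫⁻ u, ENNReal.ofReal ((siteMap V k x u k - x k) ^ 2) ∂unif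
          ∂evolve (siteMap V) n ν ≤ ENNReal.ofReal (4 * M) := by
      rw [lintegral_const_mul _ (Finset.measurable_sum _ fun k _ => hdm k),
        lintegral_finsetSum _ fun k _ => hdm k]
      have each : ∀ k : ↥(Finset.Ioo 0 N), ∫⁻ x, ∫⁻ u,
          ENNReal.ofReal ((siteMap V k x u k - x k) ^ 2) ∂unif ∂evolve (siteMap V) n ν ≤
            ENNReal.ofReal (4 * M) := by
        intro k
        have hk := Finset.mem_Ioo.1 k.2
        have hmo := hmom N r S ν hN2 hν n (k - 1) (by omega)
        rw [Nat.sub_add_cancel hk.1] at hmo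
        exact lintegral_displacement_le h k hM hmo.1 (hmo.2 k)
      refine (mul_le_mul_right (Finset.sum_le_sum fun k _ => each k) _).trans_eq ?_
      rw [Finset.sum_const, Finset.card_univ, card_sites, nsmul_eq_mul, ← mul_assoc,
        ENNReal.inv_mul_cancel (by exact_mod_cast (by omega : N - 1 ≠ 0)) (by simp), one_mul]
    refine (add_le_add (mul_le_mul_right ih _) noise).trans ?_
    rw [← ENNReal.ofReal_mul (sq_nonneg _), ← ENNReal.ofReal_add (by positivity) (by positivity)]
    apply ENNReal.ofReal_le_ofReal
    have hb : (1 - q) ^ 2 ≤ 1 - q := by nlinarith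
    have hBN : 0 ≤ (S + 2 * M) * (N : ℝ) ^ 3 := by positivity
    have h5 : 4 * M ≤ q * ((S + 2 * M) * (N : ℝ) ^ 3) := by
      have : q * ((S + 2 * M) * (N : ℝ) ^ 3) = S * (q * (N : ℝ) ^ 3) + 2 * M * (q * (N : ℝ) ^ 3) := by
        ring
      rw [this]
      nlinarith [mul_nonneg hS (show 0 ≤ q * (N : ℝ) ^ 3 by positivity),
        mul_le_mul_of_nonneg_left hqge hM]
    nlinarith [mul_le_mul_of_nonneg_right hb hBN]

/-- Chebyshev bound for the lowest mode. -/
lemma measure_sineSum_le_of_variance {μ : Measure (Omega N)} {F B s : ℝ} (hs : 0 < s)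
    (hv : ∫⁻ x, ENNReal.ofReal ((sineSum x - F) ^ 2) ∂μ ≤ ENNReal.ofReal B) :
    μ {x | s ≤ |sineSum x - F|} ≤ ENNReal.ofReal (B / s ^ 2) := by
  have hsm := measurable_sineSum (N := N)
  have hmF : Measurable fun x : Omega N => ENNReal.ofReal ((sineSum x - F) ^ 2) := by fun_prop
  have h3 := mul_meas_ge_le_lintegral (μ := μ) hmF (ENNReal.ofReal (s ^ 2))
  have sp : 0 < s ^ 2 := by positivity
  have sub : {x : Omega N | s ≤ |sineSum x - F|} ⊆
      {x | ENNReal.ofReal (s ^ 2) ≤ ENNReal.ofReal ((sineSum x - F) ^ 2)} := fun x hx => by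
    refine ENNReal.ofReal_le_ofReal ?_
    rw [← sq_abs (sineSum x - F)]
    exact pow_le_pow_left₀ hs.le hx 2
  refine (measure_mono sub).trans ?_
  rw [ENNReal.ofReal_div_of_pos sp, ENNReal.le_div_iff_mul_le
    (Or.inl (by simpa using hs.ne')) (Or.inl ENNReal.ofReal_ne_top), mul_comm]
  exact h3.trans hv

/-- The lowest mode is of order `N ^ (3/2)` at equilibrium. -/
lemma gibbs_sineSum_tail (h : Coercive V κ C K) (hN : 3 ≤ N) {ν : Measure (Omega N)}
    (hν : IsTentLaw V am ap r S ν) {B : ℝ}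
    (hv : ∀ n : ℕ, ∫⁻ x, ENNReal.ofReal
        ((sineSum x - (1 - lam N / ((N - 1 : ℕ) : ℝ)) ^ n * tentMode N r) ^ 2)
          ∂evolve (siteMap V) n ν ≤ ENNReal.ofReal (B * (N : ℝ) ^ 3)) {s : ℝ} (hs : 0 < s) :
    gibbs V N {x | 2 * s + 1 ≤ sineSum x} ≤ ENNReal.ofReal (B * (N : ℝ) ^ 3 / s ^ 2) := by
  have hN2 : 2 ≤ N := by omega
  have hνp := hν.isProbabilityMeasure
  refine gibbs_tail_le h hN2 hν.bound measurable_sineSum (A := 1) zero_le_one ?_ ?_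
  · intro x y
    rw [one_mul, sineSum, sineSum, ← Finset.sum_sub_distrib]
    refine (Finset.abs_sum_le_sum_abs _ _).trans ?_
    have e : ∀ k : ↥(Finset.Ioo 0 N), |sinW N k * x k - sinW N k * y k| ≤
        (fun m : ℕ => |height x m - height y m|) k := by
      intro k
      simp only [height_coe]
      rw [← mul_sub, abs_mul]
      exact mul_le_of_le_one_left (abs_nonneg _) (abs_sinW_le N k)
    refine (Finset.sum_le_sum fun k _ => e k).trans ?_
    rw [Finset.sum_coe_sort (Finset.Ioo 0 N) fun m : ℕ => |height x m - height y m|]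
    refine Finset.sum_le_sum_of_subset_of_nonneg (fun m hm => ?_) fun _ _ _ => abs_nonneg _
    rw [Finset.mem_Ioo] at hm
    exact Finset.mem_range.2 (by omega)
  · have hN1 : (0 : ℝ) < ((N - 1 : ℕ) : ℝ) := by exact_mod_cast (by omega : 0 < N - 1)
    have hq0 : 0 < lam N / ((N - 1 : ℕ) : ℝ) := div_pos (lam_pos hN2) hN1
    have hlim : Tendsto (fun n : ℕ => (1 - lam N / ((N - 1 : ℕ) : ℝ)) ^ n * tentMode N r) atTop
        (𝓝 (0 * tentMode N r)) :=
      (tendsto_pow_atTop_nhds_zero_of_lt_one (by linarith [lam_div_le_one hN])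
        (by linarith)).mul_const _
    rw [zero_mul] at hlim
    filter_upwards [hlim.eventually (gt_mem_nhds hs)] with n hn
    refine (measure_mono fun x hx => ?_).trans (measure_sineSum_le_of_variance hs (hv n))
    rw [mem_ofPred_eq] at hx ⊢
    exact le_trans (by linarith) (le_abs_self _)

end GradPhi
end

/-! ### The Poisson number of updates and the lower bound on the mixing time. -/

noncomputable section
namespace GradPhi

variable {V : ℝ → ℝ} {κ C κm Cm κp Cp am ap r S : ℝ} {K Km Kp N : ℕ}

lemma poisW_nonneg {m : ℝ} (hm : 0 ≤ m) (n : ℕ) : 0 ≤ poisW m n := by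
  unfold poisW; positivity

lemma hasSum_poisW_mul_pow (m a : ℝ) :
    HasSum (fun n => poisW m n * a ^ n) (Real.exp (m * (a - 1))) := by
  have h := (NormedSpace.expSeries_div_hasSum_exp (m * a)).mul_left (Real.exp (-m))
  rw [← Real.exp_eq_exp_ℝ, ← Real.exp_add] at h
  rw [show m * (a - 1) = -m + m * a by ring]
  refine h.congr_fun fun n => ?_
  rw [poisW, mul_pow]; ring

lemma tsum_poisW {m : ℝ} (hm : 0 ≤ m) : ∑' n, ENNReal.ofReal (poisW m n) = 1 := by
  have h := hasSum_poisW_mul_pow m 1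
  simp only [one_pow, mul_one, sub_self, mul_zero, Real.exp_zero] at h
  rw [← ENNReal.ofReal_tsum_of_nonneg (poisW_nonneg hm) h.summable, h.tsum_eq, ENNReal.ofReal_one]

/-- Chernoff bounds for the Poisson law, for both tails. -/
lemma poisson_tail {m : ℝ} (hm : 0 ≤ m) (θ b : ℝ) :
    ∑' n : ℕ, (if θ * b ≤ θ * n then ENNReal.ofReal (poisW m n) else 0) ≤
      ENNReal.ofReal (Real.exp (-(θ * b) + m * (Real.exp θ - 1))) := by
  have h := (hasSum_poisW_mul_pow m (Real.exp θ)).mul_left (Real.exp (-(θ * b)))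
  rw [← Real.exp_add] at h
  have hnn : ∀ n, 0 ≤ Real.exp (-(θ * b)) * (poisW m n * Real.exp θ ^ n) := fun n =>
    mul_nonneg (Real.exp_pos _).le (mul_nonneg (poisW_nonneg hm n) (by positivity))
  rw [← h.tsum_eq, ENNReal.ofReal_tsum_of_nonneg hnn h.summable]
  refine ENNReal.tsum_le_tsum fun n => ?_
  split_ifs with hn
  · apply ENNReal.ofReal_le_ofReal
    rw [mul_left_comm, ← Real.exp_nat_mul, ← Real.exp_add]
    refine le_mul_of_one_le_right (poisW_nonneg hm n) (Real.one_le_exp ?_)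
    linarith
  · exact zero_le

lemma Coercive.isProbabilityMeasure_law (h : Coercive V κ C K) (hN : 2 ≤ N) (t : ℝ≥0)
    (x : Omega N) : IsProbabilityMeasure (law V N t x) := by
  have := nonempty_sites hN
  constructor
  rw [h.law_apply hN t x MeasurableSet.univ]
  have e : ∀ n, evolve (siteMap V) n (Measure.dirac x) univ = 1 := fun n => by
    have := isProbabilityMeasure_evolve h.measurable_siteMap n (Measure.dirac x)
    exact measure_univ
  simp_rw [e, mul_one]
  exact tsum_poisW (by positivity)

lemma Coercive.evolve_dirac_apply (h : Coercive V κ C K) (hN : 2 ≤ N) (n : ℕ) (x : Omega N)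
    {s : Set (Omega N)} (hs : MeasurableSet s) :
    evolve (siteMap V) n (Measure.dirac x) s =
      (stepOp (siteMap V))^[n] (s.indicator fun _ => 1) x := by
  have := nonempty_sites hN
  have hm : Measurable (s.indicator fun _ : Omega N => (1 : ℝ≥0∞)) :=
    measurable_const.indicator hs
  have hmeas := fun i => h.measurable_siteMap (N := N) i
  have h1 := lintegral_evolve hmeas (Measure.dirac x) n hm
  rw [lintegral_indicator_const hs, one_mul,
    lintegral_dirac' _ (measurable_iterate_stepOp hmeas hm n)] at h1
  exact h1

lemma Coercive.measurable_law_apply (h : Coercive V κ C K) (hN : 2 ≤ N) (t : ℝ≥0)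
    {s : Set (Omega N)} (hs : MeasurableSet s) : Measurable fun x => law V N t x s := by
  have hm : Measurable (s.indicator fun _ : Omega N => (1 : ℝ≥0∞)) :=
    measurable_const.indicator hs
  simp_rw [h.law_apply hN t _ hs, h.evolve_dirac_apply hN _ _ hs]
  exact Measurable.tsum fun n => (measurable_iterate_stepOp
    (fun i => h.measurable_siteMap (N := N) i) hm n).const_mul _

/-- The mean over the initial condition of the law at time `t`. -/
lemma Coercive.lintegral_law_apply (h : Coercive V κ C K) (hN : 2 ≤ N) (t : ℝ≥0)
    (ν : Measure (Omega N)) [IsProbabilityMeasure ν] {s : Set (Omega N)} (hs : MeasurableSet s) :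
    ∫⁻ x, law V N t x s ∂ν = ∑' n, ENNReal.ofReal (poisW (((N - 1 : ℕ) : ℝ) * t) n) *
      evolve (siteMap V) n ν s := by
  have := nonempty_sites hN
  have hm : Measurable (s.indicator fun _ : Omega N => (1 : ℝ≥0∞)) :=
    measurable_const.indicator hs
  have hmeas := fun i => h.measurable_siteMap (N := N) i
  simp_rw [h.law_apply hN t _ hs, h.evolve_dirac_apply hN _ _ hs]
  rw [lintegral_tsum fun n => ((measurable_iterate_stepOp hmeas hm n).const_mul _).aemeasurable]
  congr 1
  ext n
  rw [lintegral_const_mul _ (measurable_iterate_stepOp hmeas hm n),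
    ← lintegral_evolve hmeas ν n hm, lintegral_indicator_const hs, one_mul]

lemma exp_neg_two_mul_le {q : ℝ} (hq : 0 ≤ q) (hq1 : q ≤ 1 / 2) : Real.exp (-(2 * q)) ≤ 1 - q := by
  rw [Real.exp_neg, inv_le_comm₀ (Real.exp_pos _) (by linarith)]
  refine le_trans ?_ (Real.add_one_le_exp _)
  rw [inv_le_iff_one_le_mul₀ (by linarith)]
  nlinarith

/-- A lower bound on the distance to equilibrium from concentration of the lowest mode. -/
lemma le_worstDist_of_sineSum (h : Coercive V κ C K) (hN : 3 ≤ N) {ν : Measure (Omega N)}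
    (hν : IsTentLaw V am ap r S ν) {B s : ℝ} (hB : 0 ≤ B) (hs : 1 ≤ s)
    (hv : ∀ n : ℕ, ∫⁻ x, ENNReal.ofReal
        ((sineSum x - (1 - lam N / ((N - 1 : ℕ) : ℝ)) ^ n * tentMode N r) ^ 2)
          ∂evolve (siteMap V) n ν ≤ ENNReal.ofReal (B * (N : ℝ) ^ 3))
    {t : ℝ≥0} {m : ℝ} (ht : ((N - 1 : ℕ) : ℝ) * t ≤ m / 2)
    (hm : ∀ n : ℕ, (n : ℝ) ≤ m → 4 * s ≤ (1 - lam N / ((N - 1 : ℕ) : ℝ)) ^ n * tentMode N r) :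
    ENNReal.ofReal (1 - (2 * (B * (N : ℝ) ^ 3 / s ^ 2) + Real.exp (-(m / 10)))) ≤
      worstDist V N t := by
  have hN2 : 2 ≤ N := by omega
  have hνp := hν.isProbabilityMeasure
  have := nonempty_sites hN2
  have hs0 : 0 < s := by linarith
  set E := B * (N : ℝ) ^ 3 / s ^ 2 with hE
  have hE0 : 0 ≤ E := by positivity
  -- The separating event: it is unlikely at equilibrium, and likely for the chain, whose mode is
  -- within `s` of a mean at least `4 * s`; `1 ≤ s` provides the room `4 * s - s ≥ 2 * s + 1`.
  set A : Set (Omega N) := {x | 2 * s + 1 ≤ sineSum x} with hA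
  have hAm : MeasurableSet A := measurableSet_le measurable_const measurable_sineSum
  have hπ : gibbs V N A ≤ ENNReal.ofReal E := gibbs_sineSum_tail h hN hν hv hs0
  set μ := ((N - 1 : ℕ) : ℝ) * (t : ℝ) with hμ
  have hμ0 : 0 ≤ μ := by positivity
  have hmean : ∫⁻ x, law V N t x Aᶜ ∂ν ≤
      ENNReal.ofReal E + ENNReal.ofReal (Real.exp (-(m / 10))) := by
    rw [h.lintegral_law_apply hN2 t ν hAm.compl]
    have hterm : ∀ n : ℕ, ENNReal.ofReal (poisW μ n) * evolve (siteMap V) n ν Aᶜ ≤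
        ENNReal.ofReal (poisW μ n) * ENNReal.ofReal E +
          if Real.log 2 * m ≤ Real.log 2 * n then ENNReal.ofReal (poisW μ n) else 0 := by
      intro n
      have hpn := isProbabilityMeasure_evolve (fun i => h.measurable_siteMap (N := N) i) n ν
      split_ifs with hn
      · refine le_trans ?_ le_add_self
        exact mul_le_of_le_one_right zero_le prob_le_one
      · rw [add_zero]
        refine mul_le_mul_right ?_ _
        have hn' : (n : ℝ) ≤ m := by
          by_contra hcon
          exact hn (mul_le_mul_of_nonneg_left (not_le.1 hcon).le
            (Real.log_nonneg (by norm_num)))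
        refine (measure_mono fun x hx => ?_).trans (measure_sineSum_le_of_variance hs0 (hv n))
        have hx' : sineSum x < 2 * s + 1 := not_le.1 hx
        have h4 := hm n hn'
        rw [mem_ofPred_eq, abs_sub_comm]
        exact le_trans (by linarith) (le_abs_self _)
    refine (ENNReal.tsum_le_tsum hterm).trans ?_
    rw [ENNReal.tsum_add, ENNReal.tsum_mul_right, tsum_poisW hμ0, one_mul]
    -- The Poisson mean is at most `m / 2`, so the exponent is at most `-(log 2 - 1 / 2) * m`, which
    -- is below `-m / 10`.
    refine add_le_add le_rfl ((poisson_tail hμ0 (Real.log 2) m).trans ?_)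
    apply ENNReal.ofReal_le_ofReal (Real.exp_le_exp.2 _)
    rw [Real.exp_log (by norm_num)]
    have := Real.log_two_gt_d9
    have hm0 : 0 ≤ m := by linarith
    nlinarith
  -- Passage from the random tent to a fixed initial condition: some admissible starting point does
  -- at least as well as the average.
  obtain ⟨x, hx, hxle⟩ := exists_notMem_null_le_lintegral (μ := ν)
    (h.measurable_law_apply hN2 t hAm.compl).aemeasurable (ae_iff.1 hν.bound)
  rw [mem_ofPred_eq, not_not] at hx
  have hlp := h.isProbabilityMeasure_law hN2 t x
  refine le_trans ?_ (le_iSup₂_of_le x hx (le_iSup₂_of_le A hAm le_rfl))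
  have hc := prob_compl_eq_one_sub (μ := law V N t x) hAm.compl
  rw [compl_compl] at hc
  rw [hc]
  have h3 := hxle.trans hmean
  rw [← ENNReal.ofReal_add hE0 (Real.exp_pos _).le] at h3
  refine le_trans ?_ (tsub_le_tsub (tsub_le_tsub_left h3 1) hπ)
  rw [← ENNReal.ofReal_one, ← ENNReal.ofReal_sub _ (by positivity), ← ENNReal.ofReal_sub _ hE0]
  apply ENNReal.ofReal_le_ofReal
  linarith

/-- The mode starts at order `N ^ 2` and fluctuates at order at most `N ^ (3/2)`; the threshold `s`
of order `N ^ (7/4)` lies strictly between. By time `τ = log N / (16 λ_N)` there are at most `2 (N -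
1) τ` updates, up to a negligible probability. Each multiplies the mean by `1 - q ≥ exp (-2 q)`, so
the total loss is at most a factor `N ^ (-1/4)`. -/
theorem lower_bound (h : Coercive V κ C K)
    (hm : Coercive (fun x => V x - am * x) κm Cm Km)
    (hp : Coercive (fun x => V x - ap * x) κp Cp Kp) (hle : am ≤ ap)
    (hm0 : ∫ x, x * bondW V am x < 0) (hp0 : 0 < ∫ x, x * bondW V ap x) {ε : ℝ}
    (hε1 : ε < 1) :
    ∃ N₀ : ℕ, ∀ N ≥ N₀,
      ENNReal.ofReal (1 / 16 / lam N * Real.log N) ≤ mixingTime V N ε := by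
  obtain ⟨r, hr, S, hS, N₁, hN₁⟩ := exists_isTentLaw hm hp hle hm0 hp0
  obtain ⟨B, hB, hvar⟩ := exists_sineSum_variance (r := r) h hm hp hS
  set a := r / 256 with ha
  have ha0 : 0 < a := by positivity
  have lim1 : Tendsto (fun x : ℝ => 2 * (B / a ^ 2 * x ^ (-(1 / 2) : ℝ)) + Real.exp (-(x / 320)))
      atTop (𝓝 (2 * (B / a ^ 2 * 0) + 0)) := by
    refine (((tendsto_rpow_neg_atTop (by norm_num)).const_mul _).const_mul _).add ?_
    exact Real.tendsto_exp_neg_atTop_nhds_zero.comp (tendsto_id.atTop_div_const (by norm_num))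
  rw [mul_zero, mul_zero, add_zero] at lim1
  have lim2 : Tendsto (fun x : ℝ => a * x ^ (7 / 4 : ℝ)) atTop atTop :=
    (tendsto_rpow_atTop (by norm_num)).const_mul_atTop ha0
  have ev := ((lim1.eventually (ge_mem_nhds (show (0 : ℝ) < 1 - ε by linarith))).and
    (lim2.eventually_ge_atTop 1)).natCast_atTop
  obtain ⟨N₂, hN₂⟩ := eventually_atTop.1 ev
  refine ⟨max (max N₁ N₂) 16, fun N hN => ?_⟩
  have hNN1 : N₁ ≤ N := by omega
  have hNN2 : N₂ ≤ N := by omega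
  have hN16 : 16 ≤ N := by omega
  obtain ⟨ν, hν⟩ := hN₁ N hNN1
  obtain ⟨hA, hB'⟩ := hN₂ N hNN2
  have hN16' : (16 : ℝ) ≤ N := by exact_mod_cast hN16
  have hN0 : (0 : ℝ) < N := by linarith
  have hN1e : ((N - 1 : ℕ) : ℝ) = N - 1 := by
    rw [Nat.cast_sub (by omega)]; simp
  have hN1 : (0 : ℝ) < ((N - 1 : ℕ) : ℝ) := by rw [hN1e]; linarith
  have hlog : 1 ≤ Real.log N := by
    rw [Real.le_log_iff_exp_le hN0]
    linarith [Real.exp_one_lt_d9]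
  have hlam := lam_pos (N := N) (by omega)
  have hlam2 := lam_le_two N
  refine le_iInf₂ fun t ht => ?_
  by_contra hcon
  rw [not_le, ← ENNReal.ofReal_coe_nnreal] at hcon
  replace hcon := (ENNReal.ofReal_lt_ofReal_iff_of_nonneg t.2).1 hcon
  refine absurd ht (not_lt.2 ?_)
  set τ := 1 / 16 / lam N * Real.log N with hτ
  set q := lam N / ((N - 1 : ℕ) : ℝ) with hq
  have hq0 : 0 < q := div_pos hlam hN1
  have hq2 : q ≤ 1 / 2 := by
    rw [hq, div_le_iff₀ hN1, hN1e]; linarith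
  set s := a * (N : ℝ) ^ (7 / 4 : ℝ) with hs
  have hqτ : 2 * q * (2 * ((N - 1 : ℕ) : ℝ) * τ) = 1 / 4 * Real.log N := by
    rw [hq, hτ]; field_simp; ring
  have key := le_worstDist_of_sineSum h (by omega) hν hB hB' (hvar N ν (by omega) hν) (t := t)
    (m := 2 * ((N - 1 : ℕ) : ℝ) * τ) (by
      have := mul_le_mul_of_nonneg_left hcon.le hN1.le
      exact this.trans_eq (by ring)) (by
      intro n hn
      have h1 : (N : ℝ) ^ (-(1 / 4) : ℝ) ≤ (1 - q) ^ n := by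
        have e1 := pow_le_pow_left₀ (Real.exp_pos _).le (exp_neg_two_mul_le hq0.le hq2) n
        refine le_trans ?_ e1
        rw [← Real.exp_nat_mul, Real.rpow_def_of_pos hN0]
        apply Real.exp_le_exp.2
        have := mul_le_mul_of_nonneg_left hn (show 0 ≤ 2 * q by positivity)
        linarith
      have h2 := tentMode_ge hr.le hN16
      have h3 : 4 * s = (N : ℝ) ^ (-(1 / 4) : ℝ) * (r / 64 * (N : ℝ) ^ 2) := by
        have e : (N : ℝ) ^ (-(1 / 4) : ℝ) * (N : ℝ) ^ 2 = (N : ℝ) ^ (7 / 4 : ℝ) := by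
          rw [← Real.rpow_natCast (N : ℝ) 2, ← Real.rpow_add hN0]
          norm_num
        rw [hs, ha, ← e]; ring
      rw [h3]
      exact mul_le_mul h1 h2 (by positivity) (pow_nonneg (by linarith) n))
  refine le_trans (ENNReal.ofReal_le_ofReal ?_) key
  have e1 : B * (N : ℝ) ^ 3 / s ^ 2 = B / a ^ 2 * (N : ℝ) ^ (-(1 / 2) : ℝ) := by
    have : s ^ 2 = a ^ 2 * (N : ℝ) ^ (7 / 2 : ℝ) := by
      rw [hs, mul_pow, ← Real.rpow_natCast ((N : ℝ) ^ (7 / 4 : ℝ)) 2, ← Real.rpow_mul hN0.le]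
      norm_num
    rw [this, mul_div_mul_comm, ← Real.rpow_natCast (N : ℝ) 3, ← Real.rpow_sub hN0]
    norm_num
  have e2 : Real.exp (-(2 * ((N - 1 : ℕ) : ℝ) * τ / 10)) ≤ Real.exp (-((N : ℝ) / 320)) := by
    apply Real.exp_le_exp.2
    have hτ1 : 1 / 32 ≤ τ := by
      rw [hτ, div_div, div_mul_eq_mul_div, one_mul, div_le_div_iff₀ (by norm_num) (by positivity)]
      nlinarith
    rw [hN1e]
    have : (N - 1 : ℝ) * (1 / 32) ≤ (N - 1) * τ := mul_le_mul_of_nonneg_left hτ1 (by linarith)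
    linarith
  rw [e1]
  linarith

end GradPhi
end

/-! ### Continuity of the heat-bath law in total variation. -/

noncomputable section
namespace GradPhi

variable {V : ℝ → ℝ} {κ C : ℝ} {K N : ℕ}

/-- The slope over `[s, t]` lies between the slopes over the adjacent unit intervals, each at most
`2 * R` in absolute value. Thus polynomial growth of a convex function implies polynomial local
Lipschitz constants. -/
lemma ConvexOn.abs_sub_le_of_bound (hV : ConvexOn ℝ univ V) {s t R : ℝ} (hst : s < t)
    (h1 : |V (s - 1)| ≤ R) (h2 : |V s| ≤ R) (h3 : |V t| ≤ R) (h4 : |V (t + 1)| ≤ R) :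
    |V s - V t| ≤ 2 * R * (t - s) := by
  have a := hV.slope_mono_adjacent (mem_univ (s - 1)) (mem_univ t) (by linarith) hst
  have b := hV.slope_mono_adjacent (mem_univ s) (mem_univ (t + 1)) hst (by linarith)
  have hts : 0 < t - s := sub_pos.2 hst
  rw [show s - (s - 1) = 1 by ring, div_one, le_div_iff₀ hts] at a
  rw [show t + 1 - t = 1 by ring, div_one, div_le_iff₀ hts] at b
  rw [abs_le] at *
  constructor <;> nlinarith

lemma Coercive.abs_sub_le (h : Coercive V κ C K) {s t : ℝ} (hst : |s - t| ≤ 1) :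
    |V s - V t| ≤ 2 * (C * (3 + |s|) ^ K) * |s - t| := by
  have bd : ∀ z, |z - s| ≤ 2 → |V z| ≤ C * (3 + |s|) ^ K := by
    intro z hz
    refine (h.growth z).trans (mul_le_mul_of_nonneg_left ?_ h.cpos.le)
    refine pow_le_pow_left₀ (by positivity) ?_ K
    have := abs_add_le (z - s) s
    rw [sub_add_cancel] at this
    linarith
  have hst' := abs_le.1 hst
  rcases lt_trichotomy s t with hlt | rfl | hlt
  · rw [abs_of_neg (sub_neg.2 hlt), neg_sub]
    apply ConvexOn.abs_sub_le_of_bound h.convex hlt <;> apply bd <;> rw [abs_le] <;>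
      constructor <;> linarith
  · simp
  · rw [abs_of_pos (sub_pos.2 hlt), abs_sub_comm]
    apply ConvexOn.abs_sub_le_of_bound h.convex hlt <;> apply bd <;> rw [abs_le] <;>
      constructor <;> linarith

/-- The moment controlling the continuity of the heat-bath law in the neighbouring heights. -/
def bathMoment (V : ℝ → ℝ) (K : ℕ) (b c : ℝ) : ℝ :=
  ∫ U, (5 + |Qt V b c U - b| + |c - Qt V b c U|) ^ K ∂unif

lemma Coercive.integrable_bath (h : Coercive V κ C K) (b c : ℝ) (n : ℕ) :
    Integrable (fun U => (5 + |Qt V b c U - b| + |c - Qt V b c U|) ^ n) unif := by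
  refine h.integrable_comp_Qt b c (g := fun u => (5 + |u - b| + |c - u|) ^ n) (by fun_prop)
    (B := (5 + |c - b|) ^ n) (n := n) fun u => ?_
  rw [abs_of_nonneg (by positivity), ← mul_pow]
  refine pow_le_pow_left₀ (by positivity) ?_ n
  have := abs_add_le (c - b) (b - u)
  rw [sub_add_sub_cancel, abs_sub_comm b u] at this
  nlinarith [abs_nonneg (u - b), abs_nonneg (c - b)]

lemma Coercive.one_le_bathMoment (h : Coercive V κ C K) (b c : ℝ) : 1 ≤ bathMoment V K b c := by
  have : ∫ _, (1 : ℝ) ∂unif ≤ bathMoment V K b c := by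
    refine integral_mono (integrable_const _) (h.integrable_bath b c K) fun U => ?_
    exact one_le_pow₀ (by linarith [abs_nonneg (Qt V b c U - b), abs_nonneg (c - Qt V b c U)])
  simpa using this

lemma one_sub_exp_le (x : ℝ) : 1 - Real.exp x ≤ |x| := by
  linarith [Real.add_one_le_exp x, neg_abs_le x]

/-- Comparison of two normalised densities, through the differences of the potentials. -/
lemma integral_dens_sub_le {φ φ' g : ℝ → ℝ} (hφ : Measurable φ) (hφ' : Measurable φ')
    (hw : Integrable fun u => Real.exp (-φ u)) (hw' : Integrable fun u => Real.exp (-φ' u))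
    (hg : Measurable g) (hg0 : ∀ u, 0 ≤ g u) (hg1 : ∀ u, g u ≤ 1) {E : ℝ}
    (hi : Integrable (fun u => |φ' u - φ u|) (dens fun u => Real.exp (-φ u)))
    (hi' : Integrable (fun u => |φ' u - φ u|) (dens fun u => Real.exp (-φ' u)))
    (hE : ∫ u, |φ' u - φ u| ∂(dens fun u => Real.exp (-φ u)) ≤ E)
    (hE' : ∫ u, |φ' u - φ u| ∂(dens fun u => Real.exp (-φ' u)) ≤ E) :
    ∫ u, g u ∂(dens fun u => Real.exp (-φ' u)) ≤
      ∫ u, g u ∂(dens fun u => Real.exp (-φ u)) + E := by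
  -- When the normalisation of `φ'` is the larger one, it can be discarded after the change of
  -- density, and `1 - exp x ≤ |x|` finishes. In the other case the roles of the densities are
  -- exchanged and `g` is replaced by `1 - g`.
  have one_side : ∀ (φ φ' g : ℝ → ℝ), Measurable φ → Measurable φ' →
      Integrable (fun u => Real.exp (-φ u)) → Integrable (fun u => Real.exp (-φ' u)) →
      Measurable g → (∀ u, 0 ≤ g u) → (∀ u, g u ≤ 1) →
      Integrable (fun u => |φ' u - φ u|) (dens fun u => Real.exp (-φ' u)) →
      ∫ u, |φ' u - φ u| ∂(dens fun u => Real.exp (-φ' u)) ≤ E →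
      ∫ u, Real.exp (-φ u) ≤ ∫ u, Real.exp (-φ' u) →
      ∫ u, g u ∂(dens fun u => Real.exp (-φ' u)) ≤
        ∫ u, g u ∂(dens fun u => Real.exp (-φ u)) + E := by
    intro φ φ' g hφ hφ' hw hw' hg hg0 hg1 hi' hE' hZ
    have hm : Measurable fun u => Real.exp (-φ u) := by fun_prop
    have hm' : Measurable fun u => Real.exp (-φ' u) := by fun_prop
    have hp : ∀ u, 0 < Real.exp (-φ u) := fun u => Real.exp_pos _
    have hp' : ∀ u, 0 < Real.exp (-φ' u) := fun u => Real.exp_pos _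
    have hZ0 := integral_pos_of_pos hw hp
    have hZ0' := integral_pos_of_pos hw' hp'
    have := isProbabilityMeasure_dens hw' hp'
    have hgi : ∀ {w : ℝ → ℝ}, Integrable w → Integrable fun u => g u * w u := fun hw =>
      hw.bdd_mul hg.aestronglyMeasurable (c := 1) (ae_of_all _ fun u => by
        rw [Real.norm_eq_abs, abs_of_nonneg (hg0 u)]; exact hg1 u)
    have hgd : Integrable g (dens fun u => Real.exp (-φ' u)) :=
      integrable_dens hm' hp' (hgi hw')
    -- change of density
    have hcd : ∫ u, g u * Real.exp (φ' u - φ u) ∂(dens fun u => Real.exp (-φ' u)) ≤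
        ∫ u, g u ∂(dens fun u => Real.exp (-φ u)) := by
      rw [integral_dens hm' hp', integral_dens hm hp]
      have e : ∀ u, g u * Real.exp (φ' u - φ u) * Real.exp (-φ' u) = g u * Real.exp (-φ u) := by
        intro u
        rw [mul_assoc, ← Real.exp_add]; ring_nf
      simp_rw [e]
      exact div_le_div_of_nonneg_left (integral_nonneg fun u => mul_nonneg (hg0 u) (hp u).le)
        hZ0 hZ
    have hci : Integrable (fun u => g u * Real.exp (φ' u - φ u))
        (dens fun u => Real.exp (-φ' u)) := by
      refine integrable_dens hm' hp' ((hgi hw).congr (ae_of_all _ fun u => ?_))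
      simp only
      rw [mul_assoc, ← Real.exp_add]; ring_nf
    have hle : ∫ u, g u ∂(dens fun u => Real.exp (-φ' u)) ≤
        ∫ u, (g u * Real.exp (φ' u - φ u) + |φ' u - φ u|) ∂(dens fun u => Real.exp (-φ' u)) := by
      refine integral_mono hgd (hci.add hi') fun u => ?_
      have h1 := one_sub_exp_le (φ' u - φ u)
      have h2 := mul_le_mul_of_nonneg_left h1 (hg0 u)
      have h3 := mul_le_mul_of_nonneg_right (hg1 u) (abs_nonneg (φ' u - φ u))
      simp only
      nlinarith
    rw [integral_add hci hi'] at hle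
    linarith
  rcases le_total (∫ u, Real.exp (-φ u)) (∫ u, Real.exp (-φ' u)) with hZ | hZ
  · exact one_side φ φ' g hφ hφ' hw hw' hg hg0 hg1 hi' hE' hZ
  · have hp : ∀ u, 0 < Real.exp (-φ u) := fun u => Real.exp_pos _
    have hp' : ∀ u, 0 < Real.exp (-φ' u) := fun u => Real.exp_pos _
    have := isProbabilityMeasure_dens hw hp
    have := isProbabilityMeasure_dens hw' hp'
    have hgd : ∀ (μ : Measure ℝ) [IsProbabilityMeasure μ], Integrable g μ := fun μ _ =>
      Integrable.of_bound hg.aestronglyMeasurable 1 (ae_of_all _ fun u => by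
        rw [Real.norm_eq_abs, abs_of_nonneg (hg0 u)]; exact hg1 u)
    have := one_side φ' φ (fun u => 1 - g u) hφ' hφ hw' hw (by fun_prop)
      (fun u => by linarith [hg1 u]) (fun u => by linarith [hg0 u])
      (by simpa only [abs_sub_comm] using hi) (by simpa only [abs_sub_comm] using hE) hZ
    rw [integral_sub (integrable_const _) (hgd _), integral_sub (integrable_const _) (hgd _)] at this
    simp only [integral_const, probReal_univ, smul_eq_mul, one_mul] at this
    linarith

lemma Coercive.abs_potential_sub_le (h : Coercive V κ C K) {b c b' c' : ℝ} (hb : |b - b'| ≤ 1)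
    (hc : |c - c'| ≤ 1) (u : ℝ) :
    |(V (u - b') + V (c' - u)) - (V (u - b) + V (c - u))| ≤
      2 * C * (|b - b'| + |c - c'|) * (3 + |u - b| + |c - u|) ^ K := by
  have h1 := h.abs_sub_le (s := u - b) (t := u - b') (by
    rw [sub_sub_sub_cancel_left, abs_sub_comm]; exact hb)
  have h2 := h.abs_sub_le (s := c - u) (t := c' - u) (by rw [sub_sub_sub_cancel_right]; exact hc)
  rw [sub_sub_sub_cancel_left, abs_sub_comm b'] at h1
  rw [sub_sub_sub_cancel_right] at h2
  have m1 : (3 + |u - b|) ^ K ≤ (3 + |u - b| + |c - u|) ^ K :=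
    pow_le_pow_left₀ (by positivity) (by linarith [abs_nonneg (c - u)]) K
  have m2 : (3 + |c - u|) ^ K ≤ (3 + |u - b| + |c - u|) ^ K :=
    pow_le_pow_left₀ (by positivity) (by linarith [abs_nonneg (u - b)]) K
  have hC := h.cpos
  calc |(V (u - b') + V (c' - u)) - (V (u - b) + V (c - u))|
      = |-(V (u - b) - V (u - b')) + -(V (c - u) - V (c' - u))| := by congr 1; ring
    _ ≤ |V (u - b) - V (u - b')| + |V (c - u) - V (c' - u)| := by
        refine (abs_add_le _ _).trans_eq ?_
        rw [abs_neg, abs_neg]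
    _ ≤ 2 * (C * (3 + |u - b|) ^ K) * |b - b'| + 2 * (C * (3 + |c - u|) ^ K) * |c - c'| :=
        add_le_add h1 h2
    _ ≤ 2 * (C * (3 + |u - b| + |c - u|) ^ K) * |b - b'| +
        2 * (C * (3 + |u - b| + |c - u|) ^ K) * |c - c'| := by gcongr
    _ = _ := by ring

/-- The heat-bath law depends on the neighbours in a Lipschitz way, in total variation. -/
lemma Coercive.lintegral_Qt_le (h : Coercive V κ C K) (b c b' c' : ℝ) {G : ℝ → ℝ≥0∞}
    (hG : Measurable G) (hG1 : ∀ u, G u ≤ 1) :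
    ∫⁻ U, G (Qt V b' c' U) ∂unif ≤ ∫⁻ U, G (Qt V b c U) ∂unif +
      ENNReal.ofReal ((2 * C + 1) * bathMoment V K b c * (|b - b'| + |c - c'|)) := by
  have hM := h.one_le_bathMoment b c
  have hC := h.cpos
  by_cases hbc : |b - b'| ≤ 1 ∧ |c - c'| ≤ 1
  swap
  -- If a neighbour moves by more than one, the error term alone exceeds one.
  · have h1 : 1 ≤ |b - b'| + |c - c'| := by
      rw [not_and_or, not_le, not_le] at hbc
      rcases hbc with h | h
      · linarith [abs_nonneg (c - c')]
      · linarith [abs_nonneg (b - b')]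
    refine le_trans ?_ le_add_self
    refine le_trans (b := 1) ?_ ?_
    · refine (lintegral_mono fun U => hG1 _).trans ?_
      simp
    · rw [ENNReal.one_le_ofReal]
      have : 1 ≤ (2 * C + 1) * bathMoment V K b c := by nlinarith
      nlinarith
  obtain ⟨hb, hc⟩ := hbc
  set e := |b - b'| + |c - c'| with he
  have he0 : 0 ≤ e := by positivity
  set g : ℝ → ℝ := fun u => (G u).toReal with hg
  have hgm : Measurable g := hG.ennreal_toReal
  have hg0 : ∀ u, 0 ≤ g u := fun u => ENNReal.toReal_nonneg
  have hg1 : ∀ u, g u ≤ 1 := fun u => by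
    have := ENNReal.toReal_mono (by simp) (hG1 u)
    simpa using this
  have hGg : ∀ u, G u = ENNReal.ofReal (g u) := fun u =>
    (ENNReal.ofReal_toReal ((hG1 u).trans_lt (by simp)).ne).symm
  have conv : ∀ b c, ∫⁻ U, G (Qt V b c U) ∂unif =
      ENNReal.ofReal (∫ u, g u ∂dens (wt V b c)) := by
    intro b c
    have := h.prob b c
    rw [h.lintegral_Qt b c hG]
    simp_rw [hGg]
    refine (ofReal_integral_eq_lintegral_ofReal ?_ (ae_of_all _ hg0)).symm
    exact Integrable.of_bound hgm.aestronglyMeasurable 1 (ae_of_all _ fun u => by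
        rw [Real.norm_eq_abs, abs_of_nonneg (hg0 u)]; exact hg1 u)
  have hint : ∀ b c, 0 ≤ ∫ u, g u ∂dens (wt V b c) := fun b c => integral_nonneg hg0
  rw [conv, conv, ← ENNReal.ofReal_add (hint _ _) (by positivity)]
  apply ENNReal.ofReal_le_ofReal
  have hmV := h.meas
  set φ : ℝ → ℝ := fun u => V (u - b) + V (c - u) with hφ
  set φ' : ℝ → ℝ := fun u => V (u - b') + V (c' - u) with hφ'
  have ew : wt V b c = fun u => Real.exp (-φ u) := by
    ext u; simp only [wt, hφ]; ring_nf
  have ew' : wt V b' c' = fun u => Real.exp (-φ' u) := by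
    ext u; simp only [wt, hφ']; ring_nf
  have hdiff : ∀ u, |φ' u - φ u| ≤ 2 * C * e * (3 + |u - b| + |c - u|) ^ K :=
    fun u => h.abs_potential_sub_le hb hc u
  have hφm : Measurable φ := by fun_prop
  have hφm' : Measurable φ' := by fun_prop
  -- transfer to the uniform variable
  have key : ∀ b₁ c₁ : ℝ, |b - b₁| ≤ 1 → |c - c₁| ≤ 1 →
      Integrable (fun u => |φ' u - φ u|) (dens (wt V b₁ c₁)) ∧
        ∫ u, |φ' u - φ u| ∂dens (wt V b₁ c₁) ≤ (2 * C + 1) * bathMoment V K b c * e := by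
    intro b₁ c₁ hb₁ hc₁
    rw [abs_le] at hb₁ hc₁
    have hQm := h.measurable_Qt' b₁ c₁
    have hdm : Measurable fun u => |φ' u - φ u| := by fun_prop
    have hpt : ∀ U, |φ' (Qt V b₁ c₁ U) - φ (Qt V b₁ c₁ U)| ≤
        2 * C * e * (5 + |Qt V b c U - b| + |c - Qt V b c U|) ^ K := by
      intro U
      refine (hdiff _).trans (mul_le_mul_of_nonneg_left ?_ (by positivity))
      -- Monotonicity and translation move the value by at most one, so each of the two distances
      -- grows by at most one. This raises the constant from `3` to the `5` of `bathMoment`, and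
      -- lets the moment at `(b, c)` control both densities.
      have q1 := h.Qt_mono (b := b + -1) (c := c + -1) (b' := b₁) (c' := c₁) (by linarith)
        (by linarith) U
      have q2 := h.Qt_mono (b := b₁) (c := c₁) (b' := b + 1) (c' := c + 1) (by linarith)
        (by linarith) U
      rw [h.Qt_shift] at q1 q2
      have hd : |Qt V b₁ c₁ U - Qt V b c U| ≤ 1 := abs_le.2 ⟨by linarith, by linarith⟩
      refine pow_le_pow_left₀ (by positivity) ?_ K
      have a1 := abs_add_le (Qt V b₁ c₁ U - Qt V b c U) (Qt V b c U - b)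
      have a2 := abs_add_le (c - Qt V b c U) (Qt V b c U - Qt V b₁ c₁ U)
      rw [sub_add_sub_cancel] at a1 a2
      rw [abs_sub_comm (Qt V b c U) (Qt V b₁ c₁ U)] at a2
      linarith
    have hbi := (h.integrable_bath b c K).const_mul (2 * C * e)
    have hui : Integrable (fun U => |φ' (Qt V b₁ c₁ U) - φ (Qt V b₁ c₁ U)|) unif :=
      hbi.mono' (hdm.comp hQm).aestronglyMeasurable (ae_of_all _ fun U => by
        rw [Real.norm_eq_abs, abs_abs]; exact hpt U)
    rw [← h.map_Qt b₁ c₁]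
    constructor
    · exact (integrable_map_measure hdm.aestronglyMeasurable hQm.aemeasurable).2 hui
    · rw [integral_map hQm.aemeasurable hdm.aestronglyMeasurable]
      refine (integral_mono hui hbi hpt).trans ?_
      rw [integral_const_mul]
      change 2 * C * e * bathMoment V K b c ≤ _
      nlinarith [mul_nonneg he0 (zero_le_one.trans hM)]
  obtain ⟨hi, hE⟩ := key b c (by simp) (by simp)
  obtain ⟨hi', hE'⟩ := key b' c' hb hc
  have hw := h.integrable_wt b c
  have hw' := h.integrable_wt b' c'
  rw [ew] at hi hE hw ⊢
  rw [ew'] at hi' hE' hw' ⊢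
  exact integral_dens_sub_le hφm hφm' hw hw' hgm hg0 hg1 hi hi' hE hE'

end GradPhi
end

/-! ### Accumulated costs, bad sites and the count of disagreements. -/

noncomputable section
namespace GradPhi

variable {V : ℝ → ℝ} {κ C : ℝ} {K N : ℕ}

section Accumulated
variable {ι α : Type*} [Fintype ι]

/-- The expected accumulated cost of `m` steps of the chain. -/
def accumulated (Φ : ι → α → ℝ → α) (b : α → ℝ≥0∞) : ℕ → α → ℝ≥0∞
  | 0 => fun _ => 0
  | m + 1 => fun x => b x + stepOp Φ (accumulated Φ b m) x

lemma measurable_accumulated [MeasurableSpace α] {Φ : ι → α → ℝ → α}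
    (hΦ : ∀ i, Measurable fun p : α × ℝ => Φ i p.1 p.2) {b : α → ℝ≥0∞} (hb : Measurable b)
    (m : ℕ) : Measurable (accumulated Φ b m) := by
  induction m with
  | zero => exact measurable_const
  | succ m ih => exact hb.add (measurable_stepOp hΦ ih)

lemma lintegral_accumulated [MeasurableSpace α] {Φ : ι → α → ℝ → α}
    (hΦ : ∀ i, Measurable fun p : α × ℝ => Φ i p.1 p.2) {b : α → ℝ≥0∞} (hb : Measurable b)
    {μ : Measure α} [SFinite μ] (hμ : step Φ μ = μ) (m : ℕ) :
    ∫⁻ x, accumulated Φ b m x ∂μ = m * ∫⁻ x, b x ∂μ := by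
  induction m with
  | zero => simp [accumulated]
  | succ m ih =>
    simp only [accumulated]
    rw [lintegral_add_left hb, ← lintegral_step hΦ μ (measurable_accumulated hΦ hb m), hμ, ih]
    push_cast; ring

lemma stepOp_le_one [Nonempty ι] {Φ : ι → α → ℝ → α} {f : α → ℝ≥0∞} (hf : ∀ x, f x ≤ 1) (x : α) :
    stepOp Φ f x ≤ 1 := by
  have h1 : ∀ i, ∫⁻ u, f (Φ i x u) ∂unif ≤ 1 := fun i =>
    (lintegral_mono fun u => hf _).trans (by simp)
  refine (mul_le_mul_right (Finset.sum_le_sum fun i _ => h1 i) _).trans ?_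
  rw [Finset.sum_const, Finset.card_univ, nsmul_eq_mul, mul_one]
  exact ENNReal.inv_mul_le_one _

lemma iterate_stepOp_le_one [Nonempty ι] {Φ : ι → α → ℝ → α} {f : α → ℝ≥0∞} (hf : ∀ x, f x ≤ 1)
    (m : ℕ) (x : α) : (stepOp Φ)^[m] f x ≤ 1 := by
  induction m generalizing x with
  | zero => exact hf x
  | succ m ih =>
    rw [Function.iterate_succ_apply']
    exact stepOp_le_one ih x

end Accumulated

/-- The fraction of sites where the heat-bath moment is large. -/
def badFrac (V : ℝ → ℝ) (K : ℕ) (L : ℝ) (y : Omega N) : ℝ≥0∞ :=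
  (Fintype.card ↥(Finset.Ioo 0 N) : ℝ≥0∞)⁻¹ * ∑ k : ↥(Finset.Ioo 0 N),
    {y : Omega N | L ≤ bathMoment V K (height y (k - 1)) (height y (k + 1))}.indicator 1 y

lemma Coercive.measurable_bathMoment (h : Coercive V κ C K) :
    Measurable fun p : ℝ × ℝ => bathMoment V K p.1 p.2 := by
  have hQ := h.measurable_Qt
  have hm : Measurable fun q : (ℝ × ℝ) × ℝ =>
      (5 + |Qt V q.1.1 q.1.2 q.2 - q.1.1| + |q.1.2 - Qt V q.1.1 q.1.2 q.2|) ^ K := by fun_prop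
  exact (StronglyMeasurable.integral_prod_right (f := fun p : ℝ × ℝ => fun U =>
    (5 + |Qt V p.1 p.2 U - p.1| + |p.2 - Qt V p.1 p.2 U|) ^ K) hm.stronglyMeasurable).measurable

lemma Coercive.measurableSet_bathMoment (h : Coercive V κ C K) (L : ℝ) (k : ℕ) :
    MeasurableSet {y : Omega N | L ≤ bathMoment V K (height y (k - 1)) (height y (k + 1))} := by
  have hp : Measurable fun y : Omega N => (height y (k - 1), height y (k + 1)) :=
    (measurable_height _).prodMk (measurable_height _)
  have hm := h.measurable_bathMoment.comp hp
  exact measurableSet_le measurable_const hm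

lemma Coercive.measurable_badFrac (h : Coercive V κ C K) (L : ℝ) :
    Measurable (badFrac (N := N) V K L) := by
  unfold badFrac
  refine Measurable.const_mul (Finset.measurable_sum _ fun k _ => ?_) _
  exact measurable_one.indicator (h.measurableSet_bathMoment L k)

/-- The number of sites where two configurations with difference `d` disagree. -/
def supportCard (d : Omega N) : ℝ≥0∞ := ∑ k, if d k = 0 then 0 else 1

lemma supportCard_le (d : Omega N) : supportCard d ≤ N := by
  refine (Finset.sum_le_card_nsmul _ _ 1 fun k _ => ?_).trans ?_
  · split_ifs <;> simp
  · rw [Finset.card_univ, card_sites, nsmul_eq_mul, mul_one]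
    exact_mod_cast Nat.sub_le N 1

lemma one_le_supportCard {d : Omega N} (hd : d ≠ 0) : 1 ≤ supportCard d := by
  obtain ⟨k, hk⟩ := Function.ne_iff.1 hd
  refine le_trans ?_ (Finset.single_le_sum (f := fun k => if d k = 0 then (0 : ℝ≥0∞) else 1)
    (fun _ _ => zero_le) (Finset.mem_univ k))
  simp only [Pi.zero_apply, ne_eq] at hk
  simp [hk]

/-- Each disagreement is erased by exactly one of the `N - 1` possible updates. -/
lemma sum_supportCard_update (d : Omega N) :
    ∑ k, supportCard (Function.update d k 0) = ((N - 2 : ℕ) : ℝ≥0∞) * supportCard d := by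
  unfold supportCard
  rw [Finset.sum_comm, Finset.mul_sum]
  refine Finset.sum_congr rfl fun j _ => ?_
  have e : ∀ k, (if Function.update d k 0 j = 0 then (0 : ℝ≥0∞) else 1) =
      if k = j then 0 else if d j = 0 then 0 else 1 := by
    intro k
    by_cases hk : k = j
    · subst hk; simp
    · simp [hk, Function.update_of_ne (Ne.symm hk)]
  simp_rw [e]
  rw [Finset.sum_ite, Finset.sum_const_zero, zero_add, Finset.sum_const, Finset.filter_ne',
    Finset.card_erase_of_mem (Finset.mem_univ j), Finset.card_univ, card_sites, nsmul_eq_mul,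
    Nat.sub_sub]

lemma update_add_update (y d : Omega N) (k : ↥(Finset.Ioo 0 N)) (v : ℝ) :
    Function.update (y + d) k v = Function.update y k v + Function.update d k 0 := by
  ext j
  by_cases hj : j = k
  · subst hj; simp
  · simp [Function.update_of_ne hj]

lemma sum_abs_neighbours_le (d : Omega N) :
    ∑ k : ↥(Finset.Ioo 0 N), (|height d (k - 1)| + |height d (k + 1)|) ≤ 2 * ∑ k, |d k| := by
  have e : ∑ k, |d k| = ∑ i ∈ Finset.range (N - 1), |height d (i + 1)| := by
    rw [← sum_sites_eq fun k => |height d k|]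
    simp only [height_coe]
  rw [Finset.sum_add_distrib, e, two_mul, sum_sites_eq fun k => |height d (k - 1)|,
    sum_sites_eq fun k => |height d (k + 1)|]
  simp only [Nat.add_sub_cancel]
  rcases Nat.eq_zero_or_pos (N - 1) with h0 | h0
  · simp [h0]
  obtain ⟨m, hm⟩ : ∃ m, N - 1 = m + 1 := ⟨N - 2, by omega⟩
  rw [hm]
  refine add_le_add ?_ ?_
  · rw [Finset.sum_range_succ', Finset.sum_range_succ]
    simp only [height_zero, abs_zero, add_zero]
    linarith [abs_nonneg (height d (m + 1))]
  · rw [Finset.sum_range_succ, Finset.sum_range_succ']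
    have : height d (m + 1 + 1) = 0 := height_of_le d (by omega)
    rw [this, abs_zero, add_zero]
    linarith [abs_nonneg (height d (0 + 1))]

end GradPhi
end

/-! ### Smoothing: small differences become agreement. -/

noncomputable section
namespace GradPhi

variable {V : ℝ → ℝ} {κ C : ℝ} {K N : ℕ}

/-- Translating the starting point of an update changes the expectations by at most the total
variation between the two heat-bath laws. -/
lemma Coercive.lintegral_siteMap_add_le (h : Coercive V κ C K) (L : ℝ) (y d : Omega N)
    (k : ↥(Finset.Ioo 0 N)) {f : Omega N → ℝ≥0∞} (hf : Measurable f) (hf1 : ∀ x, f x ≤ 1) :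
    ∫⁻ u, f (siteMap V k (y + d) u) ∂unif ≤
      ∫⁻ u, f (siteMap V k y u + Function.update d k 0) ∂unif +
      ({y : Omega N | L ≤ bathMoment V K (height y (k - 1)) (height y (k + 1))}.indicator 1 y +
        ENNReal.ofReal ((2 * C + 1) * L * (|height d (k - 1)| + |height d (k + 1)|))) := by
  by_cases hy : L ≤ bathMoment V K (height y (k - 1)) (height y (k + 1))
  · refine le_trans (b := 1) ((lintegral_mono fun u => hf1 _).trans (by simp)) ?_
    refine le_trans ?_ le_add_self
    refine le_trans ?_ le_self_add
    rw [indicator_of_mem (by exact hy)]; rfl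
  · have hG : Measurable fun v => f (Function.update (y + d) k v) :=
      hf.comp (measurable_update _)
    have hmain := h.lintegral_Qt_le (height y (k - 1)) (height y (k + 1))
      (height (y + d) (k - 1)) (height (y + d) (k + 1)) hG fun v => hf1 _
    have e : ∀ i, |height y i - height (y + d) i| = |height d i| := fun i => by
      rw [height_add, sub_add_cancel_left, abs_neg]
    rw [e, e] at hmain
    refine hmain.trans (add_le_add (le_of_eq ?_) (le_trans ?_ le_add_self))
    · refine lintegral_congr fun u => ?_
      rw [update_add_update]; rfl
    · apply ENNReal.ofReal_le_ofReal
      have hC := h.cpos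
      exact mul_le_mul_of_nonneg_right (mul_le_mul_of_nonneg_left (not_le.1 hy).le (by positivity))
        (by positivity)

/-- Smoothing: the dependence of the `m`-step transition probabilities on the starting point. -/
theorem Coercive.iterate_stepOp_add_le (h : Coercive V κ C K) (hN : 2 ≤ N) {L : ℝ} (hL : 0 ≤ L)
    {B : Set (Omega N)} (hB : MeasurableSet B) (m : ℕ) (y d : Omega N) :
    (stepOp (siteMap V))^[m] (B.indicator 1) (y + d) ≤
      (stepOp (siteMap V))^[m] (B.indicator 1) y +
      m * ENNReal.ofReal (2 * (2 * C + 1) * L / ((N - 1 : ℕ) : ℝ) * ∑ k, |d k|) +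
      accumulated (siteMap V) (badFrac V K L) m y +
      supportCard d * (((N - 1 : ℕ) : ℝ≥0∞)⁻¹ * ((N - 2 : ℕ) : ℝ≥0∞)) ^ m := by
  have hne := nonempty_sites hN
  have hC := h.cpos
  have hN1 : (0 : ℝ) < ((N - 1 : ℕ) : ℝ) := by exact_mod_cast (by omega : 0 < N - 1)
  have hmeas := fun i => h.measurable_siteMap (N := N) i
  have hBm : Measurable (B.indicator (1 : Omega N → ℝ≥0∞)) := measurable_one.indicator hB
  have hB1 : ∀ x, B.indicator (1 : Omega N → ℝ≥0∞) x ≤ 1 := fun x =>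
    indicator_le_self' (fun _ _ => zero_le) x
  have hbad := h.measurable_badFrac (N := N) L
  set a : ℝ := 2 * (2 * C + 1) * L / ((N - 1 : ℕ) : ℝ) with ha
  have ha0 : 0 ≤ a := by positivity
  set ρ : ℝ≥0∞ := ((N - 1 : ℕ) : ℝ≥0∞)⁻¹ * ((N - 2 : ℕ) : ℝ≥0∞) with hρ
  -- The difference `d` is fixed and the update is drawn at `y`: after paying the total variation
  -- cost at the site `k`, the shifted configuration differs from the updated `y` by `d` with its
  -- `k`-th entry set to zero. Hence `∑ |d k|` never grows, the cost per step stays bounded by the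
  -- initial one plus the bad sites met by the chain from `y`, and the final term counts the sites
  -- never updated.
  induction m generalizing y d with
  | zero =>
    by_cases hd : d = 0
    · subst hd
      rw [add_zero]
      exact le_self_add.trans (le_self_add.trans le_self_add)
    · simp only [Function.iterate_zero, id, pow_zero, mul_one]
      exact ((hB1 _).trans (one_le_supportCard hd)).trans le_add_self
  | succ m ih =>
    set g := (stepOp (siteMap V))^[m] (B.indicator (1 : Omega N → ℝ≥0∞)) with hg
    have hgm : Measurable g := measurable_iterate_stepOp hmeas hBm m
    have hg1 : ∀ x, g x ≤ 1 := iterate_stepOp_le_one hB1 m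
    have hacc := measurable_accumulated hmeas hbad m
    set A : ℝ≥0∞ := ENNReal.ofReal (a * ∑ k, |d k|) with hA
    set bad : ↥(Finset.Ioo 0 N) → ℝ≥0∞ := fun k =>
      {y : Omega N | L ≤ bathMoment V K (height y (k - 1)) (height y (k + 1))}.indicator 1 y
      with hbaddef
    set τ : ↥(Finset.Ioo 0 N) → ℝ≥0∞ := fun k =>
      ENNReal.ofReal ((2 * C + 1) * L * (|height d (k - 1)| + |height d (k + 1)|)) with hτ
    have site : ∀ k, ∫⁻ u, g (siteMap V k (y + d) u) ∂unif ≤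
        (∫⁻ u, g (siteMap V k y u) ∂unif) + m * A +
          (∫⁻ u, accumulated (siteMap V) (badFrac V K L) m (siteMap V k y u) ∂unif) +
          supportCard (Function.update d k 0) * ρ ^ m + (bad k + τ k) := by
      intro k
      refine (h.lintegral_siteMap_add_le L y d k hgm hg1).trans (add_le_add ?_ le_rfl)
      have mu : Measurable fun u => siteMap V k y u :=
        (hmeas k).comp (f := fun u => (y, u)) (by fun_prop)
      have hAk : ENNReal.ofReal (a * ∑ j, |Function.update d k 0 j|) ≤ A := by
        apply ENNReal.ofReal_le_ofReal
        refine mul_le_mul_of_nonneg_left (Finset.sum_le_sum fun j _ => ?_) ha0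
        by_cases hj : j = k
        · subst hj; simp
        · rw [Function.update_of_ne hj]
      refine (lintegral_mono fun u => (ih (siteMap V k y u) (Function.update d k 0)).trans
        (add_le_add (add_le_add (add_le_add le_rfl (mul_le_mul_right hAk _)) le_rfl) le_rfl)).trans
          (le_of_eq ?_)
      have hau : Measurable fun u => accumulated (siteMap V) (badFrac V K L) m (siteMap V k y u) :=
        hacc.comp mu
      rw [lintegral_add_right _ measurable_const, lintegral_add_right _ hau,
        lintegral_add_right _ measurable_const, lintegral_const, lintegral_const]
      simp
    have hsum := Finset.sum_le_sum fun k (_ : k ∈ Finset.univ) => site k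
    have hstep := mul_le_mul_right hsum (Fintype.card ↥(Finset.Ioo 0 N) : ℝ≥0∞)⁻¹
    rw [Function.iterate_succ_apply']
    refine hstep.trans ?_
    simp only [Finset.sum_add_distrib, mul_add]
    have e1 : (Fintype.card ↥(Finset.Ioo 0 N) : ℝ≥0∞)⁻¹ *
        ∑ _k : ↥(Finset.Ioo 0 N), (m : ℝ≥0∞) * A = m * A := by
      rw [Finset.sum_const, Finset.card_univ, card_sites, nsmul_eq_mul, ← mul_assoc,
        ENNReal.inv_mul_cancel (by exact_mod_cast (by omega : N - 1 ≠ 0)) (by simp), one_mul]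
    have e2 : (Fintype.card ↥(Finset.Ioo 0 N) : ℝ≥0∞)⁻¹ *
        ∑ k, supportCard (Function.update d k 0) * ρ ^ m = supportCard d * ρ ^ (m + 1) := by
      rw [← Finset.sum_mul, sum_supportCard_update, card_sites, pow_succ, hρ]
      ring
    have e3 : (Fintype.card ↥(Finset.Ioo 0 N) : ℝ≥0∞)⁻¹ * ∑ k, τ k ≤ A := by
      have hc : (Fintype.card ↥(Finset.Ioo 0 N) : ℝ≥0∞)⁻¹ =
          ENNReal.ofReal (((N - 1 : ℕ) : ℝ)⁻¹) := by
        rw [card_sites, ENNReal.ofReal_inv_of_pos hN1, ENNReal.ofReal_natCast]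
      rw [hc, hτ, ← ENNReal.ofReal_sum_of_nonneg fun k _ => by positivity,
        ← ENNReal.ofReal_mul (by positivity), ← Finset.mul_sum]
      apply ENNReal.ofReal_le_ofReal
      have := sum_abs_neighbours_le d
      calc ((N - 1 : ℕ) : ℝ)⁻¹ * ((2 * C + 1) * L *
            ∑ k : ↥(Finset.Ioo 0 N), (|height d (k - 1)| + |height d (k + 1)|))
          ≤ ((N - 1 : ℕ) : ℝ)⁻¹ * ((2 * C + 1) * L * (2 * ∑ k, |d k|)) := by gcongr
        _ = a * ∑ k, |d k| := by rw [ha]; field_simp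
    rw [e1, e2]
    have e4 : (((m + 1 : ℕ) : ℝ≥0∞)) * A = m * A + A := by push_cast; ring
    rw [e4]
    change _ ≤ stepOp (siteMap V) g y + (m * A + A) +
      (badFrac V K L y + stepOp (siteMap V) (accumulated (siteMap V) (badFrac V K L) m) y) + _
    have e5 : stepOp (siteMap V) g y = (Fintype.card ↥(Finset.Ioo 0 N) : ℝ≥0∞)⁻¹ *
      ∑ k, ∫⁻ u, g (siteMap V k y u) ∂unif := rfl
    have e6 : stepOp (siteMap V) (accumulated (siteMap V) (badFrac V K L) m) y =
      (Fintype.card ↥(Finset.Ioo 0 N) : ℝ≥0∞)⁻¹ *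
        ∑ k, ∫⁻ u, accumulated (siteMap V) (badFrac V K L) m (siteMap V k y u) ∂unif := rfl
    have e7 : badFrac V K L y = (Fintype.card ↥(Finset.Ioo 0 N) : ℝ≥0∞)⁻¹ * ∑ k, bad k := rfl
    rw [← e5, ← e6, ← e7]
    calc _ ≤ stepOp (siteMap V) g y + m * A +
          stepOp (siteMap V) (accumulated (siteMap V) (badFrac V K L) m) y +
          supportCard d * ρ ^ (m + 1) + (badFrac V K L y + A) := by gcongr
      _ = _ := by ring

end GradPhi
end

/-! ### Rarity of large heat-bath moments at equilibrium. -/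

noncomputable section
namespace GradPhi

variable {V : ℝ → ℝ} {κ C : ℝ} {K N : ℕ} {am ap κm Cm κp Cp : ℝ} {Km Kp : ℕ}

lemma add_add_pow_le {a b c : ℝ} (ha : 0 ≤ a) (hb : 0 ≤ b) (hc : 0 ≤ c) (n : ℕ) :
    (a + b + c) ^ n ≤ 3 ^ n * (a ^ n + b ^ n + c ^ n) := by
  have key : ∀ M, 0 ≤ M → a ≤ M → b ≤ M → c ≤ M → M ^ n ≤ a ^ n + b ^ n + c ^ n →
      (a + b + c) ^ n ≤ 3 ^ n * (a ^ n + b ^ n + c ^ n) := fun M _ h1 h2 h3 h4 => by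
    calc (a + b + c) ^ n ≤ (3 * M) ^ n := pow_le_pow_left₀ (by positivity) (by linarith) n
      _ = 3 ^ n * M ^ n := mul_pow _ _ _
      _ ≤ _ := by gcongr
  have pa := pow_nonneg ha n
  have pb := pow_nonneg hb n
  have pc := pow_nonneg hc n
  rcases le_total a b with hab | hab <;> rcases le_total b c with hbc | hbc <;>
    rcases le_total a c with hac | hac
  · exact key c hc hac hbc le_rfl (by linarith)
  · exact key c hc (hab.trans hbc) hbc le_rfl (by linarith)
  · exact key b hb hab le_rfl hbc (by linarith)
  · exact key b hb hab le_rfl hbc (by linarith)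
  · exact key c hc hac hbc le_rfl (by linarith)
  · exact key a ha le_rfl hab hac (by linarith)
  · exact key a ha le_rfl hab (hbc.trans hab) (by linarith)
  · exact key a ha le_rfl hab hac (by linarith)

/-- Markov's inequality inside the expectation: `t ≤ L / 2 + (2 / L) ^ i * t ^ (i + 1)`, since the
second term dominates `t` once `t > L / 2`. Higher moments thus turn into an arbitrary power of `1 /
L`. -/
lemma Coercive.one_le_of_le_bathMoment (h : Coercive V κ C K) {L : ℝ} (hL : 0 < L) (i : ℕ)
    {b c : ℝ} (hb : L ≤ bathMoment V K b c) :
    1 ≤ (2 / L) ^ (i + 1) *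
      ∫ U, (5 + |Qt V b c U - b| + |c - Qt V b c U|) ^ (K * (i + 1)) ∂unif := by
  have hi := h.integrable_bath b c (K * (i + 1))
  have h2L : 0 < 2 / L := by positivity
  have hle : bathMoment V K b c ≤ L / 2 + (2 / L) ^ i *
      ∫ U, (5 + |Qt V b c U - b| + |c - Qt V b c U|) ^ (K * (i + 1)) ∂unif := by
    rw [← integral_const_mul]
    have e : L / 2 = ∫ _, L / 2 ∂unif := by simp
    rw [e, ← integral_add (integrable_const _) (hi.const_mul _)]
    refine integral_mono (h.integrable_bath b c K) ((integrable_const _).add (hi.const_mul _))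
      fun U => ?_
    rw [pow_mul]
    set t := (5 + |Qt V b c U - b| + |c - Qt V b c U|) ^ K
    have ht0 : 0 ≤ t := by positivity
    have hs : (2 / L) ^ i * t ^ (i + 1) = t * (2 / L * t) ^ i := by rw [mul_pow]; ring
    rw [hs]
    rcases le_or_gt t (L / 2) with hle | hlt
    · have : 0 ≤ t * (2 / L * t) ^ i := by positivity
      linarith
    · have : 1 ≤ 2 / L * t := by
        rw [div_mul_eq_mul_div, le_div_iff₀ hL]; linarith
      have := le_mul_of_one_le_right ht0 (one_le_pow₀ this (n := i))
      linarith
  have : L / 2 ≤ (2 / L) ^ i *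
      ∫ U, (5 + |Qt V b c U - b| + |c - Qt V b c U|) ^ (K * (i + 1)) ∂unif := by linarith
  calc (1 : ℝ) = 2 / L * (L / 2) := by field_simp
    _ ≤ 2 / L * _ := mul_le_mul_of_nonneg_left this h2L.le
    _ = _ := by ring

/-- Sites with a large heat-bath moment are rare at equilibrium. -/
lemma exists_lintegral_badFrac_le (h : Coercive V κ C K)
    (hm : Coercive (fun x => V x - am * x) κm Cm Km)
    (hp : Coercive (fun x => V x - ap * x) κp Cp Kp) (i : ℕ) :
    ∃ M ≥ 0, ∀ (N : ℕ) (r S : ℝ) (ν : Measure (Omega N)), 2 ≤ N → IsTentLaw V am ap r S ν →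
      ∀ L > 0, ∫⁻ y, badFrac V K L y ∂gibbs V N ≤ ENNReal.ofReal (M * (2 / L) ^ (i + 1)) := by
  set n := K * (i + 1) with hn
  obtain ⟨M, hM0, hM⟩ := exists_gibbs_moments h hm hp n
  refine ⟨3 ^ n * (5 ^ n + M + M), by positivity, fun N r S ν hN hν L hL => ?_⟩
  have hMj := (hM N r S ν hN hν).1
  have := nonempty_sites hN
  have := h.isProbabilityMeasure_gibbs hN
  have site : ∀ k : ↥(Finset.Ioo 0 N),
      gibbs V N {y | L ≤ bathMoment V K (height y (k - 1)) (height y (k + 1))} ≤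
        ENNReal.ofReal (3 ^ n * (5 ^ n + M + M) * (2 / L) ^ (i + 1)) := by
    intro k
    have hk := Finset.mem_Ioo.1 k.2
    -- The heat-bath moment at `k` is the mean of this local function after an update at `k`, so by
    -- invariance its equilibrium mean is a moment of two increments.
    set f : Omega N → ℝ≥0∞ := fun y => ENNReal.ofReal
      ((5 + |height y k - height y (k - 1)| + |height y (k + 1) - height y k|) ^ n) with hf
    have hfm : Measurable f := by
      have a := measurable_height (N := N) k
      have b := measurable_height (N := N) ((k : ℕ) - 1)
      have c := measurable_height (N := N) ((k : ℕ) + 1)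
      exact (((measurable_const.add (a.sub b).abs).add (c.sub a).abs).pow_const n).ennreal_ofReal
    have hpt : ∀ y : Omega N, L ≤ bathMoment V K (height y (k - 1)) (height y (k + 1)) →
        1 ≤ ENNReal.ofReal ((2 / L) ^ (i + 1)) * ∫⁻ u, f (siteMap V k y u) ∂unif := by
      intro y hy
      have h1 := h.one_le_of_le_bathMoment hL i hy
      have e : ∫⁻ u, f (siteMap V k y u) ∂unif = ENNReal.ofReal
          (∫ U, (5 + |Qt V (height y (k - 1)) (height y (k + 1)) U - height y (k - 1)| +
            |height y (k + 1) - Qt V (height y (k - 1)) (height y (k + 1)) U|) ^ n ∂unif) := by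
        rw [ofReal_integral_eq_lintegral_ofReal (h.integrable_bath _ _ n)
          (ae_of_all _ fun U => by positivity)]
        refine lintegral_congr fun u => ?_
        simp only [hf, siteMap, height_update]
        rw [Function.update_self, Function.update_of_ne (by omega),
          Function.update_of_ne (by omega)]
      rw [e, ← ENNReal.ofReal_mul (by positivity), ← ENNReal.ofReal_one]
      exact ENNReal.ofReal_le_ofReal h1
    have hfb : ∫⁻ y, f y ∂gibbs V N ≤ ENNReal.ofReal (3 ^ n * (5 ^ n + M + M)) := by
      have a : Measurable fun y : Omega N =>
          ENNReal.ofReal (|height y k - height y (k - 1)| ^ n) :=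
        (((measurable_height _).sub (measurable_height _)).abs.pow_const n).ennreal_ofReal
      have c : Measurable fun y : Omega N =>
          ENNReal.ofReal (|height y (k + 1) - height y k| ^ n) :=
        (((measurable_height _).sub (measurable_height _)).abs.pow_const n).ennreal_ofReal
      have ha := hMj ((k : ℕ) - 1) (by omega)
      have hc := hMj (k : ℕ) hk.2
      rw [Nat.sub_add_cancel hk.1] at ha
      calc ∫⁻ y, f y ∂gibbs V N
          ≤ ∫⁻ y, ENNReal.ofReal (3 ^ n) * (ENNReal.ofReal (5 ^ n) +
              ENNReal.ofReal (|height y k - height y (k - 1)| ^ n) +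
              ENNReal.ofReal (|height y (k + 1) - height y k| ^ n)) ∂gibbs V N := by
            refine lintegral_mono fun y => ?_
            rw [← ENNReal.ofReal_add (by positivity) (by positivity),
              ← ENNReal.ofReal_add (by positivity) (by positivity),
              ← ENNReal.ofReal_mul (by positivity)]
            exact ENNReal.ofReal_le_ofReal
              (add_add_pow_le (by norm_num) (abs_nonneg _) (abs_nonneg _) n)
        _ = ENNReal.ofReal (3 ^ n) * (ENNReal.ofReal (5 ^ n) +
              ∫⁻ y, ENNReal.ofReal (|height y k - height y (k - 1)| ^ n) ∂gibbs V N +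
              ∫⁻ y, ENNReal.ofReal (|height y (k + 1) - height y k| ^ n) ∂gibbs V N) := by
            have b : Measurable fun y : Omega N => ENNReal.ofReal (5 ^ n) +
                ENNReal.ofReal (|height y k - height y (k - 1)| ^ n) := measurable_const.add a
            have d : Measurable fun y : Omega N => ENNReal.ofReal (5 ^ n) +
                ENNReal.ofReal (|height y k - height y (k - 1)| ^ n) +
                ENNReal.ofReal (|height y (k + 1) - height y k| ^ n) := b.add c
            rw [lintegral_const_mul _ d, lintegral_add_right _ c, lintegral_add_right _ a, lintegral_const, measure_univ,
              mul_one]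
        _ ≤ _ := by
            rw [ENNReal.ofReal_mul (by positivity), ENNReal.ofReal_add (by positivity) hM0,
              ENNReal.ofReal_add (by positivity) hM0]
            gcongr
    have hs := h.measurableSet_bathMoment (N := N) L k
    calc gibbs V N {y | L ≤ bathMoment V K (height y (k - 1)) (height y (k + 1))}
        = ∫⁻ y, {y : Omega N | L ≤ bathMoment V K (height y (k - 1)) (height y (k + 1))}.indicator
            1 y ∂gibbs V N := (lintegral_indicator_one hs).symm
      _ ≤ ∫⁻ y, ENNReal.ofReal ((2 / L) ^ (i + 1)) * ∫⁻ u, f (siteMap V k y u) ∂unif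
            ∂gibbs V N := by
          refine lintegral_mono fun y => ?_
          by_cases hy : y ∈ {y : Omega N |
              L ≤ bathMoment V K (height y (k - 1)) (height y (k + 1))}
          · rw [indicator_of_mem hy]; exact hpt y hy
          · rw [indicator_of_notMem hy]; exact zero_le
      _ = ENNReal.ofReal ((2 / L) ^ (i + 1)) * ∫⁻ y, f y ∂gibbs V N := by
          rw [lintegral_const_mul _ (measurable_lintegral_unif (h.measurable_siteMap k) hfm),
            ← lintegral_siteStep (h.measurable_siteMap k) _ hfm, h.siteStep_gibbs hN k]
      _ ≤ _ := by
          rw [mul_comm, ENNReal.ofReal_mul (by positivity)]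
          exact mul_le_mul_left hfb _
  have hms : ∀ k : ↥(Finset.Ioo 0 N), Measurable fun y : Omega N =>
      {y : Omega N | L ≤ bathMoment V K (height y (k - 1)) (height y (k + 1))}.indicator
        (1 : Omega N → ℝ≥0∞) y := fun k =>
    measurable_one.indicator (h.measurableSet_bathMoment L k)
  unfold badFrac
  rw [lintegral_const_mul _ (Finset.measurable_sum _ fun k _ => hms k),
    lintegral_finsetSum _ fun k _ => hms k]
  refine (mul_le_mul_right (Finset.sum_le_sum fun (k : ↥(Finset.Ioo 0 N)) _ =>
    (lintegral_indicator_one (h.measurableSet_bathMoment L k)).le.trans (site k)) _).trans ?_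
  rw [Finset.sum_const, Finset.card_univ, nsmul_eq_mul, ← mul_assoc,
    ENNReal.inv_mul_cancel (Nat.cast_ne_zero.2 Fintype.card_ne_zero) (by simp), one_mul]

end GradPhi
end

/-! ### Convergence after a given number of updates: contraction, then smoothing. -/

noncomputable section
namespace GradPhi

variable {V : ℝ → ℝ} {κ C : ℝ} {K N : ℕ}

lemma untouched_ratio_pow_le (hN : 2 ≤ N) (m : ℕ) :
    (((N - 1 : ℕ) : ℝ≥0∞)⁻¹ * ((N - 2 : ℕ) : ℝ≥0∞)) ^ m ≤
      ENNReal.ofReal (Real.exp (-(m / ((N - 1 : ℕ) : ℝ)))) := by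
  have hN1 : (0 : ℝ) < ((N - 1 : ℕ) : ℝ) := by exact_mod_cast (by omega : 0 < N - 1)
  have e : ((N - 1 : ℕ) : ℝ≥0∞)⁻¹ * ((N - 2 : ℕ) : ℝ≥0∞) =
      ENNReal.ofReal (((N - 1 : ℕ) : ℝ)⁻¹ * ((N - 2 : ℕ) : ℝ)) := by
    rw [ENNReal.ofReal_mul (by positivity), ENNReal.ofReal_inv_of_pos hN1, ENNReal.ofReal_natCast,
      ENNReal.ofReal_natCast]
  rw [e, ← ENNReal.ofReal_pow (by positivity)]
  apply ENNReal.ofReal_le_ofReal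
  have h2 : ((N - 2 : ℕ) : ℝ) = ((N - 1 : ℕ) : ℝ) - 1 := by
    rw [show N - 2 = N - 1 - 1 by omega, Nat.cast_sub (by omega), Nat.cast_one]
  have h3 : ((N - 1 : ℕ) : ℝ)⁻¹ * ((N - 2 : ℕ) : ℝ) ≤ Real.exp (-((N - 1 : ℕ) : ℝ)⁻¹) := by
    have := Real.add_one_le_exp (-((N - 1 : ℕ) : ℝ)⁻¹)
    rw [h2, mul_sub, inv_mul_cancel₀ hN1.ne']
    linarith
  calc _ ≤ Real.exp (-((N - 1 : ℕ) : ℝ)⁻¹) ^ m := pow_le_pow_left₀ (by positivity) h3 m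
    _ = _ := by rw [← Real.exp_nat_mul]; congr 1; ring

/-- Convergence to equilibrium in the number of updates: contraction of the heights during the
first `n` updates, smoothing during the last `m`. -/
lemma Coercive.evolve_dirac_le (h : Coercive V κ C K) (hN : 2 ≤ N) {x : Omega N}
    (hx : ∀ k, |x k| ≤ (N : ℝ)) {M : ℝ} (hM : 0 ≤ M)
    (hMk : ∀ k ≤ N, ∫⁻ y, ENNReal.ofReal |height y k| ∂gibbs V N ≤ ENNReal.ofReal (M * N))
    {η : ℝ} (hη : 0 < η) (hη1 : η < 1) {L : ℝ} (hL : 0 ≤ L) {β : ℝ} (hβ : 0 ≤ β)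
    (hbad : ∫⁻ y, badFrac V K L y ∂gibbs V N ≤ ENNReal.ofReal β) {B : Set (Omega N)}
    (hB : MeasurableSet B) (n m : ℕ) :
    evolve (siteMap V) (m + n) (Measure.dirac x) B ≤ gibbs V N B + ENNReal.ofReal
      (m * (2 * (2 * C + 1) * L * ((1 + M) * N / Real.sin (Real.pi * η / 2) *
        Real.exp (-((1 - η) ^ 2 * lam N * n / ((N - 1 : ℕ) : ℝ))))) + m * β +
        N * Real.exp (-(m / ((N - 1 : ℕ) : ℝ)))) := by
  have := nonempty_sites hN
  have := h.isProbabilityMeasure_gibbs hN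
  have hC := h.cpos
  have hN1 : (0 : ℝ) < ((N - 1 : ℕ) : ℝ) := by exact_mod_cast (by omega : 0 < N - 1)
  have hsin : 0 < Real.sin (Real.pi * η / 2) :=
    Real.sin_pos_of_pos_of_lt_pi (by positivity) (by nlinarith [Real.pi_pos])
  set G := (1 + M) * N / Real.sin (Real.pi * η / 2) *
        Real.exp (-((1 - η) ^ 2 * lam N * n / ((N - 1 : ℕ) : ℝ))) with hG
  have hG0 : 0 ≤ G := by positivity
  set Γ := evolve (twoMap V N) n ((Measure.dirac x).prod (gibbs V N)) with hΓ
  have hgap : ∀ k ≤ N, meanGap Γ k ≤ ENNReal.ofReal G := by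
    intro k hk
    refine h.meanGap_evolve_le_exp hN hη hη1 _ (by positivity) (fun j hj => ?_) n hk
    refine (meanGap_prod_le j).trans ?_
    rw [lintegral_dirac' _ (measurable_height j).abs.ennreal_ofReal, add_mul, one_mul,
      ENNReal.ofReal_add (by positivity) (by positivity)]
    refine add_le_add (ENNReal.ofReal_le_ofReal ?_) (hMk j hj)
    unfold height
    split_ifs with hj'
    · exact hx _
    · simp
  obtain ⟨hfst, hsnd⟩ := map_fst_evolve_prod h hN (ν := Measure.dirac x) (μ := gibbs V N) n
  rw [h.evolve_gibbs hN, ← hΓ] at hsnd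
  rw [← hΓ] at hfst
  have hBm : Measurable (B.indicator (1 : Omega N → ℝ≥0∞)) := measurable_one.indicator hB
  have hmeas := fun i => h.measurable_siteMap (N := N) i
  set F := (stepOp (siteMap V))^[m] (B.indicator (1 : Omega N → ℝ≥0∞)) with hF
  have hFm : Measurable F := measurable_iterate_stepOp hmeas hBm m
  have := isProbabilityMeasure_evolve hmeas n (Measure.dirac x)
  have hlhs : evolve (siteMap V) (m + n) (Measure.dirac x) B = ∫⁻ p, F p.1 ∂Γ := by
    rw [evolve_add, ← lintegral_indicator_one hB, lintegral_evolve hmeas _ m hBm, ← hfst,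
      lintegral_map hFm measurable_fst]
  have hπ : ∫⁻ p, F p.2 ∂Γ = gibbs V N B := by
    rw [← lintegral_map hFm measurable_snd, hsnd, hF, ← lintegral_evolve hmeas _ m hBm,
      h.evolve_gibbs hN, lintegral_indicator_one hB]
  set acc := accumulated (siteMap V) (badFrac (N := N) V K L) m with hacc
  have haccm : Measurable acc := measurable_accumulated hmeas (h.measurable_badFrac L) m
  have hstep : step (siteMap V) (gibbs V N) = gibbs V N := h.evolve_gibbs hN 1
  have hacci : ∫⁻ p, acc p.2 ∂Γ ≤ ENNReal.ofReal (m * β) := by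
    rw [← lintegral_map haccm measurable_snd, hsnd, hacc,
      lintegral_accumulated hmeas (h.measurable_badFrac L) hstep m,
      ENNReal.ofReal_mul (by positivity), ENNReal.ofReal_natCast]
    exact mul_le_mul_right hbad _
  set a := 2 * (2 * C + 1) * L / ((N - 1 : ℕ) : ℝ) with ha
  have ha0 : 0 ≤ a := by positivity
  have hgm : ∀ k : ↥(Finset.Ioo 0 N), Measurable fun p : Omega N × Omega N =>
      ENNReal.ofReal |height p.1 k - height p.2 k| := fun k => measurable_gap (k : ℕ)
  have hdiff : ∫⁻ p : Omega N × Omega N, ENNReal.ofReal a *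
      ∑ k : ↥(Finset.Ioo 0 N), ENNReal.ofReal |height p.1 k - height p.2 k| ∂Γ ≤
        ENNReal.ofReal (2 * (2 * C + 1) * L * G) := by
    rw [lintegral_const_mul _ (Finset.measurable_sum _ fun k _ => hgm k),
      lintegral_finsetSum _ fun k _ => hgm k]
    refine (mul_le_mul_right (Finset.sum_le_sum fun (k : ↥(Finset.Ioo 0 N)) _ =>
      hgap k (Finset.mem_Ioo.1 k.2).2.le) _).trans (le_of_eq ?_)
    rw [Finset.sum_const, Finset.card_univ, card_sites, nsmul_eq_mul, ← ENNReal.ofReal_natCast,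
      ← ENNReal.ofReal_mul hN1.le, ← ENNReal.ofReal_mul ha0]
    congr 1
    rw [ha]; field_simp
  have hdm : Measurable fun p : Omega N × Omega N => ENNReal.ofReal a *
      ∑ k : ↥(Finset.Ioo 0 N), ENNReal.ofReal |height p.1 k - height p.2 k| :=
    (Finset.measurable_sum _ fun k _ => hgm k).const_mul _
  have hF2 : Measurable fun p : Omega N × Omega N => F p.2 := hFm.comp measurable_snd
  have hacc2 : Measurable fun p : Omega N × Omega N => acc p.2 := haccm.comp measurable_snd
  have hFacc : Measurable fun p : Omega N × Omega N => F p.2 + acc p.2 := hF2.add hacc2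
  have hΓp : IsProbabilityMeasure Γ := isProbabilityMeasure_evolve h.measurable_twoMap n _
  have hpt : ∀ p : Omega N × Omega N, F p.1 ≤ (F p.2 + acc p.2) + ((m : ℝ≥0∞) *
      (ENNReal.ofReal a * ∑ k : ↥(Finset.Ioo 0 N), ENNReal.ofReal |height p.1 k - height p.2 k|) +
        ENNReal.ofReal (N * Real.exp (-(m / ((N - 1 : ℕ) : ℝ))))) := by
    intro p
    -- The base point is the stationary copy, so that the bad sites accumulated during smoothing are
    -- counted under the invariant measure.
    have key := h.iterate_stepOp_add_le hN hL hB m p.2 (p.1 - p.2)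
    rw [add_sub_cancel] at key
    refine key.trans ?_
    have e : ENNReal.ofReal (a * ∑ k, |(p.1 - p.2) k|) = ENNReal.ofReal a *
        ∑ k : ↥(Finset.Ioo 0 N), ENNReal.ofReal |height p.1 k - height p.2 k| := by
      rw [ENNReal.ofReal_mul ha0, ENNReal.ofReal_sum_of_nonneg fun k _ => abs_nonneg _]
      simp only [height_coe, Pi.sub_apply]
    have e' : supportCard (p.1 - p.2) * (((N - 1 : ℕ) : ℝ≥0∞)⁻¹ * ((N - 2 : ℕ) : ℝ≥0∞)) ^ m ≤
        ENNReal.ofReal (N * Real.exp (-(m / ((N - 1 : ℕ) : ℝ)))) := by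
      rw [ENNReal.ofReal_mul (by positivity), ENNReal.ofReal_natCast]
      exact mul_le_mul' (supportCard_le _) (untouched_ratio_pow_le hN m)
    rw [e]
    refine (add_le_add le_rfl e').trans (le_of_eq ?_)
    ring
  rw [hlhs]
  refine (lintegral_mono hpt).trans ?_
  rw [lintegral_add_left hFacc, lintegral_add_left hF2, lintegral_add_right _
    measurable_const, lintegral_const_mul _ hdm, lintegral_const, measure_univ, mul_one, hπ,
    add_assoc]
  refine add_le_add le_rfl ?_
  rw [ENNReal.ofReal_add (by positivity) (by positivity),
    ENNReal.ofReal_add (by positivity) (by positivity),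
    ENNReal.ofReal_mul (p := (m : ℝ)) (by positivity), ENNReal.ofReal_natCast]
  calc _ ≤ ENNReal.ofReal (m * β) + (m * ENNReal.ofReal (2 * (2 * C + 1) * L * G) +
        ENNReal.ofReal (N * Real.exp (-(m / ((N - 1 : ℕ) : ℝ))))) := by gcongr
    _ = _ := by ring

end GradPhi
end

/-! ### Return to continuous time, and the number of updates. -/

noncomputable section
namespace GradPhi

variable {V : ℝ → ℝ} {κ C : ℝ} {K N : ℕ} {am ap κm Cm κp Cp : ℝ} {Km Kp : ℕ}

/-- The product of `1 - x + x ^ 2 / 2` and `1 + x + x ^ 2 / 2` is `1 + x ^ 4 / 4`, hence at least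
one. -/
lemma exp_neg_le_quadratic {x : ℝ} (hx : 0 ≤ x) : Real.exp (-x) ≤ 1 - x + x ^ 2 / 2 := by
  have h1 := Real.quadratic_le_exp_of_nonneg hx
  have h2 : 0 < 1 - x + x ^ 2 / 2 := by nlinarith [sq_nonneg (x - 1)]
  rw [Real.exp_neg, inv_le_comm₀ (Real.exp_pos x) h2]
  refine le_trans ?_ h1
  rw [inv_le_iff_one_le_mul₀ h2]
  nlinarith [sq_nonneg (x ^ 2)]

lemma lam_le (hN : 2 ≤ N) : lam N ≤ 5 / (N : ℝ) ^ 2 := by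
  have hN0 : (0 : ℝ) < N := by exact_mod_cast (by omega : 0 < N)
  have h1 := Real.one_sub_sq_div_two_le_cos (x := Real.pi / N)
  have hpi : Real.pi ^ 2 ≤ 10 := by nlinarith [Real.pi_lt_d2, Real.pi_pos]
  unfold lam
  rw [div_pow] at h1
  have : Real.pi ^ 2 / (N : ℝ) ^ 2 ≤ 10 / (N : ℝ) ^ 2 := by gcongr
  have e : (10 : ℝ) / (N : ℝ) ^ 2 = 2 * (5 / (N : ℝ) ^ 2) := by ring
  linarith

/-- Passage from a deterministic number of updates to a Poisson one. -/
lemma Coercive.law_le_of_evolve_le (h : Coercive V κ C K) (hN : 2 ≤ N) {t : ℝ≥0} {η : ℝ}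
    (hη : 0 < η) {x : Omega N} {B : Set (Omega N)} (hB : MeasurableSet B) {q : ℝ≥0∞}
    (hq : ∀ n : ℕ, (1 - η) * (((N - 1 : ℕ) : ℝ) * t) ≤ n →
      evolve (siteMap V) n (Measure.dirac x) B ≤ q) :
    law V N t x B ≤ q + ENNReal.ofReal (Real.exp (-(((N - 1 : ℕ) : ℝ) * t * η ^ 2 / 2))) := by
  have := nonempty_sites hN
  set μ : ℝ := ((N - 1 : ℕ) : ℝ) * t with hμ
  have hμ0 : 0 ≤ μ := by positivity
  have hmeas := fun i => h.measurable_siteMap (N := N) i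
  rw [h.law_apply hN t x hB]
  have hpt : ∀ n : ℕ, ENNReal.ofReal (poisW μ n) * evolve (siteMap V) n (Measure.dirac x) B ≤
      ENNReal.ofReal (poisW μ n) * q +
        (if -η * ((1 - η) * μ) ≤ -η * n then ENNReal.ofReal (poisW μ n) else 0) := by
    intro n
    rcases le_total ((1 - η) * μ) n with hn | hn
    · exact (mul_le_mul_right (hq n hn) _).trans le_self_add
    · rw [if_pos (by nlinarith)]
      have := isProbabilityMeasure_evolve hmeas n (Measure.dirac x)
      exact (mul_le_of_le_one_right' prob_le_one).trans le_add_self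
  refine (ENNReal.tsum_le_tsum hpt).trans ?_
  rw [ENNReal.tsum_add, ENNReal.tsum_mul_right, tsum_poisW hμ0, one_mul]
  -- Lower tail with `θ = -η`: the exponent `η (1 - η) μ + μ (exp (-η) - 1)` is at most `-μ η ^ 2 /
  -- 2`.
  refine add_le_add le_rfl ((poisson_tail hμ0 (-η) ((1 - η) * μ)).trans ?_)
  apply ENNReal.ofReal_le_ofReal (Real.exp_le_exp.2 _)
  nlinarith [mul_le_mul_of_nonneg_left (exp_neg_le_quadratic hη.le) hμ0]

/-- The error in the convergence to equilibrium, as a function of the size. -/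
def mixingError (A A' γ δ η : ℝ) (N : ℕ) : ℝ :=
  A * (N : ℝ) ^ (-(δ / 4)) + A' * (N : ℝ) ^ (-1 : ℝ) + N * Real.exp (-(N : ℝ) ^ γ) +
    Real.exp (-(N * η ^ 2 / 2))

lemma tendsto_mixingError (A A' : ℝ) {γ δ η : ℝ} (hγ : 0 < γ) (hδ : 0 < δ) (hη : 0 < η) :
    Tendsto (mixingError A A' γ δ η) atTop (𝓝 0) := by
  have hc : Tendsto (fun N : ℕ => (N : ℝ)) atTop atTop := tendsto_natCast_atTop_atTop
  have t1 : Tendsto (fun N : ℕ => A * (N : ℝ) ^ (-(δ / 4))) atTop (𝓝 (A * 0)) :=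
    ((tendsto_rpow_neg_atTop (by positivity)).comp hc).const_mul A
  have t2 : Tendsto (fun N : ℕ => A' * (N : ℝ) ^ (-1 : ℝ)) atTop (𝓝 (A' * 0)) :=
    ((tendsto_rpow_neg_atTop one_pos).comp hc).const_mul A'
  have t3 : Tendsto (fun N : ℕ => (N : ℝ) * Real.exp (-(N : ℝ) ^ γ)) atTop (𝓝 0) := by
    have hs : Tendsto (fun y : ℝ => y ^ (1 / γ) * Real.exp (-1 * y)) atTop (𝓝 0) :=
      tendsto_rpow_mul_exp_neg_mul_atTop_nhds_zero _ _ one_pos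
    refine (hs.comp ((tendsto_rpow_atTop hγ).comp hc)).congr fun N => ?_
    simp only [Function.comp_apply]
    rw [← Real.rpow_mul (by positivity), mul_one_div_cancel hγ.ne', Real.rpow_one, neg_one_mul]
  have t4 : Tendsto (fun N : ℕ => Real.exp (-(N * η ^ 2 / 2))) atTop (𝓝 0) := by
    refine Real.tendsto_exp_neg_atTop_nhds_zero.comp ?_
    have e : ∀ N : ℕ, (N : ℝ) * η ^ 2 / 2 = N * (η ^ 2 / 2) := fun N => by ring
    simp_rw [e]
    exact hc.atTop_mul_const (by positivity)
  unfold mixingError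
  simpa using ((t1.add t2).add t3).add t4

/-- The number of updates is at least of order `N ^ 3 * log N`, so the at most `2 N ^ 2` reserved
for smoothing change the exponent only by a bounded amount, hence the factor `exp 20`. The relation
between `η` and `δ` gives `(1 - 3 η) (2 + δ) = 2 + δ / 2`: three factors `1 - η` are lost, one from
the Poisson fluctuation and two from the lowered frequency. -/
lemma update_count_bounds (hN : 12 ≤ N) (hlog : 1 ≤ Real.log N) {γ δ η : ℝ} (hγ1 : γ ≤ 1)
    (hδ : 0 < δ) (hη : 0 < η) (hη' : η * (6 * (2 + δ)) = δ) {n : ℕ}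
    (hn : (1 - η) * (((N - 1 : ℕ) : ℝ) * ((2 + δ) / lam N * Real.log N)) ≤ n) :
    ⌈(N : ℝ) ^ (1 + γ)⌉₊ ≤ n ∧
      Real.exp (-((1 - η) ^ 2 * lam N * ((n - ⌈(N : ℝ) ^ (1 + γ)⌉₊ : ℕ) : ℝ) /
        ((N - 1 : ℕ) : ℝ))) ≤ Real.exp 20 * (N : ℝ) ^ (-(2 + δ / 2)) := by
  have hx : (12 : ℝ) ≤ N := by exact_mod_cast hN
  have hl0 := lam_pos (show 2 ≤ N by omega)
  have hl5 := lam_le (show 2 ≤ N by omega)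
  have hη6 : η < 1 / 6 := by nlinarith
  have hN1 : ((N - 1 : ℕ) : ℝ) = N - 1 := by rw [Nat.cast_sub (by omega), Nat.cast_one]
  set x := (N : ℝ) with hxdef
  set l := lam N
  set m := ⌈x ^ (1 + γ)⌉₊ with hm
  rw [hN1] at hn ⊢
  have hmle : (m : ℝ) ≤ 2 * x ^ 2 := by
    have h1 : x ^ (1 + γ) ≤ x ^ 2 := by
      rw [← Real.rpow_natCast x 2]
      exact Real.rpow_le_rpow_of_exponent_le (by linarith) (by push_cast; linarith)
    have h2 := (Nat.ceil_lt_add_one (show 0 ≤ x ^ (1 + γ) by positivity)).le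
    nlinarith
  have hlx : l * x ^ 2 ≤ 5 := by
    rwa [le_div_iff₀ (by positivity)] at hl5
  have hinv : x ^ 2 / 5 ≤ 1 / l := by
    rw [div_le_div_iff₀ (by norm_num) hl0]; linarith
  have hmn : (m : ℝ) ≤ n := by
    refine le_trans ?_ hn
    have h1 : 2 * (x ^ 2 / 5) * 1 ≤ (2 + δ) / l * Real.log x := by
      rw [div_eq_mul_one_div (2 + δ)]
      gcongr
      linarith
    have h2 : (11 / 12 * x) * (2 * (x ^ 2 / 5) * 1) ≤ (x - 1) * ((2 + δ) / l * Real.log x) := by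
      apply mul_le_mul _ h1 (by positivity) (by linarith)
      linarith
    have h3 : (5 / 6 : ℝ) * ((11 / 12 * x) * (2 * (x ^ 2 / 5) * 1)) ≤
        (1 - η) * ((x - 1) * ((2 + δ) / l * Real.log x)) :=
      mul_le_mul (by linarith) h2 (by positivity) (by linarith)
    have h4 : 12 * x ^ 2 ≤ x * x ^ 2 := by gcongr
    nlinarith
  have hmn' : m ≤ n := by exact_mod_cast hmn
  refine ⟨hmn', ?_⟩
  rw [Nat.cast_sub hmn', Real.rpow_def_of_pos (by linarith), ← Real.exp_add]
  apply Real.exp_le_exp.2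
  have hx1 : 0 < x - 1 := by linarith
  have hmain : (1 - η) * ((2 + δ) * Real.log x) - 20 ≤ l * (n - m) / (x - 1) := by
    rw [le_div_iff₀ hx1]
    have h1 : (1 - η) * ((2 + δ) * Real.log x) * (x - 1) ≤ l * n := by
      have := mul_le_mul_of_nonneg_left hn hl0.le
      refine le_trans (le_of_eq ?_) this
      field_simp
    have h2 : l * m ≤ 10 := by nlinarith
    nlinarith
  have hη2 : (1 - η) ^ 2 ≤ 1 := by nlinarith
  have hsq := mul_le_mul_of_nonneg_left hmain (sq_nonneg (1 - η))
  have hcube : (2 + δ / 2) * Real.log x ≤ (1 - η) ^ 2 * ((1 - η) * ((2 + δ) * Real.log x)) := by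
    have h3 : 1 - 3 * η ≤ (1 - η) ^ 3 := by nlinarith
    have h4 : 2 + δ / 2 ≤ (1 - η) ^ 3 * (2 + δ) := by nlinarith
    have := mul_le_mul_of_nonneg_right h4 (by linarith : 0 ≤ Real.log x)
    linarith
  have e : (1 - η) ^ 2 * l * (n - m) / (x - 1) = (1 - η) ^ 2 * (l * (n - m) / (x - 1)) := by ring
  rw [e]
  linarith

end GradPhi
end

/-! ### Choice of the exponents and the upper bound. -/

noncomputable section
namespace GradPhi

variable {V : ℝ → ℝ} {κ C : ℝ} {K N : ℕ} {am ap κm Cm κp Cp : ℝ} {Km Kp : ℕ}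

/-- Power counting: `x ^ (1 + γ)` updates, moment level `x ^ γ`, and mean gaps `x * x ^ (-(2 + δ /
2))` give `x ^ (2 γ - δ / 2)`; the bound `γ ≤ δ / 8` leaves half of the gain. -/
lemma smoothing_error_le {x m c M s X γ δ : ℝ} (hx : 1 ≤ x) (hγδ : γ ≤ δ / 8)
    (hc : 0 ≤ c) (hM : 0 ≤ M) (hs : 0 < s) (hm : m ≤ 2 * x ^ (1 + γ))
    (hX0 : 0 ≤ X) (hX : X ≤ Real.exp 20 * x ^ (-(2 + δ / 2))) :
    m * (c * x ^ γ * ((1 + M) * x / s * X)) ≤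
      2 * c * (1 + M) / s * Real.exp 20 * x ^ (-(δ / 4)) := by
  have hx0 : 0 < x := by linarith
  have e : x ^ (1 + γ) * x ^ γ * x * x ^ (-(2 + δ / 2)) = x ^ (2 * γ - δ / 2) := by
    nth_rewrite 3 [← Real.rpow_one x]
    rw [← Real.rpow_add hx0, ← Real.rpow_add hx0, ← Real.rpow_add hx0]
    congr 1; ring
  calc m * (c * x ^ γ * ((1 + M) * x / s * X))
      ≤ 2 * x ^ (1 + γ) * (c * x ^ γ * ((1 + M) * x / s *
          (Real.exp 20 * x ^ (-(2 + δ / 2))))) := by gcongr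
    _ = 2 * c * (1 + M) / s * Real.exp 20 *
          (x ^ (1 + γ) * x ^ γ * x * x ^ (-(2 + δ / 2))) := by ring
    _ = 2 * c * (1 + M) / s * Real.exp 20 * x ^ (2 * γ - δ / 2) := by rw [e]
    _ ≤ _ := by
      have : x ^ (2 * γ - δ / 2) ≤ x ^ (-(δ / 4)) :=
        Real.rpow_le_rpow_of_exponent_le hx (by linarith)
      gcongr

lemma bad_error_le {x m M γ : ℝ} (hx : 1 ≤ x) (hM : 0 ≤ M) {i : ℕ}
    (hi : 2 + γ ≤ γ * ((i + 1 : ℕ) : ℝ)) (hm : m ≤ 2 * x ^ (1 + γ)) :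
    m * (M * (2 / x ^ γ) ^ (i + 1)) ≤ 2 * M * 2 ^ (i + 1) * x ^ (-1 : ℝ) := by
  have hx0 : 0 < x := by linarith
  have e : (2 / x ^ γ) ^ (i + 1) = 2 ^ (i + 1) * x ^ (-(γ * ((i + 1 : ℕ) : ℝ))) := by
    rw [div_pow, ← Real.rpow_natCast (x ^ γ), ← Real.rpow_mul hx0.le, Real.rpow_neg hx0.le,
      div_eq_mul_inv]
  rw [e]
  calc m * (M * (2 ^ (i + 1) * x ^ (-(γ * ((i + 1 : ℕ) : ℝ)))))
      ≤ 2 * x ^ (1 + γ) * (M * (2 ^ (i + 1) * x ^ (-(γ * ((i + 1 : ℕ) : ℝ))))) := by gcongr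
    _ = 2 * M * 2 ^ (i + 1) * (x ^ (1 + γ) * x ^ (-(γ * ((i + 1 : ℕ) : ℝ)))) := by ring
    _ = 2 * M * 2 ^ (i + 1) * x ^ (1 + γ - γ * ((i + 1 : ℕ) : ℝ)) := by
      rw [← Real.rpow_add hx0, ← sub_eq_add_neg]
    _ ≤ _ := by
      have : x ^ (1 + γ - γ * ((i + 1 : ℕ) : ℝ)) ≤ x ^ (-1 : ℝ) :=
        Real.rpow_le_rpow_of_exponent_le hx (by linarith)
      gcongr

/-- With `x ^ (1 + γ)` updates each site receives at least `x ^ γ` on average, and the factor `x` is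
the union bound over sites. -/
lemma untouched_error_le {x m γ : ℝ} (hx : 1 < x) (hm : x ^ (1 + γ) ≤ m) :
    x * Real.exp (-(m / (x - 1))) ≤ x * Real.exp (-x ^ γ) := by
  have hx0 : 0 < x := by linarith
  have : x ^ γ ≤ m / (x - 1) := by
    rw [le_div_iff₀ (by linarith)]
    rw [add_comm, Real.rpow_add_one hx0.ne'] at hm
    have : 0 < x ^ γ := by positivity
    nlinarith
  gcongr

/-- The upper bound on the mixing time. -/
theorem upper_bound (h : Coercive V κ C K)
    (hm : Coercive (fun x => V x - am * x) κm Cm Km)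
    (hp : Coercive (fun x => V x - ap * x) κp Cp Kp) (hle : am ≤ ap)
    (hm0 : ∫ x, x * bondW V am x < 0) (hp0 : 0 < ∫ x, x * bondW V ap x) {δ ε : ℝ}
    (hδ : 0 < δ) (hε : 0 < ε) :
    ∃ N₀ : ℕ, ∀ N ≥ N₀, mixingTime V N ε ≤
      ENNReal.ofReal ((2 + δ) / lam N * Real.log N) := by
  obtain ⟨r, -, S, -, N₁, hN₁⟩ := exists_isTentLaw hm hp hle hm0 hp0
  -- The same exponent sets the length `N ^ (1 + γ)` of the smoothing phase and the level `L = N ^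
  -- γ` of admissible heat-bath moments.
  set γ := min 1 (δ / 8) with hγdef
  have hγ : 0 < γ := lt_min one_pos (by positivity)
  have hγ1 : γ ≤ 1 := min_le_left _ _
  have hγδ : γ ≤ δ / 8 := min_le_right _ _
  set η := δ / (6 * (2 + δ)) with hηdef
  have hη : 0 < η := by positivity
  have hη' : η * (6 * (2 + δ)) = δ := div_mul_cancel₀ _ (by positivity)
  have hη1 : η < 1 := by nlinarith
  -- The moment order is chosen so that the bad sites met in `N ^ (1 + γ)` updates contribute at
  -- most a multiple of `N ^ (-1)`.
  obtain ⟨i, hi⟩ := exists_nat_ge ((2 + γ) / γ)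
  have hi' : 2 + γ ≤ γ * ((i + 1 : ℕ) : ℝ) := by
    rw [div_le_iff₀ hγ] at hi
    push_cast
    nlinarith
  -- Only the bound on the heights is needed here, so the order of the increment moments is
  -- immaterial.
  obtain ⟨M, hM, hMom⟩ := exists_gibbs_moments h hm hp 0
  obtain ⟨M', hM', hBad⟩ := exists_lintegral_badFrac_le h hm hp i
  have hC := h.cpos
  set s := Real.sin (Real.pi * η / 2) with hsdef
  have hs : 0 < s := Real.sin_pos_of_pos_of_lt_pi (by positivity) (by nlinarith [Real.pi_pos])
  set c := 2 * (2 * C + 1) with hc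
  set A := 2 * c * (1 + M) / s * Real.exp 20
  set A' := 2 * M' * 2 ^ (i + 1)
  have hlim := (tendsto_mixingError A A' hγ hδ hη).eventually (gt_mem_nhds hε)
  have hlog : ∀ᶠ N : ℕ in atTop, 1 ≤ Real.log N :=
    (Real.tendsto_log_atTop.comp tendsto_natCast_atTop_atTop).eventually_ge_atTop 1
  obtain ⟨N₀, hN₀⟩ := eventually_atTop.1 ((hlim.and hlog).and
    ((eventually_ge_atTop N₁).and (eventually_ge_atTop 12)))
  refine ⟨N₀, fun N hN => ?_⟩
  obtain ⟨⟨herr, hlogN⟩, hNN₁, hN12⟩ := hN₀ N hN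
  obtain ⟨ν, hν⟩ := hN₁ N hNN₁
  have hN2 : 2 ≤ N := by omega
  have hx : (12 : ℝ) ≤ N := by exact_mod_cast hN12
  have hl0 := lam_pos hN2
  have hN1 : ((N - 1 : ℕ) : ℝ) = N - 1 := by rw [Nat.cast_sub (by omega), Nat.cast_one]
  have hT0 : 0 ≤ (2 + δ) / lam N * Real.log N := by positivity
  set T : ℝ≥0 := ⟨(2 + δ) / lam N * Real.log N, hT0⟩ with hT
  have hTe : ENNReal.ofReal ((2 + δ) / lam N * Real.log N) = T := ENNReal.ofReal_eq_coe_nnreal hT0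
  rw [hTe]
  have hdist : worstDist V N T ≤ ENNReal.ofReal (mixingError A A' γ δ η N) → mixingTime V N ε ≤ T :=
    fun hd => (iInf_le _ T).trans
      (iInf_le _ (hd.trans_lt ((ENNReal.ofReal_lt_ofReal_iff hε).2 herr)))
  apply hdist
  refine iSup₂_le fun x hxN => iSup₂_le fun B hB => ?_
  rw [tsub_le_iff_left]
  set m := ⌈(N : ℝ) ^ (1 + γ)⌉₊ with hmdef
  have hm1 : (N : ℝ) ^ (1 + γ) ≤ m := Nat.le_ceil _
  have hm2 : (m : ℝ) ≤ 2 * (N : ℝ) ^ (1 + γ) := by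
    have a := (Nat.ceil_lt_add_one (show 0 ≤ (N : ℝ) ^ (1 + γ) by positivity)).le
    have b := Real.one_le_rpow (x := (N : ℝ)) (z := 1 + γ) (by linarith) (by linarith)
    linarith
  have hq : ∀ n : ℕ, (1 - η) * (((N - 1 : ℕ) : ℝ) * T) ≤ n →
      evolve (siteMap V) n (Measure.dirac x) B ≤ gibbs V N B + ENNReal.ofReal
        (A * (N : ℝ) ^ (-(δ / 4)) + A' * (N : ℝ) ^ (-1 : ℝ) + N * Real.exp (-(N : ℝ) ^ γ)) := by
    intro n hn
    obtain ⟨hmn, hexp⟩ := update_count_bounds hN12 hlogN hγ1 hδ hη hη' hn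
    have key := h.evolve_dirac_le hN2 hxN hM (hMom N r S ν hN2 hν).2 hη hη1
      (L := (N : ℝ) ^ γ) (by positivity) (β := M' * (2 / (N : ℝ) ^ γ) ^ (i + 1)) (by positivity)
      (hBad N r S ν hN2 hν _ (by positivity)) hB (n - m) m
    rw [Nat.add_sub_cancel' hmn] at key
    refine key.trans (add_le_add le_rfl (ENNReal.ofReal_le_ofReal ?_))
    refine add_le_add (add_le_add ?_ ?_) ?_
    · exact smoothing_error_le (by linarith) hγδ (by positivity) hM hs hm2
        (by positivity) hexp
    · exact bad_error_le (by linarith) hM' hi' hm2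
    · rw [hN1]; exact untouched_error_le (by linarith) hm1
  refine (h.law_le_of_evolve_le hN2 hη hB hq).trans ?_
  rw [add_assoc, ← ENNReal.ofReal_add (by positivity) (by positivity)]
  refine add_le_add le_rfl (ENNReal.ofReal_le_ofReal (add_le_add le_rfl ?_))
  have hTN : (N : ℝ) ≤ ((N - 1 : ℕ) : ℝ) * T := by
    have h1 : 2 ≤ (T : ℝ) := by
      change 2 ≤ (2 + δ) / lam N * Real.log N
      have : 2 ≤ (2 + δ) / lam N := by
        rw [le_div_iff₀ hl0]
        have := lam_le hN2
        have : (5 : ℝ) / (N : ℝ) ^ 2 ≤ 1 := by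
          rw [div_le_one (by positivity)]; nlinarith
        linarith
      nlinarith
    rw [hN1]; nlinarith
  gcongr

/-- Existence of a pre-cutoff, from bounds on the mixing times of the same order. -/
lemma limsup_div_le {T T' : ℕ → ℝ≥0∞} {a b : ℝ} (hb : 0 < b) {g : ℕ → ℝ}
    (hg : ∀ᶠ N in atTop, 0 < g N) (hT : ∀ᶠ N in atTop, T N ≤ ENNReal.ofReal (a * g N))
    (hT' : ∀ᶠ N in atTop, ENNReal.ofReal (b * g N) ≤ T' N) :
    limsup (fun N => T N / T' N) atTop ≤ ENNReal.ofReal (a / b) := by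
  refine limsup_le_of_le (by isBoundedDefault) ?_
  filter_upwards [hg, hT, hT'] with N h1 h2 h3
  refine (ENNReal.div_le_div h2 h3).trans (le_of_eq ?_)
  rw [← ENNReal.ofReal_div_of_pos (by positivity)]
  congr 1
  field_simp

end GradPhi
end

/-! ### Assembly for the original potential. -/

theorem corollary4p3 (V : ℝ → ℝ) (hV : GradPhi.IsAdmissible V) :
    -- the upper bound on the mixing time
    (∀ δ : ℝ, 0 < δ → ∀ ε : ℝ, ε ∈ Set.Ioo (0 : ℝ) 1 → ∃ N₀ : ℕ, ∀ N : ℕ, N₀ ≤ N →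
      GradPhi.mixingTime V N ε ≤
        ENNReal.ofReal ((2 + δ) / GradPhi.lam N * Real.log (N : ℝ))) ∧
    -- it is of the correct order
    (∃ c : ℝ, 0 < c ∧ ∀ ε : ℝ, ε ∈ Set.Ioo (0 : ℝ) 1 → ∃ N₀ : ℕ, ∀ N : ℕ, N₀ ≤ N →
      ENNReal.ofReal (c / GradPhi.lam N * Real.log (N : ℝ)) ≤ GradPhi.mixingTime V N ε) ∧
    -- pre-cutoff
    (∃ C : ℝ≥0, ∀ ε : ℝ, ε ∈ Set.Ioo (0 : ℝ) (1 / 2) →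
      Filter.limsup (fun N : ℕ => GradPhi.mixingTime V N ε / GradPhi.mixingTime V N (1 - ε))
        Filter.atTop ≤ (C : ℝ≥0∞)) := by
  obtain ⟨a, am, ap, hle, ⟨κ, C, K, h⟩, ⟨κm, Cm, Km, hm⟩, ⟨κp, Cp, Kp, hp⟩, hm0, hp0⟩ :=
    hV.exists_tilts
  have upper : ∀ δ ε : ℝ, 0 < δ → 0 < ε → ∃ N₀ : ℕ, ∀ N : ℕ, N₀ ≤ N →
      GradPhi.mixingTime V N ε ≤ ENNReal.ofReal ((2 + δ) / GradPhi.lam N * Real.log (N : ℝ)) := by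
    intro δ ε hδ hε
    rw [← GradPhi.mixingTime_tilt V a]
    exact GradPhi.upper_bound h hm hp hle hm0 hp0 hδ hε
  have lower : ∀ ε : ℝ, ε < 1 → ∃ N₀ : ℕ, ∀ N : ℕ, N₀ ≤ N →
      ENNReal.ofReal (1 / 16 / GradPhi.lam N * Real.log (N : ℝ)) ≤ GradPhi.mixingTime V N ε := by
    intro ε hε
    rw [← GradPhi.mixingTime_tilt V a]
    exact GradPhi.lower_bound h hm hp hle hm0 hp0 hε
  refine ⟨fun δ hδ ε hε => upper δ ε hδ hε.1,
    ⟨1 / 16, by norm_num, fun ε hε => lower ε hε.2⟩, (3 / (1 / 16) : ℝ≥0), fun ε hε => ?_⟩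
  -- With `δ = 1` the constants are `3` above, at level `ε`, and `1 / 16` below, at level `1 - ε`;
  -- neither depends on `ε`, and their ratio bounds the limsup.
  have hu := eventually_atTop.2 (upper 1 ε one_pos hε.1)
  have hl := eventually_atTop.2 (lower (1 - ε) (by linarith [hε.1]))
  have hg : ∀ᶠ N : ℕ in atTop, 0 < 1 / GradPhi.lam N * Real.log (N : ℝ) := by
    filter_upwards [eventually_ge_atTop 2] with N hN
    have := GradPhi.lam_pos hN
    have : 0 < Real.log (N : ℝ) := Real.log_pos (by exact_mod_cast hN)
    positivity
  have e : ((3 / (1 / 16) : ℝ≥0) : ℝ≥0∞) = ENNReal.ofReal (3 / (1 / 16)) := by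
    rw [ENNReal.ofReal, ENNReal.coe_inj]
    ext
    rw [Real.coe_toNNReal _ (by norm_num)]
    norm_num
  rw [e]
  refine GradPhi.limsup_div_le (by norm_num) hg (hu.mono fun N h => h.trans (le_of_eq ?_))
    (hl.mono fun N h => (le_of_eq ?_).trans h) <;> congr 1 <;> ring
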